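/- Let $G=\mathbb R^{2n+1}=\mathbb R^{2n}\times\mathbb R$ be the Heisenberg group, with group law $(x,t)(y,s)=(x+y,\,t+s+\tfrac12\omega(x,y))$, where $\omega(x,y)=\sum_{i=1}^n (x_iy_{n+i}-x_{n+i}y_i)$, dilations $\delta_\lambda(x,t)=(\lambda x,\lambda^2t)$ for $\lambda>0$, and homogeneous dimension $Q=2n+2$. A distribution $u$ on $G$ is homogeneous of degree $d$ if $\langle u,\varphi\circ\delta_\lambda\rangle=\lambda^{-Q-d}\langle u,\varphi\rangle$ for all $\lambda>0$ and all test functions $\varphi$. It is regular if its restriction to $G\setminus\{0\}$ is a smooth function; its values at points $z\neq0$ are those of this function. Let $\mathscr S_H(G)$ be the space of principal Heisenberg symbols of order zero, that is, of regular tempered distributions $k$ on $G$ that are homogeneous of degree $-Q$. For a central element $z\ne0$ of $G$ put $\tau_z(k)=k(z)$. Let $\hat k$ be the Fourier transform of $k\in\mathscr S_H(G)$, with the convention $\hat\varphi(y,s)=\int \varphi(x,t)e^{-i(x\cdot y+ts)}\,dx\,dt$ for Schwartz functions, extended to tempered distributions by $\langle\hat k,\varphi\rangle=\langle k,\hat\varphi\rangle$.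 Then $\hat k$ is a smooth function on $\mathbb R^{2n+1}\setminus\{0\}$. Put $\sigma_\pm(x)=\hat k(x,\pm1)$ for $x\in\mathbb R^{2n}$. There are asymptotic expansions, for $\|x\|\to\infty$, $$\sigma_+(x)\sim\sum_{l=0}^\infty w_{2l}(x),\qquad \sigma_-(x)\sim\sum_{l=0}^\infty(-1)^lw_{2l}(x),$$ with $w_{2l}$ smooth on $\mathbb R^{2n}\setminus\{0\}$ and homogeneous of degree $-2l$. The function $$\mathcal R=\sigma_+-(-1)^n\sigma_--\sum_{l=0}^{n-1}\bigl(1-(-1)^{n+l}\bigr)w_{2l}$$ is integrable on $\mathbb R^{2n}$. Define $$\tau(k)=\frac1{(2\pi)^n}\int_{\mathbb R^{2n}}\mathcal R(x)\,dx .$$ Then, as functionals on $\mathscr S_H(G)$, $$\tau=\frac{(2\pi)^{n+1}}{2\,n!\,i^{\,n+1}}\Bigl(\tau_{(0,+1)}-(-1)^n\,\tau_{(0,-1)}\Bigr).$$ -/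

import Mathlib

open MeasureTheory Set Filter Asymptotics Bornology
open scoped SchwartzMap FourierTransform ContDiff Topology

noncomputable section

/-! ### The Heisenberg group -/

/-- The horizontal layer `ℝ^{2n}` with its Euclidean structure: the coordinates `x_1, …, x_n` are
`x (Sum.inl i)` and the coordinates `x_{n+1}, …, x_{2n}` are `x (Sum.inr i)`. -/
abbrev Horiz (n : ℕ) : Type := EuclideanSpace ℝ (Fin n ⊕ Fin n)

/-- The space `ℝ^{2n+1} = ℝ^{2n} × ℝ`, with points `(x, t)` and the Euclidean inner product
`⟪(x, t), (y, s)⟫ = x y + t s`. -/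
abbrev Heis (n : ℕ) : Type := WithLp 2 (Horiz n × ℝ)

/-- The point `(x, t)`. -/
def heisPt {n : ℕ} (x : Horiz n) (t : ℝ) : Heis n := WithLp.toLp 2 (x, t)

/-- The standard symplectic form on `ℝ^{2n}`. -/
def symp {n : ℕ} (x y : Horiz n) : ℝ :=
  ∑ i : Fin n, (x (Sum.inl i) * y (Sum.inr i) - x (Sum.inr i) * y (Sum.inl i))

/-- The Heisenberg group law `(x, t) (y, s) = (x + y, t + s + ω(x, y) / 2)`. It is written
multiplicatively; the additive structure of `Heis n` remains that of the vector space. -/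
instance heisGroup (n : ℕ) : Group (Heis n) :=
  { mul := fun a b => heisPt (a.fst + b.fst) (a.snd + b.snd + 1 / 2 * symp a.fst b.fst)
    one := 0
    inv := fun a => -a
    mul_assoc := by
      intro a b c
      change heisPt (a.fst + b.fst + c.fst)
          (a.snd + b.snd + 1 / 2 * symp a.fst b.fst + c.snd + 1 / 2 * symp (a.fst + b.fst) c.fst)
        = heisPt (a.fst + (b.fst + c.fst))
          (a.snd + (b.snd + c.snd + 1 / 2 * symp b.fst c.fst)
            + 1 / 2 * symp a.fst (b.fst + c.fst))
      have h1 : symp (a.fst + b.fst) c.fst = symp a.fst c.fst + symp b.fst c.fst := by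
        simp only [symp, ← Finset.sum_add_distrib, PiLp.add_apply]
        exact Finset.sum_congr rfl fun i _ => by ring
      have h2 : symp a.fst (b.fst + c.fst) = symp a.fst b.fst + symp a.fst c.fst := by
        simp only [symp, ← Finset.sum_add_distrib, PiLp.add_apply]
        exact Finset.sum_congr rfl fun i _ => by ring
      rw [h1, h2, add_assoc a.fst]
      congr 1
      ring
    one_mul := by
      intro a
      change heisPt (0 + a.fst) (0 + a.snd + 1 / 2 * symp 0 a.fst) = a
      simp [symp, heisPt]
      rfl
    mul_one := by
      intro a
      change heisPt (a.fst + 0) (a.snd + 0 + 1 / 2 * symp a.fst 0) = a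
      simp [symp, heisPt]
      rfl
    inv_mul_cancel := by
      intro a
      change heisPt (-a.fst + a.fst) (-a.snd + a.snd + 1 / 2 * symp (-a.fst) a.fst) = 0
      have h : symp (-a.fst) a.fst = 0 := by
        simp only [symp, PiLp.neg_apply]
        exact Finset.sum_eq_zero fun i _ => by ring
      rw [h]
      simp [heisPt] }

/-- The central elements `z ≠ 0` of the Heisenberg group. -/
abbrev CentralPt (n : ℕ) : Type := {z : Heis n // z ∈ Subgroup.center (Heis n) ∧ z ≠ 0}

/-- The central element `(0, s)`, for `s ≠ 0`. -/
def centralPt (n : ℕ) (s : ℝ) (hs : s ≠ 0) : CentralPt n :=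
  ⟨heisPt 0 s, by
    rw [Subgroup.mem_center_iff]
    intro g
    change heisPt (g.fst + 0) (g.snd + s + 1 / 2 * symp g.fst 0)
      = heisPt (0 + g.fst) (s + g.snd + 1 / 2 * symp 0 g.fst)
    simp [symp, add_comm], fun h => hs (by simpa [heisPt] using congrArg WithLp.snd h)⟩

/-- The dilation `δ_r (x, t) = (r x, r² t)`, for `r ≠ 0` (used for `r > 0`). -/
def dilation (n : ℕ) (r : ℝ) (hr : r ≠ 0) : Heis n ≃L[ℝ] Heis n :=
  ((WithLp.prodContinuousLinearEquiv 2 ℝ (Horiz n) ℝ).trans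
    ((ContinuousLinearEquiv.smulLeft (Units.mk0 r hr)).prodCongr
      (ContinuousLinearEquiv.smulLeft (Units.mk0 (r ^ 2) (pow_ne_zero 2 hr))))).trans
    (WithLp.prodContinuousLinearEquiv 2 ℝ (Horiz n) ℝ).symm

theorem dilation_apply (n : ℕ) (r : ℝ) (hr : r ≠ 0) (x : Horiz n) (t : ℝ) :
    dilation n r hr (heisPt x t) = heisPt (r • x) (r ^ 2 * t) := rfl

/-- The homogeneous dimension `Q = 1 · 2n + 2 · 1` of the Heisenberg group. -/
def homDim (n : ℕ) : ℕ := 2 * n + 2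

/-! ### Distributions -/

/-- A distribution `u` on `ℝ^{2n+1}` is homogeneous of degree `d` if
`⟨u, φ ∘ δ_r⟩ = r^{-Q-d} ⟨u, φ⟩` for all `r > 0`. -/
def IsHomogeneousDistribution {n : ℕ} (d : ℤ) (u : 𝓢'(Heis n, ℂ)) : Prop :=
  ∀ (r : ℝ) (hr : 0 < r) (φ : 𝓢(Heis n, ℂ)),
    u (SchwartzMap.compCLMOfContinuousLinearEquiv ℂ (dilation n r hr.ne') φ) =
      (r : ℂ) ^ (-(homDim n : ℤ) - d) * u φ

/-- `f` is smooth on the complement of `0`, and there the distribution `u` is the function `f`: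
`⟨u, φ⟩ = ∫ f φ` for every test function `φ` with compact support not containing `0`. -/
def IsSmoothPart {n : ℕ} (u : 𝓢'(Heis n, ℂ)) (f : Heis n → ℂ) : Prop :=
  ContDiffOn ℝ ∞ f {0}ᶜ ∧
    ∀ φ : 𝓢(Heis n, ℂ), HasCompactSupport φ → 0 ∉ tsupport φ → u φ = ∫ x, f x * φ x

/-- A distribution is regular if it is a smooth function on the complement of `0`. -/
def IsRegularDistribution {n : ℕ} (u : 𝓢'(Heis n, ℂ)) : Prop := ∃ f, IsSmoothPart u f

/-- The smooth function by which a regular distribution `u` is given off `0`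
(uniquely determined there, see `IsSmoothPart.eq`). -/
def smoothPart {n : ℕ} (u : 𝓢'(Heis n, ℂ)) : Heis n → ℂ :=
  open Classical in if h : IsRegularDistribution u then h.choose else 0

theorem IsSmoothPart.eq {n : ℕ} {u : 𝓢'(Heis n, ℂ)} {f g : Heis n → ℂ}
    (hf : IsSmoothPart u f) (hg : IsSmoothPart u g) {z : Heis n} (hz : z ≠ 0) : f z = g z := by
  have hU : IsOpen ({0}ᶜ : Set (Heis n)) := isOpen_compl_singleton
  have hcf := hf.1.continuousOn
  have hcg := hg.1.continuousOn
  have key : ∀ᵐ x ∂(volume : Measure (Heis n)), x ∈ ({0}ᶜ : Set (Heis n)) → f x - g x = 0 := by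
    refine hU.ae_eq_zero_of_integral_contDiff_smul_eq_zero
      ((hcf.sub hcg).locallyIntegrableOn hU.measurableSet) ?_
    intro ψ hψ hψc hψs
    have hsub : Function.support (fun x => (ψ x : ℂ)) = Function.support ψ := by
      ext x; simp
    have hts : tsupport (fun x => (ψ x : ℂ)) = tsupport ψ := by
      rw [tsupport, tsupport, hsub]
    have hcs : HasCompactSupport (fun x => (ψ x : ℂ)) := by
      rw [HasCompactSupport, hts]; exact hψc
    let φ : 𝓢(Heis n, ℂ) := hcs.toSchwartzMap (Complex.ofRealCLM.contDiff.comp hψ)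
    have hφ : ∀ x, φ x = (ψ x : ℂ) := fun x => rfl
    have h0 : (0 : Heis n) ∉ tsupport φ := by
      change (0 : Heis n) ∉ tsupport (fun x => (ψ x : ℂ))
      rw [hts]; exact fun h => hψs h rfl
    have hint : ∀ F : Heis n → ℂ, ContinuousOn F {0}ᶜ →
        Integrable (fun x => F x * φ x) := by
      intro F hF
      have : IntegrableOn (fun x => F x * φ x) (tsupport ψ) :=
        ContinuousOn.integrableOn_compact hψc
          ((hF.mono hψs).mul φ.continuous.continuousOn)
      refine (integrableOn_iff_integrable_of_support_subset ?_).1 this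
      intro x hx
      apply subset_tsupport ψ
      intro h
      exact hx (by simp [hφ, h])
    have e1 := hf.2 φ hcs h0
    have e2 := hg.2 φ hcs h0
    have : ∫ x, ψ x • (f x - g x) = ∫ x, (f x * φ x - g x * φ x) := by
      congr 1; ext x; rw [hφ, Complex.real_smul]; ring
    rw [this, integral_sub (hint f hcf) (hint g hcg), ← e1, ← e2, sub_self]
  have h2 : EqOn f g {0}ᶜ :=
    Measure.eqOn_open_of_ae_eq (μ := volume)
      ((ae_restrict_iff' hU.measurableSet).2 (key.mono fun x h hx => sub_eq_zero.1 (h hx)))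
      hU hcf hcg
  exact h2 hz

/-! ### The Fourier transform -/

/-- The Fourier transform `φ̂(y, s) = ∫ φ(x, t) e^{-i(x y + t s)} dx dt` of a Schwartz function,
obtained from Mathlib's transform (with kernel `e^{-2πi⟪x, y⟫}`) by rescaling the variable;
see `fourierSchwartz_apply`. -/
def fourierSchwartz (n : ℕ) : 𝓢(Heis n, ℂ) →L[ℂ] 𝓢(Heis n, ℂ) :=
  (SchwartzMap.compCLMOfContinuousLinearEquiv ℂ
      (ContinuousLinearEquiv.smulLeft
        (Units.mk0 ((2 * Real.pi)⁻¹) (inv_ne_zero Real.two_pi_pos.ne')) :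
          Heis n ≃L[ℝ] Heis n)) ∘L
    FourierTransform.fourierCLM ℂ 𝓢(Heis n, ℂ)

theorem fourierSchwartz_apply (n : ℕ) (φ : 𝓢(Heis n, ℂ)) (y : Heis n) :
    fourierSchwartz n φ y = ∫ x, φ x * Complex.exp (-Complex.I * (inner ℝ x y : ℝ)) := by
  have : fourierSchwartz n φ y = 𝓕 (φ : Heis n → ℂ) (((2 * Real.pi)⁻¹ : ℝ) • y) := by
    rw [← SchwartzMap.fourier_coe]; rfl
  rw [this, Real.fourier_eq']
  congr 1
  ext x
  rw [smul_eq_mul, mul_comm, inner_smul_right]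
  congr 2
  have : (Real.pi : ℂ) ≠ 0 := by exact_mod_cast Real.pi_ne_zero
  push_cast
  field_simp

/-- The Fourier transform of a tempered distribution, `⟨û, φ⟩ = ⟨u, φ̂⟩`. -/
def fourierDist {n : ℕ} (u : 𝓢'(Heis n, ℂ)) : 𝓢'(Heis n, ℂ) :=
  PointwiseConvergenceCLM.precomp ℂ (fourierSchwartz n) u

/-! ### Principal symbols and the evaluation traces -/

/-- The principal Heisenberg symbols, given by their kernels: the regular distributions on the
Heisenberg group that are homogeneous of degree `-Q`. -/
def Symb (n : ℕ) : Submodule ℂ 𝓢'(Heis n, ℂ) where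
  carrier := {k | IsRegularDistribution k ∧ IsHomogeneousDistribution (-(homDim n : ℤ)) k}
  zero_mem' := ⟨⟨0, contDiffOn_const, fun φ _ _ => by simp⟩, fun r hr φ => by simp⟩
  add_mem' := by
    rintro a b ⟨⟨f, hf⟩, ha⟩ ⟨⟨g, hg⟩, hb⟩
    refine ⟨⟨f + g, hf.1.add hg.1, fun φ hc h0 => ?_⟩, fun r hr φ => ?_⟩
    · have hint : ∀ F : Heis n → ℂ, ContinuousOn F {0}ᶜ →
          Integrable (fun x => F x * φ x) := by
        intro F hF
        have : IntegrableOn (fun x => F x * φ x) (tsupport φ) :=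
          ContinuousOn.integrableOn_compact hc
            ((hF.mono fun x hx hx0 => h0 (hx0 ▸ hx)).mul φ.continuous.continuousOn)
        refine (integrableOn_iff_integrable_of_support_subset ?_).1 this
        intro x hx
        apply subset_tsupport φ
        intro h
        exact hx (by simp [h])
      change a φ + b φ = _
      rw [hf.2 φ hc h0, hg.2 φ hc h0,
        ← integral_add (hint f hf.1.continuousOn) (hint g hg.1.continuousOn)]
      congr 1; ext x; simp [add_mul]
    · change a _ + b _ = _ * (a φ + b φ)
      rw [ha r hr φ, hb r hr φ, mul_add]
  smul_mem' := by
    rintro c a ⟨⟨f, hf⟩, ha⟩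
    refine ⟨⟨c • f, contDiffOn_const.smul hf.1, fun φ hc h0 => ?_⟩, fun r hr φ => ?_⟩
    · change c * a φ = _
      rw [hf.2 φ hc h0, ← integral_const_mul]
      congr 1; ext x; simp [mul_assoc]
    · change c * a _ = _ * (c * a φ)
      rw [ha r hr φ, mul_left_comm]

/-- The evaluation trace `τ_z(k) = k(z)`, for a central element `z ≠ 0`. -/
def tauAt {n : ℕ} (z : CentralPt n) (k : Symb n) : ℂ := smoothPart (k : 𝓢'(Heis n, ℂ)) z.1

/-! ### The trace `τ` -/

/-- `σ_+(x) = k̂(x, +1)`. -/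
def sigmaPlus {n : ℕ} (k : Symb n) (x : Horiz n) : ℂ :=
  smoothPart (fourierDist (k : 𝓢'(Heis n, ℂ))) (heisPt x 1)

/-- `σ_-(x) = k̂(x, -1)`. -/
def sigmaMinus {n : ℕ} (k : Symb n) (x : Horiz n) : ℂ :=
  smoothPart (fourierDist (k : 𝓢'(Heis n, ℂ))) (heisPt x (-1))

/-- `σ(x) ∼ ∑_l v_l(x)` for `‖x‖ → ∞`, where `v_l` has order `-2l`. -/
def HasAsymptoticExpansion {n : ℕ} (σ : Horiz n → ℂ) (v : ℕ → Horiz n → ℂ) : Prop :=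
  ∀ N : ℕ, (fun x => σ x - ∑ l ∈ Finset.range N, v l x) =O[cobounded (Horiz n)]
    fun x => ‖x‖ ^ (-(2 * N : ℤ))

/-- `w l` is the term `w_{2l}` in the expansions `σ_+ ∼ ∑_l w_{2l}`, `σ_- ∼ ∑_l (-1)^l w_{2l}`:
it is smooth off `0` and homogeneous of degree `-2l`. -/
structure IsSymbolExpansion {n : ℕ} (k : Symb n) (w : ℕ → Horiz n → ℂ) : Prop where
  smooth : ∀ l, ContDiffOn ℝ ∞ (w l) {0}ᶜ
  homogeneous : ∀ (l : ℕ) (r : ℝ) (x : Horiz n), 0 < r → x ≠ 0 →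
    w l (r • x) = (r : ℂ) ^ (-(2 * l : ℤ)) * w l x
  plus : HasAsymptoticExpansion (sigmaPlus k) w
  minus : HasAsymptoticExpansion (sigmaMinus k) fun l x => (-1) ^ l * w l x

/-- The terms `w_{2l}` of the expansions of `σ_±` (they are uniquely determined off `0`). -/
def symbolTerm {n : ℕ} (k : Symb n) : ℕ → Horiz n → ℂ :=
  open Classical in if h : ∃ w, IsSymbolExpansion k w then h.choose else 0

/-- The regularized integrand
`R = σ_+ - (-1)^n σ_- - ∑_{l < n} ε_l w_{2l}`, with `ε_l = 1 - (-1)^{n+l}`. -/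
def regIntegrand {n : ℕ} (k : Symb n) (x : Horiz n) : ℂ :=
  sigmaPlus k x - (-1) ^ n * sigmaMinus k x
    - ∑ l ∈ Finset.range n, (1 - (-1) ^ (n + l)) * symbolTerm k l x

/-- The trace `τ(k) = (2π)^{-n} ∫_{ℝ^{2n}} R(x) dx`. -/
def tau {n : ℕ} (k : Symb n) : ℂ :=
  1 / (2 * (Real.pi : ℂ)) ^ n * ∫ x, regIntegrand k x

end

noncomputable section

/-! ### Dilations -/

/-! Let `f` be the smooth part of `k` and `ψ = χ - χ ∘ δ_2` the dyadic partition function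
(`annulusCutoff`), so that `∑_j ψ ∘ δ_{2^j} = 1` off the origin. The single Schwartz function `h = f
ψ` carries all the information. Pairing with `k` is invariant under dilations, hence `∫ h = k(χ) -
k(χ ∘ δ_2) = 0`, and off the origin `k̂ = k(χ) + ∑_j ĥ ∘ δ_{2^j}` (`isSmoothPart_fourierDist`).

Taylor expansion of `ĥ` in the central variable at `(x, 0)`, summed over `j`, gives `w_{2l}(x)` as
`∑_j 4^{jl} ∂_s^l ĥ(2^j x, 0) / l!`, plus `k(χ)` when `l = 0`. Remainder bounds on the unit sphere,
transported by homogeneity, become the expansions of `σ_±` at infinity (`dyadicSymbol_expansion`).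

In the combination `σ_+ - (-1)^n σ_-` the term `l = n` cancels, so subtracting the terms `l < n`
leaves a Taylor remainder of order `n + 1`. This makes the integrals of the dyadic pieces summable
(`norm_regPiece_le`, `hasSum_integral_regPiece`). Integrating a piece over `x` is a partial Fourier
inversion and replaces `ĥ` by the transform of `H(t) = h(0, t)` on the line
(`integral_slice_fourierSchwartz`). With `G = regFourier n H` and `K = ∫ R` this gives `K /
(2π)^{2n} = ∑_j s_j · G(s_j) / s_j^{n+1}` for `s_j = 4^j μ` and every `μ > 0`; on the kernel side
`f(0, ±1) = ∑_j s_j · s_j^n H(±s_j)`. Averaging over `μ` unfolds both sums to integrals over the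
half line, each with the factor `log 4` (`integral_Ioi_eq_of_hasSum`).

What remains is an identity on the line (`integral_regFourier_div`): `n! ∫ G(s) s^{-n-1} ds = π
(-i)^{n+1} (∫ t^n H(t) dt - (-1)^n ∫ t^n H(-t) dt)`, all over `(0, ∞)`. It follows from `n! /
s^{n+1} = ∫ a^n e^{-sa} da`, from the Laplace transform of `G`, in which the subtracted polynomial
is a partial geometric sum, and from `∫ 2|t| / (a² + t²) da = π`. The factors `log 4` cancel. -/

theorem heisPt_fst_snd {n : ℕ} (z : Heis n) : heisPt z.fst z.snd = z := rfl

theorem dilation_eq {n : ℕ} {r : ℝ} (hr : r ≠ 0) (z : Heis n) :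
    dilation n r hr z = heisPt (r • z.fst) (r ^ 2 * z.snd) := rfl

theorem dilation_dilation {n : ℕ} {r s : ℝ} (hr : r ≠ 0) (hs : s ≠ 0) (z : Heis n) :
    dilation n r hr (dilation n s hs z) = dilation n (r * s) (mul_ne_zero hr hs) z := by
  simp [dilation_eq, heisPt, smul_smul, mul_pow, mul_assoc]

theorem dilation_one {n : ℕ} (h : (1 : ℝ) ≠ 0) (z : Heis n) : dilation n 1 h z = z := by
  simp [dilation_eq, heisPt_fst_snd]

theorem norm_sq_heis {n : ℕ} (z : Heis n) : ‖z‖ ^ 2 = ‖z.fst‖ ^ 2 + ‖z.snd‖ ^ 2 :=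
  WithLp.prod_norm_sq_eq_of_L2 z

theorem norm_heisPt_sq {n : ℕ} (x : Horiz n) (t : ℝ) : ‖heisPt x t‖ ^ 2 = ‖x‖ ^ 2 + ‖t‖ ^ 2 :=
  norm_sq_heis _

theorem norm_le_norm_heisPt {n : ℕ} (x : Horiz n) (t : ℝ) : ‖x‖ ≤ ‖heisPt x t‖ := by
  refine le_of_sq_le_sq ?_ (norm_nonneg _)
  rw [norm_heisPt_sq]; nlinarith [sq_nonneg ‖t‖]

theorem abs_le_norm_heisPt {n : ℕ} (x : Horiz n) (t : ℝ) : |t| ≤ ‖heisPt x t‖ := by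
  refine le_of_sq_le_sq ?_ (norm_nonneg _)
  rw [norm_heisPt_sq, Real.norm_eq_abs]; nlinarith [sq_nonneg ‖x‖]

theorem heisPt_ne_zero_of_left {n : ℕ} {x : Horiz n} (hx : x ≠ 0) (t : ℝ) : heisPt x t ≠ 0 :=
  fun h => hx (congrArg WithLp.fst h)

theorem heisPt_ne_zero_of_right {n : ℕ} (x : Horiz n) {t : ℝ} (ht : t ≠ 0) : heisPt x t ≠ 0 :=
  fun h => ht (congrArg WithLp.snd h)

theorem norm_dilation_sq {n : ℕ} {r : ℝ} (hr : r ≠ 0) (z : Heis n) :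
    ‖dilation n r hr z‖ ^ 2 = r ^ 2 * ‖z.fst‖ ^ 2 + r ^ 4 * ‖z.snd‖ ^ 2 := by
  rw [dilation_eq, norm_heisPt_sq, norm_smul, norm_mul, mul_pow, mul_pow, norm_pow,
    Real.norm_eq_abs, ← pow_mul, sq_abs, pow_mul |r| 2 2, sq_abs]
  ring

theorem norm_dilation_le_of_le_one {n : ℕ} {r : ℝ} (hr : 0 < r) (h1 : r ≤ 1) (z : Heis n) :
    ‖dilation n r hr.ne' z‖ ≤ r * ‖z‖ := by
  refine le_of_sq_le_sq ?_ (by positivity)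
  rw [norm_dilation_sq, mul_pow, norm_sq_heis]
  have : r ^ 4 ≤ r ^ 2 := pow_le_pow_of_le_one hr.le h1 (by norm_num)
  nlinarith [sq_nonneg ‖z.snd‖]

theorem norm_dilation_le_of_one_le {n : ℕ} {r : ℝ} (hr : 0 < r) (h1 : 1 ≤ r) (z : Heis n) :
    ‖dilation n r hr.ne' z‖ ≤ r ^ 2 * ‖z‖ := by
  refine le_of_sq_le_sq ?_ (by positivity)
  rw [norm_dilation_sq, mul_pow, norm_sq_heis]
  have : r ^ 2 ≤ r ^ 4 := pow_le_pow_right₀ h1 (by norm_num)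
  nlinarith [sq_nonneg ‖z.fst‖]

theorem le_norm_dilation_of_one_le {n : ℕ} {r : ℝ} (hr : 0 < r) (h1 : 1 ≤ r) (z : Heis n) :
    r * ‖z‖ ≤ ‖dilation n r hr.ne' z‖ := by
  refine le_of_sq_le_sq ?_ (norm_nonneg _)
  rw [norm_dilation_sq, mul_pow, norm_sq_heis]
  have : r ^ 2 ≤ r ^ 4 := pow_le_pow_right₀ h1 (by norm_num)
  nlinarith [sq_nonneg ‖z.snd‖]

theorem inner_dilation {n : ℕ} {r : ℝ} (hr : r ≠ 0) (y z : Heis n) :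
    inner ℝ (dilation n r hr y) z = (inner ℝ y (dilation n r hr z) : ℝ) := by
  simp only [WithLp.prod_inner_apply, dilation_eq, heisPt]
  simp [inner_smul_left, inner_smul_right]
  ring

/-! ### Integration -/

theorem integral_heis {n : ℕ} {E : Type*} [NormedAddCommGroup E] [NormedSpace ℝ E]
    (F : Heis n → E) : ∫ z, F z = ∫ p : Horiz n × ℝ, F (heisPt p.1 p.2) :=
  ((WithLp.volume_preserving_symm_measurableEquiv_toLp_prod (Horiz n) ℝ).symm.integral_comp' F).symm

theorem integrable_heis_iff {n : ℕ} {E : Type*} [NormedAddCommGroup E]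
    (F : Heis n → E) : Integrable F ↔ Integrable fun p : Horiz n × ℝ => F (heisPt p.1 p.2) :=
  ((WithLp.volume_preserving_symm_measurableEquiv_toLp_prod (Horiz n) ℝ).symm.integrable_comp_emb
    (MeasurableEquiv.measurableEmbedding _)).symm

theorem det_dilation {n : ℕ} {r : ℝ} (hr : r ≠ 0) :
    LinearMap.det (dilation n r hr : Heis n →ₗ[ℝ] Heis n) = r ^ homDim n := by
  let e : (Horiz n × ℝ) ≃ₗ[ℝ] Heis n := (WithLp.linearEquiv 2 ℝ (Horiz n × ℝ)).symm
  have : (dilation n r hr : Heis n →ₗ[ℝ] Heis n)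
      = (e : (Horiz n × ℝ) →ₗ[ℝ] Heis n) ∘ₗ
        ((r • LinearMap.id : Horiz n →ₗ[ℝ] Horiz n).prodMap
          (r ^ 2 • LinearMap.id : ℝ →ₗ[ℝ] ℝ)) ∘ₗ
        (e.symm : Heis n →ₗ[ℝ] (Horiz n × ℝ)) := rfl
  rw [this, LinearMap.det_conj, LinearMap.det_prodMap, LinearMap.det_smul, LinearMap.det_smul]
  simp [homDim, ← pow_add]
  ring_nf

theorem integral_comp_dilation {n : ℕ} {r : ℝ} (hr : 0 < r) (F : Heis n → ℂ) :
    ∫ z, F (dilation n r hr.ne' z) = ((r : ℂ) ^ homDim n)⁻¹ * ∫ z, F z := by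
  have hd : LinearMap.det (dilation n r hr.ne' : Heis n →ₗ[ℝ] Heis n) ≠ 0 := by
    rw [det_dilation]; positivity
  have h := Measure.map_linearMap_addHaar_eq_smul_addHaar (volume : Measure (Heis n)) hd
  have e : ∫ z, F z ∂(Measure.map (dilation n r hr.ne' : Heis n →ₗ[ℝ] Heis n) volume)
      = ∫ z, F (dilation n r hr.ne' z) :=
    (dilation n r hr.ne').toHomeomorph.measurableEmbedding.integral_map F
  rw [← e, h, integral_smul_measure, det_dilation, ENNReal.toReal_ofReal (abs_nonneg _),
    abs_of_pos (by positivity), Complex.real_smul]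
  simp

/-! ### Homogeneous distributions -/

/-- The pullback of a Schwartz function by a dilation. -/
abbrev dilate {n : ℕ} {r : ℝ} (hr : r ≠ 0) : 𝓢(Heis n, ℂ) →L[ℂ] 𝓢(Heis n, ℂ) :=
  SchwartzMap.compCLMOfContinuousLinearEquiv ℂ (dilation n r hr)

theorem dilate_apply {n : ℕ} {r : ℝ} (hr : r ≠ 0) (φ : 𝓢(Heis n, ℂ)) (z : Heis n) :
    dilate hr φ z = φ (dilation n r hr z) := rfl

/-- Dilations are symmetric for the inner product, so a substitution with Jacobian `r^Q` moves the
dilation to the frequency side, where it is inverted. -/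
theorem fourierSchwartz_dilate {n : ℕ} {r : ℝ} (hr : 0 < r) (φ : 𝓢(Heis n, ℂ)) :
    fourierSchwartz n (dilate hr.ne' φ)
      = ((r : ℂ) ^ homDim n)⁻¹ • dilate (inv_pos.2 hr).ne' (fourierSchwartz n φ) := by
  ext y
  rw [smul_apply, dilate_apply, fourierSchwartz_apply, fourierSchwartz_apply,
    smul_eq_mul, ← integral_comp_dilation hr]
  congr 1
  ext x
  rw [dilate_apply, inner_dilation, dilation_dilation]
  congr 4
  simp only [mul_inv_cancel₀ hr.ne']
  rw [dilation_one]

theorem IsHomogeneousDistribution.fourierDist {n : ℕ} {k : 𝓢'(Heis n, ℂ)}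
    (hk : IsHomogeneousDistribution (-(homDim n : ℤ)) k) :
    IsHomogeneousDistribution 0 (fourierDist k) := by
  intro r hr φ
  change k (fourierSchwartz n (dilate hr.ne' φ)) = _ * k (fourierSchwartz n φ)
  rw [fourierSchwartz_dilate hr, map_smul, hk _ (inv_pos.2 hr)]
  simp

/-- The suitably rescaled function `f ∘ δ_r` also represents `u` off the origin, so uniqueness of
the smooth part applies. -/
theorem IsSmoothPart.dilation_eq {n : ℕ} {d : ℤ} {u : 𝓢'(Heis n, ℂ)} {f : Heis n → ℂ}
    (hf : IsSmoothPart u f) (hu : IsHomogeneousDistribution d u) {r : ℝ} (hr : 0 < r)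
    {z : Heis n} (hz : z ≠ 0) : f (dilation n r hr.ne' z) = (r : ℂ) ^ d * f z := by
  have hr0 : (r : ℂ) ≠ 0 := by exact_mod_cast hr.ne'
  have hg : IsSmoothPart u (fun z => ((r : ℂ) ^ d)⁻¹ * f (dilation n r hr.ne' z)) := by
    refine ⟨contDiffOn_const.mul (hf.1.comp (dilation n r hr.ne').contDiff.contDiffOn ?_), ?_⟩
    · intro x hx h
      exact hx ((dilation n r hr.ne').map_eq_zero_iff.1 h)
    · intro φ hc h0
      have hts : tsupport (dilate (inv_pos.2 hr).ne' φ)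
          = (dilation n r⁻¹ (inv_pos.2 hr).ne').toHomeomorph ⁻¹' tsupport φ :=
        tsupport_comp_eq_preimage φ (dilation n r⁻¹ (inv_pos.2 hr).ne').toHomeomorph
      have e := hf.2 (dilate (inv_pos.2 hr).ne' φ)
        (hc.comp_homeomorph (dilation n r⁻¹ (inv_pos.2 hr).ne').toHomeomorph) (by
          rw [hts]
          simpa using h0)
      rw [hu _ (inv_pos.2 hr)] at e
      have e2 := integral_comp_dilation hr (fun z => f z * dilate (inv_pos.2 hr).ne' φ z)
      rw [← e] at e2
      have e3 : ∀ z, dilate (inv_pos.2 hr).ne' φ (dilation n r hr.ne' z) = φ z := by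
        intro z
        rw [dilate_apply, dilation_dilation]
        simp only [inv_mul_cancel₀ hr.ne', dilation_one]
      simp only [e3] at e2
      simp only [mul_assoc]
      rw [integral_const_mul, e2]
      push_cast
      rw [inv_zpow', neg_sub, sub_neg_eq_add, zpow_add₀ hr0, zpow_natCast]
      field_simp
  have := hf.eq hg hz
  rw [this]
  field_simp

/-! ### Dilated Schwartz functions -/

theorem SchwartzMap.norm_sub_apply_zero_le {E : Type*} [NormedAddCommGroup E] [NormedSpace ℝ E]
    (η : 𝓢(E, ℂ)) (z : E) : ‖η z - η 0‖ ≤ SchwartzMap.seminorm ℝ 0 1 η * ‖z‖ := by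
  have := Convex.norm_image_sub_le_of_norm_fderiv_le (𝕜 := ℝ) (f := η) (s := univ)
    (C := SchwartzMap.seminorm ℝ 0 1 η) (fun x _ => η.differentiableAt) (fun x _ => by
      rw [← norm_iteratedFDeriv_one]
      exact SchwartzMap.norm_iteratedFDeriv_le_seminorm ℝ η 1 x) convex_univ
    (mem_univ (0 : E)) (mem_univ z)
  simpa using this

theorem norm_iteratedFDeriv_dilate_le {n : ℕ} {r : ℝ} (hr : r ≠ 0) {K : ℝ} (hK : 0 ≤ K)
    (h : ∀ z, ‖dilation n r hr z‖ ≤ K * ‖z‖) (η : 𝓢(Heis n, ℂ)) (i : ℕ) (y : Heis n) :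
    ‖iteratedFDeriv ℝ i (dilate hr η) y‖
      ≤ ‖iteratedFDeriv ℝ i η (dilation n r hr y)‖ * K ^ i := by
  have e := (dilation n r hr : Heis n →L[ℝ] Heis n).iteratedFDeriv_comp_right (η.smooth ⊤) y
    (i := i) (by exact_mod_cast le_top)
  change ‖iteratedFDeriv ℝ i (η ∘ (dilation n r hr : Heis n →L[ℝ] Heis n)) y‖ ≤ _
  rw [e]
  refine (ContinuousMultilinearMap.norm_compContinuousLinearMap_le _ _).trans ?_
  rw [Finset.prod_const, Finset.card_univ, Fintype.card_fin]
  exact mul_le_mul_of_nonneg_left (pow_le_pow_left₀ (norm_nonneg _)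
    (ContinuousLinearMap.opNorm_le_bound (dilation n r hr : Heis n →L[ℝ] Heis n) hK h) i)
    (norm_nonneg _)

/-- The gain of one factor `r` has two sources: the mean value inequality when `i = 0`, and the
chain rule factor `r^i ≤ r` when `i > 0`, where the constant `η 0` disappears. -/
theorem norm_iteratedFDeriv_dilate_sub_le {n : ℕ} (η : 𝓢(Heis n, ℂ)) (i : ℕ) {r : ℝ} (hr : 0 < r)
    (h1 : r ≤ 1) (y : Heis n) :
    ‖iteratedFDeriv ℝ i (fun y => dilate hr.ne' η y - η 0) y‖
      ≤ (SchwartzMap.seminorm ℝ 0 1 η + SchwartzMap.seminorm ℝ 0 i η) * r * (1 + ‖y‖) := by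
  have s1 := apply_nonneg (SchwartzMap.seminorm ℝ 0 1) η
  have s2 := apply_nonneg (SchwartzMap.seminorm ℝ 0 i) η
  rcases Nat.eq_zero_or_pos i with rfl | hi
  · rw [norm_iteratedFDeriv_zero, dilate_apply]
    calc _ ≤ SchwartzMap.seminorm ℝ 0 1 η * ‖dilation n r hr.ne' y‖ := η.norm_sub_apply_zero_le _
      _ ≤ SchwartzMap.seminorm ℝ 0 1 η * (r * ‖y‖) := by
        gcongr; exact norm_dilation_le_of_le_one hr h1 y
      _ = SchwartzMap.seminorm ℝ 0 1 η * r * ‖y‖ := by ring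
      _ ≤ _ := by gcongr <;> linarith
  · have e : iteratedFDeriv ℝ i (fun y => dilate hr.ne' η y - η 0) y
        = iteratedFDeriv ℝ i (dilate hr.ne' η) y := by
      rw [show (fun y => dilate hr.ne' η y - η 0) = ⇑(dilate hr.ne' η) - fun _ => η 0 from rfl,
        iteratedFDeriv_sub_apply ((dilate hr.ne' η).contDiffAt ⊤ |>.of_le (by exact_mod_cast le_top))
          contDiffAt_const, iteratedFDeriv_const_of_ne hi.ne']
      simp
    rw [e]
    calc _ ≤ ‖iteratedFDeriv ℝ i η (dilation n r hr.ne' y)‖ * r ^ i :=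
          norm_iteratedFDeriv_dilate_le hr.ne' hr.le (norm_dilation_le_of_le_one hr h1) η i y
      _ ≤ SchwartzMap.seminorm ℝ 0 i η * r := by
        gcongr
        · exact SchwartzMap.norm_iteratedFDeriv_le_seminorm ℝ η i _
        · exact pow_le_of_le_one hr.le h1 hi.ne'
      _ ≤ (SchwartzMap.seminorm ℝ 0 1 η + SchwartzMap.seminorm ℝ 0 i η) * r * 1 := by
        rw [mul_one]; gcongr; linarith
      _ ≤ _ := by gcongr; linarith [norm_nonneg y]

/-- The product of two Schwartz functions. -/
def mulSchwartz {n : ℕ} (η : 𝓢(Heis n, ℂ)) : 𝓢(Heis n, ℂ) →L[ℂ] 𝓢(Heis n, ℂ) :=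
  SchwartzMap.smulLeftCLM ℂ η

theorem mulSchwartz_apply {n : ℕ} (η φ : 𝓢(Heis n, ℂ)) (z : Heis n) :
    mulSchwartz η φ z = η z * φ z :=
  SchwartzMap.smulLeftCLM_apply_apply η.hasTemperateGrowth φ z

theorem mulSchwartz_comm {n : ℕ} (η φ : 𝓢(Heis n, ℂ)) : mulSchwartz η φ = mulSchwartz φ η := by
  ext z; rw [mulSchwartz_apply, mulSchwartz_apply, mul_comm]

theorem dilate_mulSchwartz {n : ℕ} {r : ℝ} (hr : r ≠ 0) (η φ : 𝓢(Heis n, ℂ)) :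
    dilate hr (mulSchwartz η φ) = mulSchwartz (dilate hr η) (dilate hr φ) := by
  ext z; simp only [dilate_apply, mulSchwartz_apply]

/-- By the Leibniz rule; the linear growth `1 + ‖y‖` of the first factor is absorbed by raising the
polynomial weight on `φ` from `k` to `k + 1`. -/
theorem seminorm_mulSchwartz_dilate_sub_le {n : ℕ} (η φ : 𝓢(Heis n, ℂ)) (k m : ℕ) :
    ∃ C, ∀ (r : ℝ) (hr : 0 < r), r ≤ 1 →
      SchwartzMap.seminorm ℂ k m (mulSchwartz (dilate hr.ne' η) φ - η 0 • φ) ≤ C * r := by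
  let A : ℕ → ℝ := fun i => SchwartzMap.seminorm ℝ 0 1 η + SchwartzMap.seminorm ℝ 0 i η
  have hA : ∀ i, 0 ≤ A i := fun i =>
    add_nonneg (apply_nonneg (SchwartzMap.seminorm ℝ 0 1) η)
      (apply_nonneg (SchwartzMap.seminorm ℝ 0 i) η)
  let B : ℕ → ℝ := fun i =>
    SchwartzMap.seminorm ℝ k (m - i) φ + SchwartzMap.seminorm ℝ (k + 1) (m - i) φ
  have hB : ∀ i, 0 ≤ B i := fun i =>
    add_nonneg (apply_nonneg (SchwartzMap.seminorm ℝ k (m - i)) φ)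
      (apply_nonneg (SchwartzMap.seminorm ℝ (k + 1) (m - i)) φ)
  refine ⟨∑ i ∈ Finset.range (m + 1), (m.choose i : ℝ) * (A i * B i), fun r hr h1 => ?_⟩
  refine SchwartzMap.seminorm_le_bound ℂ k m _ (mul_nonneg (Finset.sum_nonneg fun i _ =>
    mul_nonneg (Nat.cast_nonneg _) (mul_nonneg (hA i) (hB i))) hr.le) fun x => ?_
  have e : ⇑(mulSchwartz (dilate hr.ne' η) φ - η 0 • φ)
      = fun y => (dilate hr.ne' η y - η 0) * φ y := by
    ext y
    rw [sub_apply, smul_apply, mulSchwartz_apply, smul_eq_mul]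
    ring
  rw [e]
  have h := norm_iteratedFDeriv_mul_le (N := ∞) (f := fun y => dilate hr.ne' η y - η 0) (g := φ)
    (((dilate hr.ne' η).smooth ⊤).sub contDiff_const) (φ.smooth ⊤) x (n := m)
    (by exact_mod_cast le_top)
  calc _ ≤ ‖x‖ ^ k * ∑ i ∈ Finset.range (m + 1), (m.choose i : ℝ) *
        ‖iteratedFDeriv ℝ i (fun y => dilate hr.ne' η y - η 0) x‖
          * ‖iteratedFDeriv ℝ (m - i) φ x‖ := by gcongr
    _ ≤ ‖x‖ ^ k * ∑ i ∈ Finset.range (m + 1), (m.choose i : ℝ) *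
        (A i * r * (1 + ‖x‖)) * ‖iteratedFDeriv ℝ (m - i) φ x‖ := by
      gcongr with i hi
      exact norm_iteratedFDeriv_dilate_sub_le η i hr h1 x
    _ = ∑ i ∈ Finset.range (m + 1), (m.choose i : ℝ) * (A i *
        (‖x‖ ^ k * ‖iteratedFDeriv ℝ (m - i) φ x‖
          + ‖x‖ ^ (k + 1) * ‖iteratedFDeriv ℝ (m - i) φ x‖)) * r := by
      rw [Finset.mul_sum]
      exact Finset.sum_congr rfl fun i _ => by ring
    _ ≤ _ := by
      rw [Finset.sum_mul]
      gcongr with i hi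
      change _ ≤ SchwartzMap.seminorm ℝ k (m - i) φ + SchwartzMap.seminorm ℝ (k + 1) (m - i) φ
      exact add_le_add (SchwartzMap.le_seminorm ℝ k (m - i) φ x)
        (SchwartzMap.le_seminorm ℝ (k + 1) (m - i) φ x)

theorem tendsto_mulSchwartz_dilate {n : ℕ} (η φ : 𝓢(Heis n, ℂ)) {r : ℕ → ℝ} (hr : ∀ J, 0 < r J)
    (h1 : ∀ J, r J ≤ 1) (h0 : Tendsto r atTop (𝓝 0)) :
    Tendsto (fun J => mulSchwartz (dilate (hr J).ne' η) φ) atTop (𝓝 (η 0 • φ)) := by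
  rw [(schwartz_withSeminorms ℂ (Heis n) ℂ).tendsto_nhds]
  rintro ⟨k, m⟩ ε hε
  obtain ⟨C, hC⟩ := seminorm_mulSchwartz_dilate_sub_le η φ k m
  have : Tendsto (fun J => C * r J) atTop (𝓝 0) := by simpa using h0.const_mul C
  filter_upwards [this.eventually_lt_const hε] with J hJ
  exact (hC (r J) (hr J) (h1 J)).trans_lt hJ

/-! ### Dyadic series -/

/-- `r^{2l} η(δ_r y)` and its derivatives decay for `r → 0` and `r → ∞`. -/
theorem norm_iteratedFDeriv_dilate_min_le {n : ℕ} (η : 𝓢(Heis n, ℂ)) {l : ℕ}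
    (h : l ≠ 0 ∨ η 0 = 0) (i : ℕ) :
    ∃ C, ∃ N : ℕ, 0 ≤ C ∧ ∀ (r : ℝ) (hr : 0 < r) (y : Heis n), y ≠ 0 →
      r ^ (2 * l) * ‖iteratedFDeriv ℝ i (dilate hr.ne' η) y‖
        ≤ C * min r r⁻¹ * (1 + ‖y‖ + ‖y‖⁻¹ ^ N) := by
  -- For `r ≥ 1` the decay of `η` has to beat `r^{2l}` from the prefactor and `r^{2i}` from the
  -- chain rule, and still leave `r⁻¹`.
  let N := 2 * l + 2 * i + 1
  let A := SchwartzMap.seminorm ℝ 0 1 η + SchwartzMap.seminorm ℝ 0 i η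
  let B := SchwartzMap.seminorm ℝ N i η
  have hA : 0 ≤ A := add_nonneg (apply_nonneg (SchwartzMap.seminorm ℝ 0 1) η)
      (apply_nonneg (SchwartzMap.seminorm ℝ 0 i) η)
  have hB : 0 ≤ B := apply_nonneg (SchwartzMap.seminorm ℝ N i) η
  refine ⟨A + B, N, by positivity, fun r hr y hy => ?_⟩
  have hy' : 0 < ‖y‖ := norm_pos_iff.2 hy
  rcases le_total r 1 with h1 | h1
  · rw [min_eq_left (h1.trans ((one_le_inv₀ hr).2 h1))]
    have key : r ^ (2 * l) * ‖iteratedFDeriv ℝ i (dilate hr.ne' η) y‖ ≤ A * r * (1 + ‖y‖) := by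
      -- As `r → 0` smallness comes from the vanishing of `η` at the origin if `l = 0`, and from
      -- `r^{2l}` otherwise.
      rcases Nat.eq_zero_or_pos l with rfl | hl
      · have h0 : η 0 = 0 := by simpa using h
        have := norm_iteratedFDeriv_dilate_sub_le η i hr h1 y
        simp only [h0, sub_zero] at this
        rw [mul_zero, pow_zero, one_mul]
        exact this
      · calc _ ≤ r ^ (2 * l) * (‖iteratedFDeriv ℝ i η (dilation n r hr.ne' y)‖ * 1 ^ i) := by
              gcongr
              exact norm_iteratedFDeriv_dilate_le hr.ne' zero_le_one (fun z =>
                (norm_dilation_le_of_le_one hr h1 z).trans (by gcongr)) η i y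
          _ ≤ r * A := by
            rw [one_pow, mul_one]
            gcongr
            · exact pow_le_of_le_one hr.le h1 (by omega)
            · exact (SchwartzMap.norm_iteratedFDeriv_le_seminorm ℝ η i _).trans
                (le_add_of_nonneg_left (apply_nonneg (SchwartzMap.seminorm ℝ 0 1) η))
          _ = A * r * 1 := by ring
          _ ≤ _ := by gcongr; linarith
    have h2 : 0 ≤ ‖y‖⁻¹ ^ N := by positivity
    exact key.trans (mul_le_mul (by gcongr; linarith) (by linarith) (by positivity) (by positivity))
  · rw [min_eq_right ((inv_le_one_of_one_le₀ h1).trans h1)]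
    have hd : 0 < r * ‖y‖ := by positivity
    have h2 : ‖iteratedFDeriv ℝ i η (dilation n r hr.ne' y)‖ ≤ B / (r * ‖y‖) ^ N := by
      rw [le_div_iff₀ (by positivity), mul_comm]
      refine le_trans ?_ (SchwartzMap.le_seminorm ℝ N i η (dilation n r hr.ne' y))
      gcongr
      exact le_norm_dilation_of_one_le hr h1 y
    calc _ ≤ r ^ (2 * l) * (B / (r * ‖y‖) ^ N * (r ^ 2) ^ i) := by
          gcongr
          exact (norm_iteratedFDeriv_dilate_le hr.ne' (by positivity)
            (norm_dilation_le_of_one_le hr h1) η i y).trans (by gcongr)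
      _ = B * r⁻¹ * ‖y‖⁻¹ ^ N := by
        have : (r * ‖y‖) ^ N = r ^ (2 * l) * (r ^ 2) ^ i * r * ‖y‖ ^ N := by
          rw [mul_pow, ← pow_mul, ← pow_add, ← pow_succ]
        rw [this, inv_pow]; field_simp
      _ ≤ _ := by
        gcongr
        · linarith
        · linarith

theorem two_zpow_pos (j : ℤ) : (0 : ℝ) < 2 ^ j := by positivity

theorem summable_min_two_zpow : Summable fun j : ℤ => min ((2 : ℝ) ^ j) ((2 : ℝ) ^ j)⁻¹ := by
  have hg : Summable fun k : ℕ => (2⁻¹ : ℝ) ^ k :=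
    summable_geometric_of_lt_one (by norm_num) (by norm_num)
  refine Summable.of_nat_of_neg (hg.of_nonneg_of_le (fun k => by positivity) fun k => ?_)
    (hg.of_nonneg_of_le (fun k => by positivity) fun k => ?_)
  · refine (min_le_right _ _).trans ?_
    simp
  · refine (min_le_left _ _).trans ?_
    simp

/-- The dyadic dilate `η(δ_{2^j} ·)`. -/
abbrev dyadic {n : ℕ} (j : ℤ) : 𝓢(Heis n, ℂ) →L[ℂ] 𝓢(Heis n, ℂ) := dilate (two_zpow_pos j).ne'

theorem dyadic_apply {n : ℕ} (j : ℤ) (η : 𝓢(Heis n, ℂ)) (x : Horiz n) (t : ℝ) :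
    dyadic j η (heisPt x t) = η (heisPt ((2 : ℝ) ^ j • x) ((4 : ℝ) ^ j * t)) := by
  rw [dyadic, dilate_apply, dilation_apply, ← zpow_natCast, ← zpow_mul, mul_comm j, zpow_mul]
  norm_num

/-- The sum `∑_j 4^{jl} η(δ_{2^j} y)`. -/
def dyadicSum {n : ℕ} (l : ℕ) (η : 𝓢(Heis n, ℂ)) (y : Heis n) : ℂ :=
  ∑' j : ℤ, ((4 : ℂ) ^ j) ^ l * dyadic j η y

theorem norm_dyadic_le {n : ℕ} (η : 𝓢(Heis n, ℂ)) {l : ℕ} (h : l ≠ 0 ∨ η 0 = 0) :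
    ∃ C, ∃ N : ℕ, 0 ≤ C ∧ ∀ (j : ℤ) (y : Heis n), y ≠ 0 →
      ‖((4 : ℂ) ^ j) ^ l * dyadic j η y‖
        ≤ C * min ((2 : ℝ) ^ j) ((2 : ℝ) ^ j)⁻¹ * (1 + ‖y‖ + ‖y‖⁻¹ ^ N) := by
  obtain ⟨C, N, hC, hb⟩ := norm_iteratedFDeriv_dilate_min_le η h 0
  refine ⟨C, N, hC, fun j y hy => ?_⟩
  have := hb _ (two_zpow_pos j) y hy
  rw [norm_iteratedFDeriv_zero, pow_mul, ← zpow_natCast _ 2, ← zpow_mul, mul_comm j, zpow_mul] at this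
  rw [norm_mul, norm_pow, norm_zpow]
  norm_num at this ⊢
  exact this

theorem summable_dyadic {n : ℕ} (η : 𝓢(Heis n, ℂ)) {l : ℕ} (h : l ≠ 0 ∨ η 0 = 0) {y : Heis n}
    (hy : y ≠ 0) : Summable fun j : ℤ => ((4 : ℂ) ^ j) ^ l * dyadic j η y := by
  obtain ⟨C, N, hC, hb⟩ := norm_dyadic_le η h
  exact ((summable_min_two_zpow.mul_left C).mul_right _).of_norm_bounded fun j => hb j y hy

theorem contDiffOn_dyadicSum {n : ℕ} (η : 𝓢(Heis n, ℂ)) {l : ℕ} (h : l ≠ 0 ∨ η 0 = 0) :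
    ContDiffOn ℝ ∞ (dyadicSum l η) {0}ᶜ := by
  intro y₀ hy₀
  refine ContDiffAt.contDiffWithinAt ?_
  have hp : 0 < ‖y₀‖ := norm_pos_iff.2 hy₀
  -- The series converges in `C^∞` only away from the origin. Multiplication by a bump supported in
  -- a ball around `y₀` that avoids `0` makes the derivative bounds global.
  let b : ContDiffBump y₀ := ⟨‖y₀‖ / 4, ‖y₀‖ / 2, by positivity, by linarith⟩
  let ρ : 𝓢(Heis n, ℂ) := HasCompactSupport.toSchwartzMap (f := fun y => (b y : ℂ))
    (b.hasCompactSupport.comp_left (g := ((↑) : ℝ → ℂ)) rfl)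
    (Complex.ofRealCLM.contDiff.comp b.contDiff)
  have hρ : ∀ y, ρ y = (b y : ℂ) := fun y => rfl
  have hzero : ∀ y, y ∉ Metric.closedBall y₀ (‖y₀‖ / 2) → ∀ i, iteratedFDeriv ℝ i ρ y = 0 := by
    intro y hy i
    refine Function.notMem_support.1 fun hmem => hy ?_
    have h1 := support_iteratedFDeriv_subset (𝕜 := ℝ) i hmem
    have h2 : tsupport ρ ⊆ tsupport b := by
      refine closure_mono fun z hz => ?_
      simpa [hρ] using hz
    have := h2 h1
    rwa [b.tsupport_eq] at this
  have hball : ∀ y ∈ Metric.closedBall y₀ (‖y₀‖ / 2),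
      ‖y₀‖ / 2 ≤ ‖y‖ ∧ ‖y‖ ≤ 2 * ‖y₀‖ := by
    intro y hy
    rw [mem_closedBall_iff_norm] at hy
    have h1 := norm_sub_norm_le y₀ y
    have h2 := norm_sub_norm_le y y₀
    rw [norm_sub_rev] at h1
    constructor <;> linarith
  choose C N hC hb using fun i => norm_iteratedFDeriv_dilate_min_le η h i
  let D : ℕ → ℝ := fun i => C i * (1 + 2 * ‖y₀‖ + (‖y₀‖ / 2)⁻¹ ^ N i)
  let M : ℕ → ℝ := fun m => ∑ i ∈ Finset.range (m + 1),
    (m.choose i : ℝ) * SchwartzMap.seminorm ℝ 0 i ρ * D (m - i)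
  have hsm : ContDiff ℝ ∞ fun y => ∑' j : ℤ, ρ y * (((4 : ℂ) ^ j) ^ l * dyadic j η y) := by
    refine contDiff_tsum (v := fun m j => M m * min ((2 : ℝ) ^ j) ((2 : ℝ) ^ j)⁻¹)
      (fun j => (ρ.smooth ⊤).mul (contDiff_const.mul ((dyadic j η).smooth ⊤)))
      (fun m _ => summable_min_two_zpow.mul_left _) fun m j y hm => ?_
    have hL := norm_iteratedFDeriv_mul_le (N := ∞) (f := ρ)
      (g := fun y => ((4 : ℂ) ^ j) ^ l * dyadic j η y) (ρ.smooth ⊤)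
      (contDiff_const.mul ((dyadic j η).smooth ⊤)) y (n := m) (by exact_mod_cast le_top)
    refine hL.trans ?_
    rw [Finset.sum_mul]
    refine Finset.sum_le_sum fun i _ => ?_
    by_cases hy : y ∈ Metric.closedBall y₀ (‖y₀‖ / 2)
    · have hy1 := hball y hy
      have hyp : 0 < ‖y‖ := by linarith
      have e : iteratedFDeriv ℝ (m - i) (fun y => ((4 : ℂ) ^ j) ^ l * dyadic j η y) y
          = ((4 : ℂ) ^ j) ^ l • iteratedFDeriv ℝ (m - i) (dyadic j η) y :=
        iteratedFDeriv_const_smul_apply (a := ((4 : ℂ) ^ j) ^ l)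
          ((dyadic j η).smooth (m - i : ℕ)).contDiffAt
      have hbj := hb (m - i) _ (two_zpow_pos j) y (norm_pos_iff.1 hyp)
      rw [pow_mul, ← zpow_natCast _ 2, ← zpow_mul, mul_comm j, zpow_mul] at hbj
      rw [e, norm_smul, norm_pow, norm_zpow]
      norm_num at hbj ⊢
      calc _ ≤ (m.choose i : ℝ) * SchwartzMap.seminorm ℝ 0 i ρ *
            (C (m - i) * min ((2 : ℝ) ^ j) ((2 : ℝ) ^ j)⁻¹ * (1 + ‖y‖ + (‖y‖ ^ N (m - i))⁻¹)) := by
            gcongr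
            exact SchwartzMap.norm_iteratedFDeriv_le_seminorm ℝ ρ i y
        _ ≤ (m.choose i : ℝ) * SchwartzMap.seminorm ℝ 0 i ρ *
            (C (m - i) * min ((2 : ℝ) ^ j) ((2 : ℝ) ^ j)⁻¹ *
              (1 + 2 * ‖y₀‖ + ((‖y₀‖ / 2) ^ N (m - i))⁻¹)) := by
            have := hC (m - i)
            gcongr
            · exact hy1.2
            · exact hy1.1
        _ = _ := by simp only [D, inv_pow]; ring
    · rw [hzero y hy, norm_zero, mul_zero, zero_mul]
      have hD : 0 ≤ D (m - i) := by
        have := hC (m - i)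
        positivity
      positivity
  refine hsm.contDiffAt.congr_of_eventuallyEq ?_
  filter_upwards [b.eventuallyEq_one] with y hy
  simp only [hρ, hy, Pi.one_apply, Complex.ofReal_one, one_mul]
  rfl

/-! ### Dyadic decomposition of a homogeneous kernel -/

theorem hasSum_int_telescoping {b : ℤ → ℂ} {A B : ℂ} (hs : Summable fun j => b j - b (j + 1))
    (hA : Tendsto (fun J : ℕ => b J) atTop (𝓝 A))
    (hB : Tendsto (fun J : ℕ => b (-J)) atTop (𝓝 B)) :
    HasSum (fun j => b j - b (j + 1)) (B - A) := by
  have h1 : HasSum (fun j : ℕ => b j - b (j + 1)) (b 0 - A) := by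
    have hsum : Summable (fun j : ℕ => b j - b (j + 1)) :=
      hs.comp_injective (i := ((↑) : ℕ → ℤ)) Nat.cast_injective
    refine (hsum.hasSum_iff_tendsto_nat).2 ?_
    have : ∀ J : ℕ, ∑ j ∈ Finset.range J, (b j - b (j + 1)) = b 0 - b J := by
      intro J
      have := Finset.sum_range_sub' (fun j : ℕ => b j) J
      push_cast at this
      exact this
    simp only [this]
    exact hA.const_sub _
  have h2 : HasSum (fun j : ℕ => b (-(j + 1)) - b (-(j + 1) + 1)) (B - b 0) := by
    have hsum : Summable (fun j : ℕ => b (-(j + 1)) - b (-(j + 1) + 1)) :=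
      hs.comp_injective (i := fun j : ℕ => (-(j + 1) : ℤ)) fun i j h => by simpa using h
    refine (hsum.hasSum_iff_tendsto_nat).2 ?_
    have : ∀ J : ℕ, ∑ j ∈ Finset.range J, (b (-(j + 1)) - b (-(j + 1) + 1)) = b (-J) - b 0 := by
      intro J
      have := Finset.sum_range_sub (fun j : ℕ => b (-j)) J
      simpa using this
    simp only [this]
    exact hB.sub_const _
  have := HasSum.of_nat_of_neg_add_one (f := fun j => b j - b (j + 1)) h1 h2
  convert this using 1
  ring

theorem mulSchwartz_sub_left {n : ℕ} (a b φ : 𝓢(Heis n, ℂ)) :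
    mulSchwartz (a - b) φ = mulSchwartz a φ - mulSchwartz b φ := by
  ext z; simp only [mulSchwartz_apply, sub_apply, sub_mul]

theorem dyadic_dyadic {n : ℕ} (i j : ℤ) (η : 𝓢(Heis n, ℂ)) :
    dyadic i (dyadic j η) = dyadic (i + j) η := by
  ext z
  rw [dyadic, dyadic, dyadic, dilate_apply, dilate_apply, dilate_apply, dilation_dilation]
  congr 2
  simp only [← zpow_add₀ (two_ne_zero : (2 : ℝ) ≠ 0), add_comm j]

theorem dyadic_zero {n : ℕ} (η : 𝓢(Heis n, ℂ)) : dyadic 0 η = η := by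
  ext z
  rw [dyadic, dilate_apply]
  simp only [zpow_zero, dilation_one]

/-- Degree `-Q` is exactly the degree in which the scaling factor of the pairing is `1`, so every
dyadic shell reduces to the same one. -/
theorem IsHomogeneousDistribution.apply_dyadic {n : ℕ} {k : 𝓢'(Heis n, ℂ)}
    (hk : IsHomogeneousDistribution (-(homDim n : ℤ)) k) (j : ℤ) (φ : 𝓢(Heis n, ℂ)) :
    k (dyadic j φ) = k φ := by
  rw [dyadic, dilate, hk _ (two_zpow_pos j)]
  simp

/-- A smooth function with compact support that is `1` near the origin. -/
def originCutoff (n : ℕ) : 𝓢(Heis n, ℂ) :=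
  HasCompactSupport.toSchwartzMap
    (f := fun y => (((⟨1, 2, one_pos, one_lt_two⟩ : ContDiffBump (0 : Heis n)) y : ℝ) : ℂ))
    ((ContDiffBump.hasCompactSupport _).comp_left (g := ((↑) : ℝ → ℂ)) rfl)
    (Complex.ofRealCLM.contDiff.comp (ContDiffBump.contDiff _))

theorem originCutoff_eq_one {n : ℕ} {z : Heis n} (hz : ‖z‖ ≤ 1) : originCutoff n z = 1 := by
  change ((_ : ℝ) : ℂ) = 1
  rw [ContDiffBump.one_of_mem_closedBall]
  · simp
  · simpa using hz

theorem originCutoff_eq_zero {n : ℕ} {z : Heis n} (hz : 2 ≤ ‖z‖) : originCutoff n z = 0 := by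
  change ((_ : ℝ) : ℂ) = 0
  rw [ContDiffBump.zero_of_le_dist]
  · simp
  · simpa using hz

/-- The dyadic partition function `χ - χ ∘ δ_2`. -/
def annulusCutoff (n : ℕ) : 𝓢(Heis n, ℂ) := originCutoff n - dyadic 1 (originCutoff n)

theorem annulusCutoff_apply {n : ℕ} (z : Heis n) : annulusCutoff n z
    = originCutoff n z - originCutoff n (dilation n ((2 : ℝ) ^ (1 : ℤ)) (two_zpow_pos 1).ne' z) :=
  rfl

/-- The radius is `1/4` because `δ_2` can stretch the Euclidean norm by the factor `2² = 4`. -/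
theorem annulusCutoff_eq_zero_of_lt {n : ℕ} {z : Heis n} (hz : ‖z‖ < 1 / 4) :
    annulusCutoff n z = 0 := by
  have := norm_dilation_le_of_one_le (two_zpow_pos 1) (by norm_num) z
  rw [annulusCutoff_apply, originCutoff_eq_one (by linarith), originCutoff_eq_one, sub_self]
  norm_num at this ⊢
  linarith

theorem annulusCutoff_eq_zero_of_le {n : ℕ} {z : Heis n} (hz : 2 ≤ ‖z‖) :
    annulusCutoff n z = 0 := by
  have := le_norm_dilation_of_one_le (two_zpow_pos 1) (by norm_num) z
  rw [annulusCutoff_apply, originCutoff_eq_zero hz, originCutoff_eq_zero, sub_self]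
  norm_num at this ⊢
  linarith

theorem hasCompactSupport_annulusCutoff (n : ℕ) : HasCompactSupport (annulusCutoff n) :=
  HasCompactSupport.of_support_subset_isCompact (isCompact_closedBall 0 2) fun z hz => by
    by_contra h
    refine hz (annulusCutoff_eq_zero_of_le ?_)
    simp only [mem_closedBall_iff_norm, sub_zero, not_le] at h
    exact h.le

theorem zero_notMem_tsupport_annulusCutoff (n : ℕ) : 0 ∉ tsupport (annulusCutoff n) := by
  rw [notMem_tsupport_iff_eventuallyEq]
  filter_upwards [Metric.ball_mem_nhds (0 : Heis n) (by norm_num : (0 : ℝ) < 1 / 4)] with z hz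
  exact annulusCutoff_eq_zero_of_lt (by simpa using hz)

theorem tendsto_two_zpow_neg : Tendsto (fun J : ℕ => (2 : ℝ) ^ (-(J : ℤ))) atTop (𝓝 0) := by
  have := tendsto_pow_atTop_nhds_zero_of_lt_one (r := (2⁻¹ : ℝ)) (by norm_num) (by norm_num)
  refine this.congr fun J => ?_
  simp

theorem eventually_originCutoff_neg {n : ℕ} (z : Heis n) :
    ∀ᶠ J : ℕ in atTop, dyadic (-(J : ℤ)) (originCutoff n) z = 1 := by
  have h : Tendsto (fun J : ℕ => (2 : ℝ) ^ (-(J : ℤ)) * ‖z‖) atTop (𝓝 0) := by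
    simpa using tendsto_two_zpow_neg.mul_const ‖z‖
  filter_upwards [h.eventually_lt_const one_pos] with J hJ
  rw [dyadic, dilate_apply]
  refine originCutoff_eq_one ((norm_dilation_le_of_le_one (two_zpow_pos _) ?_ z).trans hJ.le)
  exact zpow_le_one_of_nonpos₀ (by norm_num) (by simp)

theorem eventually_originCutoff {n : ℕ} {z : Heis n} (hz : z ≠ 0) :
    ∀ᶠ J : ℕ in atTop, dyadic (J : ℤ) (originCutoff n) z = 0 := by
  have h : Tendsto (fun J : ℕ => (2 : ℝ) ^ J * ‖z‖) atTop atTop :=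
    (tendsto_pow_atTop_atTop_of_one_lt one_lt_two).atTop_mul_const (norm_pos_iff.2 hz)
  filter_upwards [h.eventually_ge_atTop 2] with J hJ
  rw [dyadic, dilate_apply]
  refine originCutoff_eq_zero (le_trans ?_ (le_norm_dilation_of_one_le (two_zpow_pos _) ?_ z))
  · simpa using hJ
  · simpa using one_le_pow₀ (one_le_two : (1 : ℝ) ≤ 2)

theorem dyadic_annulusCutoff {n : ℕ} (j : ℤ) : dyadic j (annulusCutoff n)
    = dyadic j (originCutoff n) - dyadic (j + 1) (originCutoff n) := by
  rw [annulusCutoff, map_sub, dyadic_dyadic]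

theorem annulusCutoff_zero (n : ℕ) : annulusCutoff n 0 = 0 :=
  annulusCutoff_eq_zero_of_lt (by simp)

/-- The series telescopes between `χ(0) = 1` at `j = -∞` and `0` at `j = +∞`. -/
theorem hasSum_annulusCutoff {n : ℕ} {z : Heis n} (hz : z ≠ 0) :
    HasSum (fun j : ℤ => dyadic j (annulusCutoff n) z) 1 := by
  have hs := summable_dyadic (annulusCutoff n) (l := 0) (Or.inr (annulusCutoff_zero n)) hz
  simp only [pow_zero, one_mul, dyadic_annulusCutoff, sub_apply] at hs ⊢
  have := hasSum_int_telescoping (A := 0) (B := 1) hs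
    (tendsto_const_nhds.congr' ((eventually_originCutoff hz).mono fun J h => h.symm))
    (tendsto_const_nhds.congr' ((eventually_originCutoff_neg z).mono fun J h => h.symm))
  simpa using this

theorem exists_schwartz_eq_mul {n : ℕ} {f : Heis n → ℂ} (hf : ContDiffOn ℝ ∞ f {0}ᶜ)
    {ψ : 𝓢(Heis n, ℂ)} (hc : HasCompactSupport ψ) (h0 : 0 ∉ tsupport ψ) :
    ∃ h : 𝓢(Heis n, ℂ), (∀ z, h z = f z * ψ z) := by
  refine ⟨HasCompactSupport.toSchwartzMap (f := fun z => f z * ψ z) hc.mul_left ?_, fun z => rfl⟩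
  rw [contDiff_iff_contDiffAt]
  intro z
  by_cases hz : z ∈ tsupport ψ
  · have hz0 : z ≠ 0 := fun h => h0 (h ▸ hz)
    exact (hf.contDiffAt (isOpen_compl_singleton.mem_nhds hz0)).mul (ψ.smooth ⊤).contDiffAt
  · refine contDiffAt_const (c := (0 : ℂ)) |>.congr_of_eventuallyEq ?_
    filter_upwards [notMem_tsupport_iff_eventuallyEq.1 hz] with w hw
    simp [hw]

/-- The kernel `e^{-i⟪x, y⟫}` is the standard character composed with the bilinear form `⟪x, y⟫ /
2π`; this form is symmetric, so the general multiplication formula applies on both sides. -/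
theorem integral_mul_fourierSchwartz {n : ℕ} (h φ : 𝓢(Heis n, ℂ)) :
    ∫ y, h y * fourierSchwartz n φ y = ∫ y, fourierSchwartz n h y * φ y := by
  let L : Heis n →ₗ[ℝ] Heis n →ₗ[ℝ] ℝ := (2 * Real.pi)⁻¹ • innerₗ (Heis n)
  have hL : ∀ x y, L x y = (2 * Real.pi)⁻¹ * (inner ℝ x y : ℝ) := fun x y => rfl
  have hF : ∀ (φ : 𝓢(Heis n, ℂ)) (y), fourierSchwartz n φ y
      = VectorFourier.fourierIntegral Real.fourierChar volume L φ y := by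
    intro φ y
    rw [fourierSchwartz_apply, VectorFourier.fourierIntegral]
    congr 1; ext x
    rw [Circle.smul_def, Real.fourierChar_apply, smul_eq_mul, mul_comm, hL]
    congr 2
    have : (Real.pi : ℂ) ≠ 0 := by exact_mod_cast Real.pi_ne_zero
    push_cast
    field_simp
  have hflip : L.flip = L := by
    ext x y; simp only [LinearMap.flip_apply, hL, real_inner_comm]
  have := VectorFourier.integral_fourierIntegral_smul_eq_flip (μ := (volume : Measure (Heis n)))
    (ν := (volume : Measure (Heis n))) (L := L)
    Real.continuous_fourierChar (by simp only [hL]; fun_prop) h.integrable φ.integrable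
  rw [hflip] at this
  simp only [hF]
  exact this.symm

theorem fourierSchwartz_zero {n : ℕ} (φ : 𝓢(Heis n, ℂ)) : fourierSchwartz n φ 0 = ∫ z, φ z := by
  rw [fourierSchwartz_apply]; simp

theorem fourierSchwartz_dyadic {n : ℕ} (j : ℤ) (φ : 𝓢(Heis n, ℂ)) :
    dyadic (-j) (fourierSchwartz n φ)
      = (((2 : ℝ) ^ j : ℝ) : ℂ) ^ homDim n • fourierSchwartz n (dyadic j φ) := by
  rw [dyadic, dyadic, fourierSchwartz_dilate (two_zpow_pos j), smul_smul, mul_inv_cancel₀, one_smul]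
  · congr 3
    simp
  · exact pow_ne_zero _ (by exact_mod_cast (two_zpow_pos j).ne')

/-- The dilation keeps its sign: it is inverted by the Fourier transform and again by the change of
variables, and the two Jacobians cancel. -/
theorem integral_mul_dyadic_fourierSchwartz {n : ℕ} (j : ℤ) (h φ : 𝓢(Heis n, ℂ)) :
    ∫ x, h x * dyadic (-j) (fourierSchwartz n φ) x
      = ∫ y, dyadic (-j) (fourierSchwartz n h) y * φ y := by
  rw [fourierSchwartz_dyadic]
  have e1 : ∀ x, h x * ((((2 : ℝ) ^ j : ℝ) : ℂ) ^ homDim n • fourierSchwartz n (dyadic j φ)) x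
      = (((2 : ℝ) ^ j : ℝ) : ℂ) ^ homDim n * (h x * fourierSchwartz n (dyadic j φ) x) := by
    intro x; rw [smul_apply, smul_eq_mul]; ring
  simp only [e1]
  have e2 := integral_comp_dilation (two_zpow_pos j)
    fun y => dyadic (-j) (fourierSchwartz n h) y * φ y
  have e3 : ∀ y, dyadic (-j) (fourierSchwartz n h) (dilation n _ (two_zpow_pos j).ne' y)
      = fourierSchwartz n h y := by
    intro y
    have := congrArg (fun η : 𝓢(Heis n, ℂ) => η y) (dyadic_dyadic j (-j) (fourierSchwartz n h))
    rw [add_neg_cancel, dyadic_zero] at this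
    exact this
  simp only [e3] at e2
  rw [integral_const_mul, integral_mul_fourierSchwartz]
  change _ * ∫ y, fourierSchwartz n h y * φ (dilation n _ (two_zpow_pos j).ne' y) = _
  rw [e2, mul_inv_cancel_left₀]
  exact pow_ne_zero _ (by exact_mod_cast (two_zpow_pos j).ne')

theorem tsupport_mulSchwartz_subset {n : ℕ} (ψ θ : 𝓢(Heis n, ℂ)) :
    tsupport (mulSchwartz ψ θ) ⊆ tsupport ψ := by
  refine closure_mono fun z hz hψ => hz ?_
  rw [mulSchwartz_apply, hψ, zero_mul]

/-- The Fourier transform of a homogeneous kernel, as a dyadic series. -/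
theorem isSmoothPart_fourierDist {n : ℕ} {k : 𝓢'(Heis n, ℂ)} {f : Heis n → ℂ}
    (hf : IsSmoothPart k f) (hk : IsHomogeneousDistribution (-(homDim n : ℤ)) k)
    {h : 𝓢(Heis n, ℂ)} (hh : ∀ z, h z = f z * annulusCutoff n z) :
    fourierSchwartz n h 0 = 0 ∧ IsSmoothPart (fourierDist k)
      fun y => k (originCutoff n) + dyadicSum 0 (fourierSchwartz n h) y := by
  have hkψ : ∀ θ : 𝓢(Heis n, ℂ), k (mulSchwartz (annulusCutoff n) θ) = ∫ x, h x * θ x := by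
    intro θ
    rw [hf.2 _ ((hasCompactSupport_annulusCutoff n).mono' ?_) ?_]
    · congr 1; ext x; rw [mulSchwartz_apply, hh, mul_assoc]
    · exact (subset_tsupport _).trans (tsupport_mulSchwartz_subset _ _)
    · exact fun h => zero_notMem_tsupport_annulusCutoff n (tsupport_mulSchwartz_subset _ _ h)
  -- The mean of `h` is `k(χ) - k(χ ∘ δ_2)`, which vanishes by dilation invariance. Without this the
  -- series for `k̂` would not converge as `j → -∞`.
  have hη : fourierSchwartz n h 0 = 0 := by
    have e := hf.2 _ (hasCompactSupport_annulusCutoff n) (zero_notMem_tsupport_annulusCutoff n)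
    rw [fourierSchwartz_zero]
    simp only [hh]
    rw [← e, annulusCutoff, map_sub, hk.apply_dyadic, sub_self]
  refine ⟨hη, contDiffOn_const.add (contDiffOn_dyadicSum _ (Or.inr hη)), fun φ hc h0 => ?_⟩
  set η := fourierSchwartz n h
  set θ := fourierSchwartz n φ
  -- Dilation invariance moves the shell `j` to the shell `0`, where `k` is integration against `h`.
  have hpiece : ∀ j : ℤ, k (mulSchwartz (dyadic j (annulusCutoff n)) θ)
      = ∫ y, dyadic (-j) η y * φ y := by
    intro j
    rw [← hk.apply_dyadic (-j), dyadic, dilate_mulSchwartz, ← dyadic, dyadic_dyadic,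
      neg_add_cancel, dyadic_zero, hkψ, integral_mul_dyadic_fourierSchwartz]
  obtain ⟨C, N, hC, hb⟩ := norm_dyadic_le η (l := 0) (Or.inr hη)
  simp only [pow_zero, one_mul] at hb
  -- The support of `φ` is compact and misses the origin, so the singular weight is bounded on it.
  obtain ⟨D, hD⟩ : ∃ D, ∀ y ∈ tsupport φ, (1 + ‖y‖ + ‖y‖⁻¹ ^ N) * ‖φ y‖ ≤ D := by
    have hco : ContinuousOn (fun y : Heis n => (1 + ‖y‖ + ‖y‖⁻¹ ^ N) * ‖φ y‖) (tsupport φ) := by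
      refine ContinuousOn.mul (ContinuousOn.add (by fun_prop) (ContinuousOn.pow
        (ContinuousOn.inv₀ (by fun_prop) fun y hy => ?_) N)) φ.continuous.norm.continuousOn
      exact norm_ne_zero_iff.2 fun h => h0 (h ▸ hy)
    obtain ⟨D, hD⟩ := hc.isCompact.exists_bound_of_continuousOn hco
    exact ⟨D, fun y hy => (le_abs_self _).trans (hD y hy)⟩
  have hbound : ∀ j y, ‖dyadic j η y * φ y‖ ≤
      (tsupport φ).indicator (fun _ => C * min ((2 : ℝ) ^ j) ((2 : ℝ) ^ j)⁻¹ * D) y := by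
    intro j y
    by_cases hy : y ∈ tsupport φ
    · rw [indicator_of_mem hy, norm_mul]
      calc _ ≤ C * min ((2 : ℝ) ^ j) ((2 : ℝ) ^ j)⁻¹ * (1 + ‖y‖ + ‖y‖⁻¹ ^ N) * ‖φ y‖ := by
            gcongr; exact hb j y fun h => h0 (h ▸ hy)
        _ ≤ _ := by
            rw [mul_assoc]; gcongr; exact hD y hy
    · rw [indicator_of_notMem hy, image_eq_zero_of_notMem_tsupport hy, mul_zero, norm_zero]
  have hindic : ∀ c : ℝ, Integrable ((tsupport φ).indicator fun _ => c) := fun c =>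
    (integrable_indicator_iff (isClosed_tsupport φ).measurableSet).2
      (integrableOn_const hc.isCompact.measure_lt_top.ne)
  have hint : ∀ j : ℤ, Integrable fun y => dyadic j η y * φ y := fun j =>
    (hindic _).mono' (by fun_prop) (ae_of_all _ (hbound j))
  have hsum : HasSum (fun j : ℤ => ∫ y, dyadic j η y * φ y) (∫ y, dyadicSum 0 η y * φ y) := by
    have h1 := hasSum_integral_of_summable_integral_norm hint ?_
    · have e : ∀ y, dyadicSum 0 η y * φ y = ∑' j : ℤ, dyadic j η y * φ y := fun y => by
        simp only [dyadicSum, pow_zero, one_mul, tsum_mul_right]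
      simp only [e]
      exact h1
    · refine ((summable_min_two_zpow.mul_left C).mul_right
        (D * volume.real (tsupport φ))).of_nonneg_of_le
        (fun j => integral_nonneg fun y => norm_nonneg _) fun j => ?_
      refine (integral_mono (hint j).norm (hindic _) (hbound j)).trans_eq ?_
      rw [integral_indicator (isClosed_tsupport φ).measurableSet, setIntegral_const, smul_eq_mul]
      ring
  have hneg : HasSum (fun j : ℤ => k (mulSchwartz (dyadic j (annulusCutoff n)) θ))
      (∫ y, dyadicSum 0 η y * φ y) := by
    simp only [hpiece]
    exact (Equiv.neg ℤ).hasSum_iff.2 hsum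
  -- The same series computed by telescoping. Its sum differs from `k θ` by the multiple `θ 0 * k
  -- χ`, which is the source of the constant `k χ` in the formula for `k̂`.
  have htel : HasSum (fun j : ℤ => k (mulSchwartz (dyadic j (annulusCutoff n)) θ))
      (k θ - θ 0 * k (originCutoff n)) := by
    have hsm := hneg.summable
    simp only [dyadic_annulusCutoff, mulSchwartz_sub_left, map_sub] at hsm ⊢
    have hr1 : ∀ J : ℕ, (2 : ℝ) ^ (-(J : ℤ)) ≤ 1 := fun J =>
      zpow_le_one_of_nonpos₀ (by norm_num) (by simp)
    refine hasSum_int_telescoping (b := fun j => k (mulSchwartz (dyadic j (originCutoff n)) θ))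
      hsm ?_ ?_
    -- At `j → +∞` the cutoffs shrink to the origin; invariance trades this for `χ` times a
    -- flattening dilate of `θ`, which converges to `θ 0 • χ` in the Schwartz topology.
    · have := (k.continuous.tendsto _).comp
        (tendsto_mulSchwartz_dilate θ (originCutoff n) (fun J => two_zpow_pos _) hr1
          tendsto_two_zpow_neg)
      have hks : k (θ 0 • originCutoff n) = θ 0 * k (originCutoff n) := by
        rw [map_smul, smul_eq_mul]
      rw [← hks]
      refine this.congr fun J => ?_
      change k (mulSchwartz (dyadic (-(J : ℤ)) θ) (originCutoff n)) = k _
      rw [← hk.apply_dyadic (-(J : ℤ)) (mulSchwartz (dyadic J (originCutoff n)) θ), dyadic, dyadic,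
        dilate_mulSchwartz, ← dyadic, ← dyadic, dyadic_dyadic, neg_add_cancel, dyadic_zero,
        mulSchwartz_comm]
    · have := (k.continuous.tendsto _).comp
        (tendsto_mulSchwartz_dilate (originCutoff n) θ (fun J => two_zpow_pos _) hr1
          tendsto_two_zpow_neg)
      rw [originCutoff_eq_one (by simp), one_smul] at this
      exact this
  have hfin := htel.unique hneg
  change k θ = _
  have hθ0 : θ 0 = ∫ y, φ y := fourierSchwartz_zero φ
  have hsplit : ∫ y, (k (originCutoff n) + dyadicSum 0 η y) * φ y
      = k (originCutoff n) * (∫ y, φ y) + ∫ y, dyadicSum 0 η y * φ y := by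
    simp only [add_mul]
    rw [integral_add (φ.integrable.const_mul _), integral_const_mul]
    have hcn := (contDiffOn_dyadicSum η (l := 0) (Or.inr hη)).continuousOn
    have : IntegrableOn (fun x => dyadicSum 0 η x * φ x) (tsupport φ) :=
      ContinuousOn.integrableOn_compact hc
        ((hcn.mono fun x hx hx0 => h0 (hx0 ▸ hx)).mul φ.continuous.continuousOn)
    refine (integrableOn_iff_integrable_of_support_subset fun x hx => subset_tsupport φ ?_).1 this
    exact fun h => hx (by simp [h])
  rw [hsplit, ← hfin, hθ0]
  ring

/-! ### Central Taylor expansion of the Fourier transform -/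

theorem hasTemperateGrowth_snd (n : ℕ) :
    Function.HasTemperateGrowth fun z : Heis n => -Complex.I * (z.snd : ℂ) :=
  ((-Complex.I) • (Complex.ofRealCLM ∘L WithLp.sndL 2 ℝ (Horiz n) ℝ)).hasTemperateGrowth

/-- Multiplication by `-it`. -/
def centralMul (n : ℕ) : 𝓢(Heis n, ℂ) →L[ℂ] 𝓢(Heis n, ℂ) :=
  SchwartzMap.smulLeftCLM ℂ fun z : Heis n => -Complex.I * (z.snd : ℂ)

theorem centralMul_apply {n : ℕ} (h : 𝓢(Heis n, ℂ)) (z : Heis n) :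
    centralMul n h z = -Complex.I * (z.snd : ℂ) * h z :=
  SchwartzMap.smulLeftCLM_apply_apply (hasTemperateGrowth_snd n) h z

theorem centralMul_iterate_apply {n : ℕ} (h : 𝓢(Heis n, ℂ)) (l : ℕ) (z : Heis n) :
    (centralMul n)^[l] h z = (-Complex.I * (z.snd : ℂ)) ^ l * h z := by
  induction l with
  | zero => simp
  | succ l ih => rw [Function.iterate_succ_apply', centralMul_apply, ih]; ring

theorem fourierSchwartz_eq_smul {n : ℕ} (h : 𝓢(Heis n, ℂ)) (z : Heis n) :
    fourierSchwartz n h z = (𝓕 h : 𝓢(Heis n, ℂ)) ((2 * Real.pi)⁻¹ • z) := rfl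

theorem SchwartzMap.hasDerivAt_heisPt {n : ℕ} (η : 𝓢(Heis n, ℂ)) (c : ℝ) (x : Horiz n) (s : ℝ) :
    HasDerivAt (fun s => η (c • heisPt x s))
      (LineDeriv.lineDerivOp (c • (heisPt 0 1 : Heis n)) η (c • heisPt x s)) s := by
  have h := (η.differentiableAt (x := c • heisPt x s)).lineDifferentiableAt
    (v := c • (heisPt 0 1 : Heis n)) |>.hasLineDerivAt
  rw [← SchwartzMap.lineDerivOp_apply] at h
  unfold HasLineDerivAt at h
  have h2 := HasDerivAt.comp_sub_const s s (by rw [sub_self]; exact h)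
  refine h2.congr_of_eventuallyEq (Eventually.of_forall fun u => ?_)
  have e : c • heisPt x u = c • heisPt x s + (u - s) • c • (heisPt 0 1 : Heis n) := by
    rw [smul_comm (u - s) c, ← smul_add]
    congr 1
    simp [heisPt, ← WithLp.toLp_smul, ← WithLp.toLp_add]
  exact congrArg η e

/-- Differentiation under the transform; the `2π` in the derivative formula for `𝓕` cancels against
the rescaling of the variable. -/
theorem hasDerivAt_fourierSchwartz {n : ℕ} (h : 𝓢(Heis n, ℂ)) (x : Horiz n) (s : ℝ) :
    HasDerivAt (fun s => fourierSchwartz n h (heisPt x s))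
      (fourierSchwartz n (centralMul n h) (heisPt x s)) s := by
  have h1 := (𝓕 h : 𝓢(Heis n, ℂ)).hasDerivAt_heisPt (2 * Real.pi)⁻¹ x s
  rw [LineDeriv.lineDerivOp_left_smul, smul_apply, SchwartzMap.lineDerivOp_fourier_eq] at h1
  refine h1.congr_deriv ?_
  symm
  have e : SchwartzMap.smulLeftCLM ℂ (inner ℝ · (heisPt 0 1 : Heis n)) h
      = Complex.I • centralMul n h := by
    ext z
    rw [SchwartzMap.smulLeftCLM_apply_apply (by fun_prop), smul_apply, centralMul_apply,
      WithLp.prod_inner_apply]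
    have : Complex.I * (-Complex.I * (z.snd : ℂ) * h z) = -(Complex.I * Complex.I) * z.snd * h z := by
      ring
    rw [smul_eq_mul, this, Complex.I_mul_I]
    simp [heisPt]
  rw [e, fourierSchwartz_eq_smul, FourierTransform.fourier_smul, FourierTransform.fourier_smul,
    smul_apply, smul_apply, Complex.real_smul, smul_eq_mul, smul_eq_mul]
  have hpi : (Real.pi : ℂ) ≠ 0 := by exact_mod_cast Real.pi_ne_zero
  have : ∀ a : ℂ, (((2 * Real.pi)⁻¹ : ℝ) : ℂ) * (-(2 * Real.pi * Complex.I) * (Complex.I * a))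
      = -(Complex.I * Complex.I) * a := by
    intro a
    push_cast
    field_simp
  rw [this, Complex.I_mul_I, neg_neg, one_mul]

/-- Schwartz functions each of which is the derivative of its predecessor in the central
direction. -/
def IsCentralDerivSeq {n : ℕ} (η : ℕ → 𝓢(Heis n, ℂ)) : Prop :=
  ∀ (l : ℕ) (x : Horiz n) (s : ℝ),
    HasDerivAt (fun s => η l (heisPt x s)) (η (l + 1) (heisPt x s)) s

theorem isCentralDerivSeq_fourierSchwartz {n : ℕ} (h : 𝓢(Heis n, ℂ)) :
    IsCentralDerivSeq fun l => fourierSchwartz n ((centralMul n)^[l] h) := by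
  intro l x s
  simp only [Function.iterate_succ_apply']
  exact hasDerivAt_fourierSchwartz _ x s

/-- The remainder of order `N` of the Taylor expansion at `(x, 0)` in the central direction. -/
def taylorRem {n : ℕ} (η : ℕ → 𝓢(Heis n, ℂ)) (N m : ℕ) (x : Horiz n) (s : ℝ) : ℂ :=
  η m (heisPt x s) - ∑ l ∈ Finset.range N, (s : ℂ) ^ l / (l.factorial : ℂ) * η (m + l) (heisPt x 0)

/-- Differentiation lowers the order of the remainder and shifts the sequence by one, which drives
the induction in `norm_taylorRem_le`. -/
theorem hasDerivAt_taylorRem {n : ℕ} {η : ℕ → 𝓢(Heis n, ℂ)} (hη : IsCentralDerivSeq η) (N m : ℕ)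
    (x : Horiz n) (s : ℝ) :
    HasDerivAt (taylorRem η (N + 1) m x) (taylorRem η N (m + 1) x s) s := by
  have hpow : ∀ l : ℕ, HasDerivAt (fun s : ℝ => (s : ℂ) ^ (l + 1) / ((l + 1).factorial : ℂ)
      * η (m + (l + 1)) (heisPt x 0))
      ((s : ℂ) ^ l / (l.factorial : ℂ) * η (m + 1 + l) (heisPt x 0)) s := by
    intro l
    have h1 := ((hasDerivAt_pow (l + 1) (s : ℂ)).comp_ofReal.div_const
      ((l + 1).factorial : ℂ)).mul_const (η (m + (l + 1)) (heisPt x 0))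
    refine h1.congr_deriv ?_
    rw [add_right_comm, Nat.factorial_succ, ← add_assoc]
    have : ((l : ℂ) + 1) ≠ 0 := by exact_mod_cast Nat.succ_ne_zero l
    have : (l.factorial : ℂ) ≠ 0 := by exact_mod_cast l.factorial_ne_zero
    push_cast
    field_simp
  have e : taylorRem η (N + 1) m x = fun s : ℝ => η m (heisPt x s)
      - (∑ l ∈ Finset.range N, (s : ℂ) ^ (l + 1) / ((l + 1).factorial : ℂ)
          * η (m + (l + 1)) (heisPt x 0) + η m (heisPt x 0)) := by
    ext s
    rw [taylorRem, Finset.sum_range_succ']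
    simp
  rw [e]
  exact (hη m x s).sub ((HasDerivAt.fun_sum fun l _ => hpow l).add_const _)

theorem SchwartzMap.one_add_norm_pow_mul_le {E : Type*} [NormedAddCommGroup E] [NormedSpace ℝ E]
    (η : 𝓢(E, ℂ)) (M : ℕ) : ∃ C, 0 ≤ C ∧ ∀ z, (1 + ‖z‖) ^ M * ‖η z‖ ≤ C := by
  have key : ∀ z, (1 + ‖z‖) ^ M * ‖η z‖ ≤
      2 ^ M * (Finset.Iic ((M, 0) : ℕ × ℕ)).sup
        (fun m => SchwartzMap.seminorm ℝ m.1 m.2) η := fun z => by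
    have := SchwartzMap.one_add_le_sup_seminorm_apply (𝕜 := ℝ) (m := (M, 0)) le_rfl le_rfl η z
    rwa [norm_iteratedFDeriv_zero] at this
  exact ⟨_, le_trans (by positivity) (key 0), key⟩

/-- Induction on `N` by the mean value inequality on `[-|s|, |s|]`. The point is that rapid decay in
`x` survives, uniformly in `s`. -/
theorem norm_taylorRem_le {n : ℕ} {η : ℕ → 𝓢(Heis n, ℂ)} (hη : IsCentralDerivSeq η) (M N m : ℕ) :
    ∃ C, 0 ≤ C ∧ ∀ (x : Horiz n) (s : ℝ), (1 + ‖x‖) ^ M * ‖taylorRem η N m x s‖ ≤ C * |s| ^ N := by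
  induction N generalizing m with
  | zero =>
    obtain ⟨C, hC, hb⟩ := (η m).one_add_norm_pow_mul_le M
    refine ⟨C, hC, fun x s => ?_⟩
    have e : taylorRem η 0 m x s = η m (heisPt x s) := by simp [taylorRem]
    rw [e, pow_zero, mul_one]
    refine le_trans ?_ (hb (heisPt x s))
    gcongr
    exact norm_le_norm_heisPt x s
  | succ N ih =>
    obtain ⟨C, hC, hb⟩ := ih (m + 1)
    refine ⟨C, hC, fun x s => ?_⟩
    have hp : 0 < (1 + ‖x‖) ^ M := by positivity
    have h0 : taylorRem η (N + 1) m x 0 = 0 := by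
      rw [taylorRem, Finset.sum_range_succ']
      simp
    have := Convex.norm_image_sub_le_of_norm_hasDerivWithin_le (f := taylorRem η (N + 1) m x)
      (f' := taylorRem η N (m + 1) x) (s := Icc (-|s|) |s|) (C := C * |s| ^ N / (1 + ‖x‖) ^ M)
      (fun t _ => (hasDerivAt_taylorRem hη N m x t).hasDerivWithinAt)
      (fun t ht => by
        rw [le_div_iff₀ hp, mul_comm]
        refine (hb x t).trans ?_
        exact mul_le_mul_of_nonneg_left
          (pow_le_pow_left₀ (abs_nonneg t) (abs_le.2 ht) N) hC) (convex_Icc _ _) (x := 0) (y := s) (by simp)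
      ⟨neg_abs_le s, le_abs_self s⟩
    rw [h0, sub_zero, sub_zero, Real.norm_eq_abs, div_mul_eq_mul_div, le_div_iff₀ hp] at this
    rw [mul_comm, pow_succ, ← mul_assoc]
    exact this

/-- Uniqueness of asymptotic power series at `0+`: once the lower coefficients vanish, divide by
`s^m` and let `s → 0`. -/
theorem eq_zero_of_sum_isBigO {c : ℕ → ℂ} (h : ∀ N : ℕ, (fun s : ℝ => ∑ l ∈ Finset.range (N + 1),
    (s : ℂ) ^ l * c l) =O[𝓝[>] 0] fun s => s ^ (N + 1)) (l : ℕ) : c l = 0 := by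
  induction l using Nat.strong_induction_on with
  | _ m ih =>
    obtain ⟨C, hC⟩ := (h m).bound
    have hev : ∀ᶠ s : ℝ in 𝓝[>] 0, ‖c m‖ ≤ C * s := by
      filter_upwards [hC, self_mem_nhdsWithin] with s hs hpos
      have hpos : 0 < s := hpos
      rw [Finset.sum_range_succ, Finset.sum_eq_zero, zero_add, norm_mul, norm_pow,
        Complex.norm_real, norm_pow, Real.norm_eq_abs, abs_of_pos hpos, pow_succ] at hs
      · have hp : 0 < s ^ m := by positivity
        have : s ^ m * ‖c m‖ ≤ s ^ m * (C * s) := by linarith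
        exact le_of_mul_le_mul_left this hp
      · intro l hl
        rw [ih l (Finset.mem_range.1 hl), mul_zero]
    have hlim : Tendsto (fun s : ℝ => C * s) (𝓝[>] 0) (𝓝 0) := by
      have : Tendsto (fun s : ℝ => C * s) (𝓝 0) (𝓝 (C * 0)) := (continuous_const_mul C).tendsto 0
      rw [mul_zero] at this
      exact this.mono_left nhdsWithin_le_nhds
    exact norm_le_zero_iff.1 (ge_of_tendsto hlim hev)

/-! ### The expansion of the symbol -/

/-- The symbol `c + ∑_j η(δ_{2^j} y)`. -/
def dyadicSymbol {n : ℕ} (c : ℂ) (η : ℕ → 𝓢(Heis n, ℂ)) (y : Heis n) : ℂ := c + dyadicSum 0 (η 0) y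

/-- The term of order `-2l` in the expansion of `dyadicSymbol c η`. -/
def dyadicTerm {n : ℕ} (c : ℂ) (η : ℕ → 𝓢(Heis n, ℂ)) (l : ℕ) (x : Horiz n) : ℂ :=
  (if l = 0 then c else 0) + (l.factorial : ℂ)⁻¹ * dyadicSum l (η l) (heisPt x 0)

theorem contDiffOn_dyadicTerm {n : ℕ} (c : ℂ) {η : ℕ → 𝓢(Heis n, ℂ)} (h0 : η 0 0 = 0) (l : ℕ) :
    ContDiffOn ℝ ∞ (dyadicTerm c η l) {0}ᶜ := by
  have hl : l ≠ 0 ∨ η l 0 = 0 := by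
    rcases Nat.eq_zero_or_pos l with rfl | hl
    · exact Or.inr h0
    · exact Or.inl hl.ne'
  refine contDiffOn_const.add (contDiffOn_const.mul
    ((contDiffOn_dyadicSum (η l) hl).comp (t := {0}ᶜ) (f := fun x => heisPt x 0) ?_ ?_))
  · have : ContDiff ℝ ∞ fun x : Horiz n =>
        (WithLp.prodContinuousLinearEquiv 2 ℝ (Horiz n) ℝ).symm (x, (0 : ℝ)) :=
      (ContinuousLinearEquiv.contDiff _).comp (contDiff_id.prodMk contDiff_const)
    exact this.contDiffOn
  · exact fun x hx => heisPt_ne_zero_of_left hx 0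

/-- Since `δ_{2^j}` scales the central variable by `4^j`, the Taylor polynomials of the pieces sum
termwise to the series defining `dyadicTerm`. The order `N + 1` is positive, so the term `l = 0`
occurs and its constant `c` cancels the one in the symbol. -/
theorem hasSum_taylorRem {n : ℕ} (c : ℂ) {η : ℕ → 𝓢(Heis n, ℂ)} (h0 : η 0 0 = 0) (N : ℕ)
    {x : Horiz n} {s : ℝ} (hx : x ≠ 0) :
    HasSum (fun j : ℤ => taylorRem η (N + 1) 0 ((2 : ℝ) ^ j • x) ((4 : ℝ) ^ j * s))
      (dyadicSymbol c η (heisPt x s)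
        - ∑ l ∈ Finset.range (N + 1), (s : ℂ) ^ l * dyadicTerm c η l x) := by
  have h1 : HasSum (fun j : ℤ => dyadic j (η 0) (heisPt x s)) (dyadicSum 0 (η 0) (heisPt x s)) := by
    have := (summable_dyadic (η 0) (l := 0) (Or.inr h0) (heisPt_ne_zero_of_left hx s)).hasSum
    simpa only [pow_zero, one_mul, dyadicSum] using this
  have h2 : ∀ l : ℕ, HasSum (fun j : ℤ => (s : ℂ) ^ l * ((l.factorial : ℂ)⁻¹ *
      (((4 : ℂ) ^ j) ^ l * dyadic j (η l) (heisPt x 0))))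
      ((s : ℂ) ^ l * ((l.factorial : ℂ)⁻¹ * dyadicSum l (η l) (heisPt x 0))) := by
    intro l
    have hl : l ≠ 0 ∨ η l 0 = 0 := by
      rcases Nat.eq_zero_or_pos l with rfl | hl
      · exact Or.inr h0
      · exact Or.inl hl.ne'
    exact ((summable_dyadic (η l) hl (heisPt_ne_zero_of_left hx 0)).hasSum.mul_left _).mul_left _
  have h3 := h1.sub (hasSum_sum (s := Finset.range (N + 1)) fun l _ => h2 l)
  have e1 : ∀ j : ℤ, taylorRem η (N + 1) 0 ((2 : ℝ) ^ j • x) ((4 : ℝ) ^ j * s)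
      = dyadic j (η 0) (heisPt x s) - ∑ l ∈ Finset.range (N + 1), (s : ℂ) ^ l *
        ((l.factorial : ℂ)⁻¹ * (((4 : ℂ) ^ j) ^ l * dyadic j (η l) (heisPt x 0))) := by
    intro j
    rw [taylorRem, dyadic_apply]
    congr 1
    refine Finset.sum_congr rfl fun l _ => ?_
    rw [dyadic_apply, mul_zero, zero_add]
    push_cast
    rw [mul_pow]
    ring
  have e2 : dyadicSymbol c η (heisPt x s)
        - ∑ l ∈ Finset.range (N + 1), (s : ℂ) ^ l * dyadicTerm c η l x
      = dyadicSum 0 (η 0) (heisPt x s) - ∑ l ∈ Finset.range (N + 1), (s : ℂ) ^ l *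
        ((l.factorial : ℂ)⁻¹ * dyadicSum l (η l) (heisPt x 0)) := by
    simp only [dyadicSymbol, dyadicTerm, mul_add, Finset.sum_add_distrib]
    rw [Finset.sum_eq_single 0 (by intro l _ hl; simp [hl]) (by simp)]
    simp
  rw [e2]
  simp only [e1]
  exact h3

/-- The remainder grows like `r^{2(N+1)}` under dilation by `r = 2^j`. This suffices for `r ≤ 1`;
for `r ≥ 1` the horizontal decay of order `2N + 3 = 2(N+1) + 1` leaves a factor `r⁻¹`. -/
theorem norm_taylorRem_dyadic_le {n : ℕ} {η : ℕ → 𝓢(Heis n, ℂ)} (hη : IsCentralDerivSeq η)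
    (N : ℕ) : ∃ C, 0 ≤ C ∧ ∀ (j : ℤ) (x : Horiz n) (s : ℝ), x ≠ 0 →
      ‖taylorRem η (N + 1) 0 ((2 : ℝ) ^ j • x) ((4 : ℝ) ^ j * s)‖
        ≤ C * |s| ^ (N + 1) * (1 + ‖x‖⁻¹ ^ (2 * N + 3)) * min ((2 : ℝ) ^ j) ((2 : ℝ) ^ j)⁻¹ := by
  obtain ⟨C, hC, hb⟩ := norm_taylorRem_le hη (2 * N + 3) (N + 1) 0
  refine ⟨C, hC, fun j x s hx => ?_⟩
  have hx' : 0 < ‖x‖ := norm_pos_iff.2 hx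
  set r : ℝ := (2 : ℝ) ^ j with hr
  have hr0 : 0 < r := two_zpow_pos j
  have h4 : (4 : ℝ) ^ j = r ^ 2 := by
    rw [hr, ← zpow_natCast, ← zpow_mul, mul_comm j, zpow_mul]; norm_num
  rw [h4]
  have hT := hb (r • x) (r ^ 2 * s)
  rw [abs_mul, abs_of_pos (by positivity), norm_smul, Real.norm_eq_abs, abs_of_pos hr0] at hT
  rcases le_total r 1 with h1 | h1
  · rw [min_eq_left (h1.trans ((one_le_inv₀ hr0).2 h1))]
    calc _ ≤ (1 + r * ‖x‖) ^ (2 * N + 3) * ‖taylorRem η (N + 1) 0 (r • x) (r ^ 2 * s)‖ :=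
          le_mul_of_one_le_left (norm_nonneg _) (one_le_pow₀ (by nlinarith))
      _ ≤ C * (r ^ 2 * |s|) ^ (N + 1) := hT
      _ = C * |s| ^ (N + 1) * 1 * r ^ (2 * (N + 1)) := by rw [mul_pow, ← pow_mul]; ring
      _ ≤ _ := by
        gcongr
        · have : 0 ≤ ‖x‖⁻¹ ^ (2 * N + 3) := by positivity
          linarith
        · exact pow_le_of_le_one hr0.le h1 (by omega)
  · rw [min_eq_right ((inv_le_one_of_one_le₀ h1).trans h1)]
    have hd : 0 < (r * ‖x‖) ^ (2 * N + 3) := by positivity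
    have : (r * ‖x‖) ^ (2 * N + 3) * ‖taylorRem η (N + 1) 0 (r • x) (r ^ 2 * s)‖
        ≤ C * (r ^ 2 * |s|) ^ (N + 1) := by
      refine le_trans ?_ hT
      gcongr
      linarith
    rw [← le_div_iff₀' hd] at this
    refine this.trans ?_
    calc _ = C * |s| ^ (N + 1) * (‖x‖⁻¹ ^ (2 * N + 3)) * r⁻¹ := by
          rw [mul_pow, ← pow_mul, mul_pow, show 2 * N + 3 = 2 * (N + 1) + 1 by ring, inv_pow]
          field_simp
          ring
      _ ≤ _ := by
        gcongr
        linarith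

theorem norm_dyadicSymbol_sub_le {n : ℕ} (c : ℂ) {η : ℕ → 𝓢(Heis n, ℂ)} (hη : IsCentralDerivSeq η)
    (h0 : η 0 0 = 0) (N : ℕ) : ∃ C, 0 ≤ C ∧ ∀ (x : Horiz n) (s : ℝ), x ≠ 0 →
      ‖dyadicSymbol c η (heisPt x s) - ∑ l ∈ Finset.range (N + 1), (s : ℂ) ^ l * dyadicTerm c η l x‖
        ≤ C * |s| ^ (N + 1) * (1 + ‖x‖⁻¹ ^ (2 * N + 3)) := by
  obtain ⟨C, hC, hb⟩ := norm_taylorRem_dyadic_le hη N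
  refine ⟨C * ∑' j : ℤ, min ((2 : ℝ) ^ j) ((2 : ℝ) ^ j)⁻¹,
    mul_nonneg hC (tsum_nonneg fun j => by positivity), fun x s hx => ?_⟩
  rw [← (hasSum_taylorRem c h0 N hx).tsum_eq]
  refine (tsum_of_norm_bounded (summable_min_two_zpow.hasSum.mul_left _)
    fun j => hb j x s hx).trans_eq ?_
  ring

theorem norm_dyadicTerm_zero_le {n : ℕ} (c : ℂ) {η : ℕ → 𝓢(Heis n, ℂ)} (h0 : η 0 0 = 0) :
    ∃ C, ∀ x : Horiz n, ‖x‖ = 1 → ‖dyadicTerm c η 0 x‖ ≤ C := by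
  obtain ⟨C, N, hC, hb⟩ := norm_dyadic_le (η 0) (l := 0) (Or.inr h0)
  refine ⟨‖c‖ + (C * ∑' j : ℤ, min ((2 : ℝ) ^ j) ((2 : ℝ) ^ j)⁻¹) * 3, fun x hx => ?_⟩
  have hx0 : x ≠ 0 := norm_ne_zero_iff.1 (by rw [hx]; exact one_ne_zero)
  have hn : ‖(heisPt x 0 : Heis n)‖ = 1 := by
    have := norm_heisPt_sq x 0
    rw [hx, norm_zero] at this
    exact (pow_eq_one_iff_of_nonneg (norm_nonneg _) two_ne_zero).1 (by linarith)
  have h1 : ‖dyadicSum 0 (η 0) (heisPt x 0)‖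
      ≤ (C * ∑' j : ℤ, min ((2 : ℝ) ^ j) ((2 : ℝ) ^ j)⁻¹) * (1 + 1 + 1⁻¹ ^ N) := by
    refine tsum_of_norm_bounded ((summable_min_two_zpow.hasSum.mul_left C).mul_right _) fun j => ?_
    have := hb j _ (heisPt_ne_zero_of_left hx0 0)
    rwa [hn] at this
  rw [dyadicTerm, if_pos rfl]
  refine (norm_add_le _ _).trans ?_
  norm_num at h1 ⊢
  exact h1

/-- The series shows homogeneity only for dyadic `r`. For general `r` the symbol takes the same
value at `(x, s)` and `(r x, r² s)`, and the coefficients of the two expansions in `s` must agree.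
-/
theorem dyadicTerm_smul {n : ℕ} {c : ℂ} {η : ℕ → 𝓢(Heis n, ℂ)} (hη : IsCentralDerivSeq η)
    (h0 : η 0 0 = 0) (hhom : ∀ (r : ℝ) (hr : 0 < r) (z : Heis n), z ≠ 0 →
      dyadicSymbol c η (dilation n r hr.ne' z) = dyadicSymbol c η z) (l : ℕ) {r : ℝ}
    (hr : 0 < r) {x : Horiz n} (hx : x ≠ 0) :
    dyadicTerm c η l (r • x) = (r : ℂ) ^ (-(2 * l : ℤ)) * dyadicTerm c η l x := by
  have hr0 : (r : ℂ) ≠ 0 := by exact_mod_cast hr.ne'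
  have hrx : r • x ≠ 0 := smul_ne_zero hr.ne' hx
  have key := eq_zero_of_sum_isBigO
    (c := fun l => dyadicTerm c η l x - (r : ℂ) ^ (2 * l) * dyadicTerm c η l (r • x)) (fun N => ?_) l
  · have := sub_eq_zero.1 key
    rw [this, zpow_neg, show (2 * l : ℤ) = ((2 * l : ℕ) : ℤ) by push_cast; rfl, zpow_natCast,
      inv_mul_cancel_left₀ (pow_ne_zero _ hr0)]
  · obtain ⟨C, hC, hb⟩ := norm_dyadicSymbol_sub_le c hη h0 N
    refine IsBigO.of_bound (C * (1 + ‖x‖⁻¹ ^ (2 * N + 3))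
      + C * (r ^ 2) ^ (N + 1) * (1 + ‖r • x‖⁻¹ ^ (2 * N + 3))) ?_
    filter_upwards [self_mem_nhdsWithin] with s hs
    have hs : 0 < s := hs
    have e : ∑ l ∈ Finset.range (N + 1), (s : ℂ) ^ l *
          (dyadicTerm c η l x - (r : ℂ) ^ (2 * l) * dyadicTerm c η l (r • x))
        = (dyadicSymbol c η (heisPt (r • x) (r ^ 2 * s)) - ∑ l ∈ Finset.range (N + 1),
            ((r ^ 2 * s : ℝ) : ℂ) ^ l * dyadicTerm c η l (r • x))
          - (dyadicSymbol c η (heisPt x s) - ∑ l ∈ Finset.range (N + 1),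
            (s : ℂ) ^ l * dyadicTerm c η l x) := by
      rw [← dilation_apply n r hr.ne', hhom r hr _ (heisPt_ne_zero_of_left hx s), sub_sub_sub_cancel_left,
        ← Finset.sum_sub_distrib]
      refine Finset.sum_congr rfl fun l _ => ?_
      push_cast
      rw [mul_pow, ← pow_mul]
      ring
    rw [e]
    refine (norm_sub_le _ _).trans ((add_le_add (hb _ _ hrx) (hb _ _ hx)).trans_eq ?_)
    rw [abs_mul, abs_of_pos hs, abs_of_pos (by positivity : 0 < r ^ 2), norm_pow,
      Real.norm_eq_abs, abs_of_pos hs, mul_pow]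
    ring

theorem dyadicSymbol_expansion {n : ℕ} {c : ℂ} {η : ℕ → 𝓢(Heis n, ℂ)} (hη : IsCentralDerivSeq η)
    (h0 : η 0 0 = 0) (hhom : ∀ (r : ℝ) (hr : 0 < r) (z : Heis n), z ≠ 0 →
      dyadicSymbol c η (dilation n r hr.ne' z) = dyadicSymbol c η z) {ε : ℝ} (hε : |ε| = 1) :
    HasAsymptoticExpansion (fun x => dyadicSymbol c η (heisPt x ε))
      fun l x => (ε : ℂ) ^ l * dyadicTerm c η l x := by
  have hunit : ∀ x : Horiz n, x ≠ 0 → ‖‖x‖⁻¹ • x‖ = 1 := fun x hx => by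
    rw [norm_smul, norm_inv, norm_norm, inv_mul_cancel₀ (norm_ne_zero_iff.2 hx)]
  have hsucc : ∀ N : ℕ, ∃ C, 0 ≤ C ∧ ∀ x : Horiz n, x ≠ 0 →
      ‖dyadicSymbol c η (heisPt x ε)
        - ∑ l ∈ Finset.range (N + 1), (ε : ℂ) ^ l * dyadicTerm c η l x‖
        ≤ C * ‖x‖ ^ (-(2 * (N + 1 : ℕ) : ℤ)) := by
    intro N
    obtain ⟨C, hC, hb⟩ := norm_dyadicSymbol_sub_le c hη h0 N
    refine ⟨C * 2, by positivity, fun x hx => ?_⟩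
    have hx' : 0 < ‖x‖ := norm_pos_iff.2 hx
    have hi : 0 < ‖x‖⁻¹ := inv_pos.2 hx'
    -- Dilation by `1/‖x‖` moves `(x, ε)` to a point over the unit sphere with central coordinate
    -- `ε/‖x‖²`: the expansion at infinity is the Taylor expansion at `s = 0`.
    have h := hb (‖x‖⁻¹ • x) (‖x‖⁻¹ ^ 2 * ε) (smul_ne_zero hi.ne' hx)
    rw [← dilation_apply n _ hi.ne', hhom _ hi _ (heisPt_ne_zero_of_left hx ε), hunit x hx, abs_mul,
      hε, abs_of_pos (by positivity)] at h
    have e : ∀ l, ((‖x‖⁻¹ ^ 2 * ε : ℝ) : ℂ) ^ l * dyadicTerm c η l (‖x‖⁻¹ • x)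
        = (ε : ℂ) ^ l * dyadicTerm c η l x := by
      intro l
      have hxc : (‖x‖ : ℂ) ≠ 0 := by exact_mod_cast hx'.ne'
      rw [dyadicTerm_smul hη h0 hhom l hi hx]
      push_cast
      rw [inv_zpow', neg_neg, mul_pow, ← pow_mul, inv_pow, zpow_mul]
      norm_cast
      rw [← pow_mul]
      push_cast
      field_simp
    simp only [e] at h
    refine h.trans_eq ?_
    rw [zpow_neg, show (2 * (N + 1 : ℕ) : ℤ) = ((2 * (N + 1) : ℕ) : ℤ) by push_cast; rfl,
      zpow_natCast, mul_one, ← pow_mul, inv_pow]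
    norm_num
    ring
  intro N
  rcases N with _ | N
  -- For `N = 0` boundedness is claimed; it follows from the estimate with one term removed and the
  -- bound for that term on the unit sphere.
  · obtain ⟨C, hC, hb⟩ := hsucc 0
    obtain ⟨D, hD⟩ := norm_dyadicTerm_zero_le c h0
    refine IsBigO.of_bound (C + D) ?_
    filter_upwards [eventually_ne_cobounded (0 : Horiz n),
      (tendsto_norm_cobounded_atTop (E := Horiz n)).eventually_ge_atTop 1] with x hx hx1
    have h1 := hb x hx
    have h2 := hD _ (hunit x hx)
    rw [dyadicTerm_smul hη h0 hhom 0 (inv_pos.2 (norm_pos_iff.2 hx)) hx] at h2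
    simp only [zero_add, Finset.range_one, Finset.sum_singleton, pow_zero, one_mul] at h1
    simp only [Nat.cast_zero, mul_zero, neg_zero, zpow_zero, one_mul] at h2
    simp only [Finset.range_zero, Finset.sum_empty, sub_zero, Nat.cast_zero, mul_zero, neg_zero,
      zpow_zero, norm_one, mul_one]
    have h3 : ‖x‖ ^ (-(2 * (1 : ℕ) : ℤ)) ≤ 1 := zpow_le_one_of_nonpos₀ hx1 (by norm_num)
    have h4 := norm_sub_norm_le (dyadicSymbol c η (heisPt x ε)) (dyadicTerm c η 0 x)
    nlinarith
  · obtain ⟨C, hC, hb⟩ := hsucc N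
    refine IsBigO.of_bound C ?_
    filter_upwards [eventually_ne_cobounded (0 : Horiz n)] with x hx
    rw [norm_zpow, norm_norm]
    exact hb x hx

/-- Along the ray `s^{-1/2} x` the term of degree `-2l` is `s^l` times its value at `x`, so the
difference of two expansions of `σ_+` is an asymptotic power series of zero. -/
theorem IsSymbolExpansion.unique {n : ℕ} {k : Symb n} {v w : ℕ → Horiz n → ℂ}
    (hv : IsSymbolExpansion k v) (hw : IsSymbolExpansion k w) (l : ℕ) {x : Horiz n} (hx : x ≠ 0) :
    v l x = w l x := by
  refine sub_eq_zero.1 (eq_zero_of_sum_isBigO (c := fun l => v l x - w l x) (fun N => ?_) l)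
  have hρ : Tendsto (fun s : ℝ => (√s)⁻¹) (𝓝[>] 0) atTop := by
    refine tendsto_inv_nhdsGT_zero.comp (tendsto_nhdsWithin_iff.2 ⟨?_, ?_⟩)
    · have := Real.continuous_sqrt.tendsto 0
      rw [Real.sqrt_zero] at this
      exact this.mono_left nhdsWithin_le_nhds
    · filter_upwards [self_mem_nhdsWithin] with s hs
      exact Real.sqrt_pos.2 hs
  have hray : Tendsto (fun s : ℝ => (√s)⁻¹ • x) (𝓝[>] 0) (cobounded (Horiz n)) := by
    rw [tendsto_norm_atTop_iff_cobounded.symm]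
    refine (hρ.atTop_mul_const (norm_pos_iff.2 hx)).congr fun s => ?_
    rw [norm_smul, Real.norm_eq_abs, abs_of_nonneg (by positivity)]
  have hdiff := ((hw.plus (N + 1)).sub (hv.plus (N + 1))).comp_tendsto hray
  refine (hdiff.congr' (f₂ := fun s : ℝ => ∑ l ∈ Finset.range (N + 1), (s : ℂ) ^ l * (v l x - w l x))
    (g₂ := fun s : ℝ => s ^ (N + 1) * ‖x‖ ^ (-(2 * (N + 1 : ℕ) : ℤ))) ?_ ?_).trans ?_
  · filter_upwards [self_mem_nhdsWithin] with s hs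
    have hs : 0 < s := hs
    have hi : 0 < (√s)⁻¹ := by positivity
    simp only [Function.comp_apply, sub_sub_sub_cancel_left]
    rw [← Finset.sum_sub_distrib]
    refine Finset.sum_congr rfl fun l _ => ?_
    rw [hv.homogeneous l _ x hi hx, hw.homogeneous l _ x hi hx, ← mul_sub]
    congr 1
    push_cast
    rw [inv_zpow', neg_neg, zpow_mul]
    norm_cast
    rw [Real.sq_sqrt hs.le]
  · filter_upwards [self_mem_nhdsWithin] with s hs
    have hs : 0 < s := hs
    simp only [Function.comp_apply]
    rw [norm_smul, mul_zpow, Real.norm_eq_abs, abs_of_nonneg (by positivity), inv_zpow', neg_neg,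
      zpow_mul]
    norm_cast
    rw [Real.sq_sqrt hs.le]
  · simp only [mul_comm _ (‖x‖ ^ (-(2 * (N + 1 : ℕ) : ℤ)))]
    exact isBigO_const_mul_self _ _ _

/-! ### Unfolding a dyadic sum -/

/-- After the substitution `s = 4^v` the integral over the line is the integral over `(0, 1]` of the
sum of all integer translates, and that sum is the constant `log 4 · A`. -/
theorem integral_Ioi_eq_of_hasSum {u : ℝ → ℂ} (hu : IntegrableOn u (Ioi 0)) {A : ℂ}
    (hA : ∀ μ : ℝ, 0 < μ → HasSum (fun j : ℤ => (((4 : ℝ) ^ j * μ : ℝ) : ℂ) * u ((4 : ℝ) ^ j * μ)) A) :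
    ∫ s in Ioi 0, u s = Real.log 4 * A := by
  have hlog : 0 < Real.log 4 := Real.log_pos (by norm_num)
  let e : ℝ → ℝ := fun v => (4 : ℝ) ^ v
  have he : ∀ v, 0 < e v := fun v => Real.rpow_pos_of_pos (by norm_num) v
  have hd : ∀ v ∈ (univ : Set ℝ), HasDerivWithinAt e (Real.log 4 * e v) univ v := by
    intro v _
    have := (Real.hasStrictDerivAt_const_rpow (by norm_num : (0 : ℝ) < 4) v).hasDerivAt
    rw [mul_comm] at this
    exact this.hasDerivWithinAt
  have hinj : InjOn e univ := ((Real.strictMono_rpow_of_base_gt_one (by norm_num)).injective).injOn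
  have him : e '' univ = Ioi 0 := by
    ext s
    simp only [image_univ, mem_range, mem_Ioi]
    refine ⟨fun ⟨v, hv⟩ => hv ▸ he v, fun hs => ⟨Real.logb 4 s, ?_⟩⟩
    exact Real.rpow_logb (by norm_num) (by norm_num) hs
  let F : ℝ → ℂ := fun v => |Real.log 4 * e v| • u (e v)
  have hF : ∀ v, F v = Real.log 4 * ((e v : ℂ) * u (e v)) := by
    intro v
    simp only [F]
    rw [abs_of_pos (mul_pos hlog (he v)), Complex.real_smul]
    push_cast
    ring
  have hFi : Integrable F := by
    have := (integrableOn_image_iff_integrableOn_abs_deriv_smul MeasurableSet.univ hd hinj u).1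
      (by rwa [him])
    rwa [integrableOn_univ] at this
  have hint : ∫ s in Ioi 0, u s = ∫ v, F v := by
    have := integral_image_eq_integral_abs_deriv_smul MeasurableSet.univ hd hinj u
    rwa [him, Measure.restrict_univ] at this
  have hs1 := hFi.hasSum_intervalIntegral_comp_add_int
  have hs2 := hFi.norm.hasSum_intervalIntegral_comp_add_int.summable
  simp only [intervalIntegral.integral_of_le (zero_le_one : (0 : ℝ) ≤ 1)] at hs1 hs2
  have hs3 := hasSum_integral_of_summable_integral_norm
    (μ := volume.restrict (Ioc (0 : ℝ) 1)) (F := fun (j : ℤ) v => F (v + j))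
    (fun j => (hFi.comp_add_right (j : ℝ)).integrableOn) hs2
  rw [hint, hs1.unique hs3]
  have : ∀ v, ∑' j : ℤ, F (v + j) = Real.log 4 * A := by
    intro v
    have := ((hA (e v) (he v)).mul_left (Real.log 4 : ℂ)).tsum_eq
    rw [← this]
    refine tsum_congr fun j => ?_
    rw [hF]
    have : e (v + j) = (4 : ℝ) ^ j * e v := by
      simp only [e]
      rw [Real.rpow_add (by norm_num), Real.rpow_intCast, mul_comm]
    rw [this]
  simp only [this]
  simp

/-! ### Laplace transforms -/

theorem integral_pow_mul_exp_neg (l : ℕ) {r : ℝ} (hr : 0 < r) :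
    ∫ s : ℝ in Ioi 0, (s : ℂ) ^ l * Complex.exp (-(r * s))
      = (l.factorial : ℂ) / (r : ℂ) ^ (l + 1) := by
  have := Complex.integral_cpow_mul_exp_neg_mul_Ioi (a := (l + 1 : ℂ)) (r := r)
    (by simp; positivity) hr
  rw [Complex.Gamma_nat_eq_factorial, add_sub_cancel_right] at this
  simp only [Complex.cpow_natCast] at this
  rw [this, show ((l : ℂ) + 1) = ((l + 1 : ℕ) : ℂ) by push_cast; rfl, Complex.cpow_natCast]
  rw [one_div, inv_pow]
  ring

theorem integrableOn_pow_mul_exp_neg (l : ℕ) {r : ℝ} (hr : 0 < r) :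
    IntegrableOn (fun s : ℝ => (s : ℂ) ^ l * Complex.exp (-(r * s))) (Ioi 0) := by
  -- A non-integrable function has integral `0` by convention, whereas the value computed above is
  -- nonzero.
  by_contra h
  have h1 := integral_pow_mul_exp_neg l hr
  rw [integral_undef h] at h1
  refine div_ne_zero ?_ (pow_ne_zero _ ?_) h1.symm
  · exact_mod_cast l.factorial_ne_zero
  · exact_mod_cast hr.ne'

theorem integral_exp_neg_complex {r : ℂ} (hr : 0 < r.re) :
    ∫ s : ℝ in Ioi 0, Complex.exp (-(r * s)) = 1 / r := by
  have := integral_exp_mul_complex_Ioi (a := -r) (by simpa using hr) 0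
  simpa [neg_mul] using this

theorem integral_two_mul_div_sq_add_sq {t : ℝ} (ht : t ≠ 0) :
    ∫ a in Ioi (0 : ℝ), 2 * |t| / (a ^ 2 + t ^ 2) = Real.pi := by
  have hp : 0 < |t|⁻¹ := inv_pos.2 (abs_pos.2 ht)
  have h := integral_comp_mul_left_Ioi (fun x : ℝ => (1 + x ^ 2)⁻¹) 0 hp
  rw [mul_zero, integral_Ioi_inv_one_add_sq, Real.arctan_zero, sub_zero, inv_inv, smul_eq_mul] at h
  have e : ∀ a : ℝ, 2 * |t| / (a ^ 2 + t ^ 2) = 2 * |t|⁻¹ * (1 + (|t|⁻¹ * a) ^ 2)⁻¹ := by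
    intro a
    have : 0 < |t| := abs_pos.2 ht
    have h2 : 0 < a ^ 2 + |t| ^ 2 := by positivity
    rw [← sq_abs t]
    have h3 : 1 + (|t|⁻¹ * a) ^ 2 = (a ^ 2 + |t| ^ 2) / |t| ^ 2 := by
      field_simp
      ring
    rw [h3]
    field_simp
  simp only [e]
  rw [integral_const_mul, h]
  field_simp

theorem integrableOn_two_mul_div_sq_add_sq {t : ℝ} (ht : t ≠ 0) :
    IntegrableOn (fun a : ℝ => 2 * |t| / (a ^ 2 + t ^ 2)) (Ioi 0) := by
  -- Again, a nonzero value of the integral forces integrability.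
  by_contra h
  have h1 := integral_two_mul_div_sq_add_sq ht
  rw [integral_undef h] at h1
  exact Real.pi_ne_zero h1.symm

/-- The Fourier transform on the line, with kernel `e^{-its}`. -/
def lineFourier (H : ℝ → ℂ) (s : ℝ) : ℂ := ∫ t, H t * Complex.exp (-Complex.I * (t * s))

theorem norm_exp_neg_I_mul (t s : ℝ) : ‖Complex.exp (-Complex.I * (t * s))‖ = 1 := by
  rw [Complex.norm_exp]
  simp

theorem integrable_laplace_lineFourier {H : ℝ → ℂ} (hH : Integrable H) (hc : Continuous H) {a : ℝ}
    (ha : 0 < a) (ε : ℝ) : Integrable (Function.uncurry fun s t : ℝ =>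
      Complex.exp (-(a * s)) * (H t * Complex.exp (-Complex.I * (t * (ε * s)))))
      ((volume.restrict (Ioi 0)).prod volume) := by
  have h1 := integrableOn_pow_mul_exp_neg 0 ha
  simp only [pow_zero, one_mul] at h1
  refine (Integrable.mul_prod (f := fun s : ℝ => Complex.exp (-(a * s))) (g := H) h1 hH).mono ?_ ?_
  · exact Continuous.aestronglyMeasurable (by fun_prop)
  · refine ae_of_all _ fun p => ?_
    simp only [Function.uncurry]
    have := norm_exp_neg_I_mul p.2 (ε * p.1)
    push_cast at this
    rw [norm_mul, norm_mul, norm_mul, this, mul_one]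

theorem laplace_lineFourier {H : ℝ → ℂ} (hH : Integrable H) (hc : Continuous H) {a : ℝ}
    (ha : 0 < a) (ε : ℝ) :
    IntegrableOn (fun s : ℝ => Complex.exp (-(a * s)) * lineFourier H (ε * s)) (Ioi 0) ∧
    ∫ s : ℝ in Ioi 0, Complex.exp (-(a * s)) * lineFourier H (ε * s)
      = ∫ t, H t / (a + Complex.I * (ε * t)) := by
  have hi := integrable_laplace_lineFourier hH hc ha ε
  have e : ∀ s : ℝ, Complex.exp (-(a * s)) * lineFourier H (ε * s)
      = ∫ t : ℝ, Complex.exp (-(a * s)) * (H t * Complex.exp (-Complex.I * (t * (ε * s)))) := by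
    intro s
    rw [lineFourier, integral_const_mul]
    push_cast
    rfl
  simp only [e]
  refine ⟨hi.integral_prod_left, ?_⟩
  rw [integral_integral_swap hi]
  congr 1
  ext t
  have h2 := integral_exp_neg_complex (r := (a + Complex.I * (ε * t))) (by simpa using ha)
  rw [div_eq_mul_one_div, ← h2, ← integral_const_mul]
  congr 1
  ext s
  rw [mul_left_comm, ← Complex.exp_add]
  congr 2
  ring

/-- The Fourier transform of `H`, antisymmetrized and with its Taylor polynomial removed. -/
def regFourier (n : ℕ) (H : ℝ → ℂ) (s : ℝ) : ℂ :=
  lineFourier H s - (-1) ^ n * lineFourier H (-s)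
    - ∑ l ∈ Finset.range n, (1 - (-1) ^ (n + l)) * ((s : ℂ) ^ l / (l.factorial : ℂ)
        * ∫ t, (-Complex.I * t) ^ l * H t)

/-- Finite geometric series for `1 / (a + z)` in powers of `-z / a`. The summands are what the
Laplace transforms of the Taylor monomials contribute. -/
theorem geom_laplace (n : ℕ) {a : ℂ} (ha : a ≠ 0) {z : ℂ} (hz : a + z ≠ 0) :
    1 / (a + z) - ∑ l ∈ Finset.range n, (-z) ^ l / a ^ (l + 1) = (-z) ^ n / a ^ n / (a + z) := by
  induction n with
  | zero => simp
  | succ n ih =>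
    rw [Finset.sum_range_succ, ← sub_sub, ih]
    field_simp
    ring

/-- The transforms of `Ĥ(±s)` are integrals of `H(t) / (a ± it)`, and the subtracted polynomial
removes the first `n` terms of both geometric series. Since `(-1)^n (it)^n = (-it)^n`, what is left
is `(-it)^n a^{-n} (1/(a + it) - 1/(a - it))`. -/
theorem laplace_regFourier (n : ℕ) {H : ℝ → ℂ} (hc : Continuous H) (hH : HasCompactSupport H)
    {a : ℝ} (ha : 0 < a) :
    ∫ s : ℝ in Ioi 0, Complex.exp (-(a * s)) * regFourier n H s
      = ((a : ℂ) ^ n)⁻¹ * ∫ t : ℝ, H t * (-Complex.I * t) ^ n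
          * (-Complex.I * (2 * t / (a ^ 2 + t ^ 2))) := by
  have hHi : Integrable H := hc.integrable_of_hasCompactSupport hH
  have ha0 : (a : ℂ) ≠ 0 := by exact_mod_cast ha.ne'
  obtain ⟨i1, e1⟩ := laplace_lineFourier hHi hc ha 1
  obtain ⟨i2, e2⟩ := laplace_lineFourier hHi hc ha (-1)
  have i3 := fun l => integrableOn_pow_mul_exp_neg l ha
  have e3 := fun l => integral_pow_mul_exp_neg l ha
  have hne : ∀ t : ℝ, (a + Complex.I * t : ℂ) ≠ 0 := fun t h => by
    have := congrArg Complex.re h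
    simp at this
    exact ha.ne' this
  have hne' : ∀ t : ℝ, (a + -(Complex.I * t) : ℂ) ≠ 0 := fun t => by
    have := hne (-t)
    push_cast at this
    rwa [mul_neg] at this
  simp only [Complex.ofReal_one, Complex.ofReal_neg, one_mul, neg_mul, mul_neg] at i1 i2 e1 e2
  let m : ℕ → ℂ := fun l => (1 - (-1) ^ (n + l)) / (l.factorial : ℂ) * ∫ t, (-Complex.I * t) ^ l * H t
  have hG : ∀ s : ℝ, Complex.exp (-(a * s)) * regFourier n H s
      = Complex.exp (-(a * s)) * lineFourier H s
        - (-1) ^ n * (Complex.exp (-(a * s)) * lineFourier H (-s))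
        - ∑ l ∈ Finset.range n, m l * ((s : ℂ) ^ l * Complex.exp (-(a * s))) := by
    intro s
    rw [regFourier, mul_sub, mul_sub, Finset.mul_sum]
    congr 1
    · ring
    · exact Finset.sum_congr rfl fun l _ => by simp only [m]; ring
  simp only [hG]
  have i12 : IntegrableOn (fun s : ℝ => Complex.exp (-(a * s)) * lineFourier H s
      - (-1) ^ n * (Complex.exp (-(a * s)) * lineFourier H (-s))) (Ioi 0) :=
    i1.sub (i2.const_mul _)
  rw [integral_sub i12 (integrable_finsetSum _ fun l _ => (i3 l).const_mul _),
    integral_sub i1 (i2.const_mul _), integral_const_mul, e1, e2,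
    integral_finsetSum _ fun l _ => (i3 l).const_mul _]
  simp only [integral_const_mul, e3]
  have j1 : Integrable fun t : ℝ => H t / (a + Complex.I * t) :=
    (Continuous.div (by fun_prop) (by fun_prop) hne).integrable_of_hasCompactSupport
      (by simp only [div_eq_mul_inv]; exact hH.mul_right)
  have j2 : Integrable fun t : ℝ => H t / (a + -(Complex.I * t)) :=
    (Continuous.div (by fun_prop) (by fun_prop) hne').integrable_of_hasCompactSupport
      (by simp only [div_eq_mul_inv]; exact hH.mul_right)
  have j12 : Integrable fun t : ℝ => H t / (a + Complex.I * t)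
      - (-1) ^ n * (H t / (a + -(Complex.I * t))) := j1.sub (j2.const_mul _)
  have j3 : ∀ l : ℕ, Integrable fun t : ℝ => (-Complex.I * t) ^ l * H t := fun l =>
    Continuous.integrable_of_hasCompactSupport (by fun_prop) hH.mul_left
  have hm : ∀ l, m l * ((l.factorial : ℂ) / (a : ℂ) ^ (l + 1))
      = ∫ t : ℝ, (1 - (-1) ^ (n + l)) / (a : ℂ) ^ (l + 1) * ((-Complex.I * t) ^ l * H t) := by
    intro l
    have : (l.factorial : ℂ) ≠ 0 := by exact_mod_cast l.factorial_ne_zero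
    rw [integral_const_mul]
    simp only [m]
    field_simp
  simp only [hm]
  rw [← integral_finsetSum _ fun l _ => (j3 l).const_mul _, ← integral_const_mul,
    ← integral_sub j1 (j2.const_mul _),
    ← integral_sub j12 (integrable_finsetSum _ fun l _ => (j3 l).const_mul _),
    ← integral_const_mul]
  congr 1
  ext t
  have g1 := geom_laplace n ha0 (hne t)
  have g2 := geom_laplace n ha0 (hne' t)
  have hsum : ∑ l ∈ Finset.range n, (1 - (-1) ^ (n + l)) / (a : ℂ) ^ (l + 1)
        * ((-Complex.I * t) ^ l * H t)
      = H t * (∑ l ∈ Finset.range n, (-(Complex.I * t)) ^ l / (a : ℂ) ^ (l + 1)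
        - (-1) ^ n * ∑ l ∈ Finset.range n, (-(-(Complex.I * t))) ^ l / (a : ℂ) ^ (l + 1)) := by
    rw [Finset.mul_sum, ← Finset.sum_sub_distrib, Finset.mul_sum]
    refine Finset.sum_congr rfl fun l _ => ?_
    rw [neg_neg, pow_add, neg_mul, neg_pow (Complex.I * t) l]
    have : ((-1 : ℂ) ^ l) * (-1) ^ l = 1 := by rw [← mul_pow]; simp
    linear_combination (-(-1) ^ n * (Complex.I * t) ^ l * H t / (a : ℂ) ^ (l + 1)) * this
  have hsq : (a : ℂ) ^ 2 + (t : ℂ) ^ 2 = (a + Complex.I * t) * (a + -(Complex.I * t)) := by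
    linear_combination (t : ℂ) ^ 2 * Complex.I_sq
  have hfin : H t / (a + Complex.I * t) - (-1) ^ n * (H t / (a + -(Complex.I * t)))
      - H t * (∑ l ∈ Finset.range n, (-(Complex.I * t)) ^ l / (a : ℂ) ^ (l + 1)
        - (-1) ^ n * ∑ l ∈ Finset.range n, (-(-(Complex.I * t))) ^ l / (a : ℂ) ^ (l + 1))
      = H t * ((-(Complex.I * t)) ^ n / (a : ℂ) ^ n / (a + Complex.I * t)
        - (-1) ^ n * ((-(-(Complex.I * t))) ^ n / (a : ℂ) ^ n / (a + -(Complex.I * t)))) := by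
    rw [← g1, ← g2]
    ring
  rw [hsum, hfin, hsq, neg_neg, neg_mul, neg_pow (Complex.I * t) n]
  have h1 := hne t
  have h2 := hne' t
  field_simp
  ring

/-- Writing `n! / s^{n+1}` as `∫ a^n e^{-sa} da` turns the left side into an integral of Laplace
transforms of `regFourier n H`. Their factor `a^{-n}` cancels `a^n`, and integrating `2t / (a² +
t²)` over `a` gives `π sign t`. -/
theorem integral_regFourier_div (n : ℕ) {H : ℝ → ℂ} (hc : Continuous H) (hH : HasCompactSupport H)
    (hm : AEStronglyMeasurable (regFourier n H) (volume.restrict (Ioi 0)))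
    (hi : IntegrableOn (fun s : ℝ => regFourier n H s / (s : ℂ) ^ (n + 1)) (Ioi 0)) :
    (n.factorial : ℂ) * ∫ s : ℝ in Ioi 0, regFourier n H s / (s : ℂ) ^ (n + 1)
      = Real.pi * (-Complex.I) ^ (n + 1) * ((∫ t : ℝ in Ioi 0, (t : ℂ) ^ n * H t)
        - (-1) ^ n * ∫ t : ℝ in Ioi 0, (t : ℂ) ^ n * H (-t)) := by
  set G := regFourier n H
  have hfac : ∀ s : ℝ, 0 < s → ∫ a : ℝ in Ioi 0, (a : ℂ) ^ n * Complex.exp (-(s * a))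
      = (n.factorial : ℂ) / (s : ℂ) ^ (n + 1) := fun s hs =>
    integral_pow_mul_exp_neg n hs
  have hfacn : ∀ s : ℝ, 0 < s → ∫ a : ℝ in Ioi 0, ‖(a : ℂ) ^ n * Complex.exp (-(s * a))‖
      = (n.factorial : ℝ) / s ^ (n + 1) := by
    intro s hs
    have h := hfac s hs
    have e : ∀ a ∈ Ioi (0 : ℝ), (a : ℂ) ^ n * Complex.exp (-(s * a))
        = ((‖(a : ℂ) ^ n * Complex.exp (-(s * a))‖ : ℝ) : ℂ) := by
      intro a ha
      rw [norm_mul, norm_pow, Complex.norm_real, Real.norm_eq_abs, abs_of_pos ha, Complex.norm_exp]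
      simp
    rw [setIntegral_congr_fun measurableSet_Ioi e, integral_complex_ofReal] at h
    exact_mod_cast h
  have hI1 : Integrable (Function.uncurry fun s a : ℝ =>
      (a : ℂ) ^ n * Complex.exp (-(s * a)) * G s)
      ((volume.restrict (Ioi 0)).prod (volume.restrict (Ioi 0))) := by
    have hmeas : AEStronglyMeasurable (Function.uncurry fun s a : ℝ =>
        (a : ℂ) ^ n * Complex.exp (-(s * a)) * G s)
        ((volume.restrict (Ioi 0)).prod (volume.restrict (Ioi 0))) :=
      (Continuous.aestronglyMeasurable (by fun_prop)).mul hm.comp_fst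
    refine (integrable_prod_iff hmeas).2 ⟨?_, ?_⟩
    · filter_upwards [ae_restrict_mem measurableSet_Ioi] with s hs
      exact (integrableOn_pow_mul_exp_neg n hs).mul_const (G s)
    · refine (hi.norm.const_mul (n.factorial : ℝ)).congr ?_
      filter_upwards [ae_restrict_mem measurableSet_Ioi] with s hs
      have hs : 0 < s := hs
      simp only [Function.uncurry, norm_mul _ (G s)]
      rw [integral_mul_const, hfacn s hs, norm_div, norm_pow, Complex.norm_real, Real.norm_eq_abs,
        abs_of_pos hs]
      ring
  have step1 : (n.factorial : ℂ) * ∫ s : ℝ in Ioi 0, G s / (s : ℂ) ^ (n + 1)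
      = ∫ a : ℝ in Ioi 0, ∫ s : ℝ in Ioi 0, (a : ℂ) ^ n * Complex.exp (-(s * a)) * G s := by
    rw [← integral_integral_swap hI1, ← integral_const_mul]
    refine setIntegral_congr_fun measurableSet_Ioi fun s hs => ?_
    rw [integral_mul_const, hfac s hs]
    ring
  have step2 : ∀ a ∈ Ioi (0 : ℝ), ∫ s : ℝ in Ioi 0, (a : ℂ) ^ n * Complex.exp (-(s * a)) * G s
      = ∫ t : ℝ, H t * (-Complex.I * t) ^ n * (-Complex.I * (2 * t / (a ^ 2 + t ^ 2))) := by
    intro a ha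
    have h := laplace_regFourier n hc hH ha
    have ha0 : (a : ℂ) ≠ 0 := by exact_mod_cast (ne_of_gt ha)
    simp only [mul_assoc, mul_comm _ (a : ℂ)] at h ⊢
    rw [integral_const_mul, h, mul_inv_cancel_left₀ (pow_ne_zero _ ha0)]
  rw [step1, setIntegral_congr_fun measurableSet_Ioi step2]
  -- The second exchange is absolutely convergent: for `t ≠ 0` the integral over `a` of the norm of
  -- the kernel is `π`, independently of `t`, and `H` has compact support.
  have hI2 : Integrable (Function.uncurry fun a t : ℝ =>
      H t * (-Complex.I * t) ^ n * (-Complex.I * (2 * t / ((a : ℂ) ^ 2 + (t : ℂ) ^ 2))))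
      ((volume.restrict (Ioi 0)).prod volume) := by
    have hnorm : ∀ a t : ℝ, ‖H t * (-Complex.I * t) ^ n
        * (-Complex.I * (2 * t / ((a : ℂ) ^ 2 + (t : ℂ) ^ 2)))‖
        = ‖H t * (-Complex.I * t) ^ n‖ * (2 * |t| / (a ^ 2 + t ^ 2)) := by
      intro a t
      rw [norm_mul, norm_mul (-Complex.I), norm_neg, Complex.norm_I, one_mul, norm_div, norm_mul]
      congr 2
      · simp
      · have : ((a : ℂ) ^ 2 + (t : ℂ) ^ 2) = ((a ^ 2 + t ^ 2 : ℝ) : ℂ) := by push_cast; rfl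
        rw [this, Complex.norm_real, Real.norm_eq_abs, abs_of_nonneg (by positivity)]
    have hmH : Measurable H := hc.measurable
    have hmeas : AEStronglyMeasurable (Function.uncurry fun a t : ℝ =>
        H t * (-Complex.I * t) ^ n * (-Complex.I * (2 * t / ((a : ℂ) ^ 2 + (t : ℂ) ^ 2))))
        ((volume.restrict (Ioi 0)).prod volume) :=
      Measurable.aestronglyMeasurable (by unfold Function.uncurry; fun_prop)
    have hae : ∀ᵐ t : ℝ, t ≠ 0 := by
      rw [ae_iff]; simp
    refine (integrable_prod_iff' hmeas).2 ⟨?_, ?_⟩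
    · filter_upwards [hae] with t ht
      refine (((integrableOn_two_mul_div_sq_add_sq ht).const_mul
        ‖H t * (-Complex.I * t) ^ n‖)).mono' ?_ (ae_of_all _ fun a => ?_)
      · exact Measurable.aestronglyMeasurable (by unfold Function.uncurry; fun_prop)
      · exact (hnorm a t).le
    · have hb : Integrable fun t : ℝ => ‖H t * (-Complex.I * t) ^ n‖ * Real.pi :=
        ((Continuous.integrable_of_hasCompactSupport (by fun_prop) hH.mul_right).norm).mul_const _
      refine hb.congr ?_
      filter_upwards [hae] with t ht
      simp only [Function.uncurry, hnorm]
      rw [integral_const_mul, integral_two_mul_div_sq_add_sq ht]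
  rw [integral_integral_swap hI2]
  have step3 : ∀ t : ℝ, t ≠ 0 → ∫ a : ℝ in Ioi 0, H t * (-Complex.I * t) ^ n *
      (-Complex.I * (2 * t / ((a : ℂ) ^ 2 + (t : ℂ) ^ 2)))
      = H t * (-Complex.I * t) ^ n * (-Complex.I * (SignType.sign t * Real.pi)) := by
    intro t ht
    rw [integral_const_mul, integral_const_mul]
    congr 2
    rw [← integral_two_mul_div_sq_add_sq ht, ← integral_complex_ofReal, ← integral_const_mul]
    congr 1
    ext a
    have : (t : ℂ) = (SignType.sign t : ℂ) * ((|t| : ℝ) : ℂ) := by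
      rcases lt_or_gt_of_ne ht with h | h
      · simp [h, abs_of_neg h]
      · simp [h, abs_of_pos h]
    push_cast
    nth_rewrite 1 [this]
    ring
  let P : ℝ → ℂ := fun t => H t * (-Complex.I * t) ^ n * (-Complex.I * Real.pi)
  have hP : Integrable P :=
    Continuous.integrable_of_hasCompactSupport (by fun_prop) (hH.mul_right.mul_right)
  -- The factor `sign t` splits the integral at `0`; the negative half is reflected afterwards,
  -- which produces the term with `H (-t)`.
  have hsplit : ∫ t : ℝ, ∫ a : ℝ in Ioi 0, H t * (-Complex.I * t) ^ n *
      (-Complex.I * (2 * t / ((a : ℂ) ^ 2 + (t : ℂ) ^ 2)))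
      = (∫ t in Iic 0, -P t) + ∫ t in Ioi 0, P t := by
    have hcongr1 : ∀ᵐ t ∂(volume.restrict (Iic (0 : ℝ))), ∫ a : ℝ in Ioi 0, H t * (-Complex.I * t) ^ n *
        (-Complex.I * (2 * t / ((a : ℂ) ^ 2 + (t : ℂ) ^ 2))) = -P t := by
      have : ∀ᵐ t : ℝ, t ≠ 0 := by rw [ae_iff]; simp
      filter_upwards [ae_restrict_mem measurableSet_Iic, ae_restrict_of_ae this] with t ht ht0
      have htn : t < 0 := lt_of_le_of_ne ht ht0
      rw [step3 t ht0]
      simp only [P, sign_neg htn, SignType.coe_neg, SignType.coe_one]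
      ring
    have hcongr2 : ∀ᵐ t ∂(volume.restrict (Ioi (0 : ℝ))), ∫ a : ℝ in Ioi 0, H t * (-Complex.I * t) ^ n *
        (-Complex.I * (2 * t / ((a : ℂ) ^ 2 + (t : ℂ) ^ 2))) = P t := by
      filter_upwards [ae_restrict_mem measurableSet_Ioi] with t ht
      rw [step3 t (ne_of_gt ht)]
      simp only [P, sign_pos (show (0 : ℝ) < t from ht), SignType.coe_one]
      ring
    rw [← integral_congr_ae hcongr1, ← integral_congr_ae hcongr2,
      ← setIntegral_union (Iic_disjoint_Ioi le_rfl) measurableSet_Ioi, Iic_union_Ioi,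
      setIntegral_univ]
    · exact (integrable_congr hcongr1).2 hP.neg.integrableOn
    · exact (integrable_congr hcongr2).2 hP.integrableOn
  rw [hsplit, show (0 : ℝ) = -0 by simp, ← integral_comp_neg_Ioi]
  simp only [neg_zero, P]
  rw [mul_sub, ← integral_const_mul, ← integral_const_mul, ← integral_const_mul, sub_eq_neg_add,
    ← integral_neg]
  congr 1
  · congr 1
    ext t
    push_cast
    rw [mul_neg, neg_mul, neg_neg, pow_succ, neg_pow Complex.I, mul_pow]
    have : ((-1 : ℂ) ^ n) * (-1) ^ n = 1 := by rw [← mul_pow]; simp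
    linear_combination (-(Real.pi : ℂ) * Complex.I ^ n * Complex.I * (t : ℂ) ^ n * H (-t)) * this
  · congr 1
    ext t
    rw [pow_succ, mul_pow]
    ring

/-! ### Slices of Schwartz functions and partial Fourier inversion -/

/-- The limit `f` is not assumed measurable: it is an a.e. limit of finite partial sums, and
countability of `ι` allows this limit to be taken over finite sets. -/
theorem integrable_of_hasSum_integral_norm {α ι : Type*} [MeasurableSpace α] {μ : Measure α}
    [Countable ι] {F : ι → α → ℂ} {f : α → ℂ} (hF : ∀ i, Integrable (F i) μ)
    (hs : Summable fun i => ∫ a, ‖F i a‖ ∂μ) (hf : ∀ᵐ a ∂μ, HasSum (fun i => F i a) (f a)) :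
    Integrable f μ ∧ HasSum (fun i => ∫ a, F i a ∂μ) (∫ a, f a ∂μ) := by
  have hmeas : AEStronglyMeasurable f μ :=
    aestronglyMeasurable_of_tendsto_ae atTop
      (f := fun (s : Finset ι) a => ∑ i ∈ s, F i a)
      (fun s => Finset.aestronglyMeasurable_fun_sum s fun i _ => (hF i).aestronglyMeasurable) hf
  refine ⟨⟨hmeas, ?_⟩, ?_⟩
  · have h1 : ∫⁻ a, ∑' i, ‖F i a‖ₑ ∂μ < ⊤ := by
      rw [lintegral_tsum fun i => (hF i).aestronglyMeasurable.enorm]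
      have : ∀ i, ∫⁻ a, ‖F i a‖ₑ ∂μ = ENNReal.ofReal (∫ a, ‖F i a‖ ∂μ) := fun i =>
        (ofReal_integral_norm_eq_lintegral_enorm (hF i)).symm
      simp only [this]
      rw [← ENNReal.ofReal_tsum_of_nonneg (fun i => integral_nonneg fun a => norm_nonneg _) hs]
      exact ENNReal.ofReal_lt_top
    refine lt_of_le_of_lt (lintegral_mono_ae ?_) h1
    filter_upwards [hf] with a ha
    rw [← ha.tsum_eq]
    exact enorm_tsum_le_tsum_enorm
  · have := hasSum_integral_of_summable_integral_norm hF hs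
    rwa [integral_congr_ae (g := f) (hf.mono fun a ha => ha.tsum_eq)] at this

/-- An integrable weight on the horizontal layer. -/
def horizWeight {n : ℕ} (x : Horiz n) : ℝ := ((1 + ‖x‖) ^ (2 * n + 1))⁻¹

theorem horizWeight_nonneg {n : ℕ} (x : Horiz n) : 0 ≤ horizWeight x := by
  unfold horizWeight; positivity

theorem finrank_horiz (n : ℕ) : Module.finrank ℝ (Horiz n) = 2 * n := by
  simp [two_mul]

theorem integrable_horizWeight (n : ℕ) : Integrable (horizWeight (n := n)) := by
  have h := integrable_one_add_norm (E := Horiz n) (μ := volume) (r := ((2 * n + 1 : ℕ) : ℝ))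
    (by rw [finrank_horiz]; exact_mod_cast Nat.lt_succ_self _)
  refine h.congr (ae_of_all _ fun x => ?_)
  simp only [horizWeight]
  rw [Real.rpow_neg (by positivity), Real.rpow_natCast]

theorem norm_slice_le {n : ℕ} (η : 𝓢(Heis n, ℂ)) (m : ℕ) :
    ∃ C, 0 ≤ C ∧ ∀ (x : Horiz n) (s : ℝ), |s| ^ m * ‖η (heisPt x s)‖ ≤ C * horizWeight x := by
  obtain ⟨C, hC, hb⟩ := η.one_add_norm_pow_mul_le (m + (2 * n + 1))
  refine ⟨C, hC, fun x s => ?_⟩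
  have hp : 0 < (1 + ‖x‖) ^ (2 * n + 1) := by positivity
  rw [horizWeight, ← div_eq_mul_inv, le_div_iff₀ hp]
  refine le_trans ?_ (hb (heisPt x s))
  rw [pow_add _ m (2 * n + 1), mul_right_comm]
  have h1 := norm_le_norm_heisPt x s
  have h2 := abs_le_norm_heisPt x s
  gcongr
  linarith

theorem continuous_heisPt {n : ℕ} : Continuous fun p : Horiz n × ℝ => heisPt p.1 p.2 :=
  (WithLp.prodContinuousLinearEquiv 2 ℝ (Horiz n) ℝ).symm.continuous

theorem continuous_heisPt_left {n : ℕ} (s : ℝ) : Continuous fun x : Horiz n => heisPt x s :=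
  continuous_heisPt.comp (Continuous.prodMk_left s)

theorem continuous_heisPt_right {n : ℕ} (x : Horiz n) : Continuous fun s : ℝ => heisPt x s :=
  continuous_heisPt.comp (Continuous.prodMk_right x)

theorem integrable_slice {n : ℕ} (η : 𝓢(Heis n, ℂ)) (s : ℝ) :
    Integrable fun x : Horiz n => η (heisPt x s) := by
  obtain ⟨C, hC, hb⟩ := norm_slice_le η 0
  refine ((integrable_horizWeight n).const_mul C).mono'
    (η.continuous.comp (continuous_heisPt_left s)).aestronglyMeasurable (ae_of_all _ fun x => ?_)
  simpa using hb x s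

theorem norm_le_inv_one_add_sq {n : ℕ} (h : 𝓢(Heis n, ℂ)) :
    ∃ C, ∀ (x : Horiz n) (t : ℝ), ‖h (heisPt x t)‖ ≤ C * (1 + t ^ 2)⁻¹ := by
  obtain ⟨C, hC, hb⟩ := h.one_add_norm_pow_mul_le 2
  refine ⟨C, fun x t => ?_⟩
  rw [← div_eq_mul_inv, le_div_iff₀ (by positivity)]
  refine le_trans ?_ (hb (heisPt x t))
  rw [mul_comm]
  gcongr
  have := abs_le_norm_heisPt x t
  rw [← sq_abs]
  nlinarith [abs_nonneg t]

/-- With `p` the partial transform of `h` in `t`, the slice of `ĥ` at height `s` is the horizontal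
transform of `p`. Fourier inversion at the origin recovers `p 0`; the powers of `2π` come from the
normalization. -/
theorem integral_slice_fourierSchwartz {n : ℕ} (h : 𝓢(Heis n, ℂ)) (s : ℝ) :
    ∫ x : Horiz n, fourierSchwartz n h (heisPt x s)
      = (2 * (Real.pi : ℂ)) ^ (2 * n) * lineFourier (fun t => h (heisPt 0 t)) s := by
  let p : Horiz n → ℂ := fun y => ∫ t : ℝ, h (heisPt y t) * Complex.exp (-Complex.I * (t * s))
  have hjoint : Continuous fun q : Horiz n × ℝ =>
      h (heisPt q.1 q.2) * Complex.exp (-Complex.I * (q.2 * s)) :=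
    (h.continuous.comp continuous_heisPt).mul (by fun_prop)
  have hprod : Integrable fun q : Horiz n × ℝ =>
      h (heisPt q.1 q.2) * Complex.exp (-Complex.I * (q.2 * s)) := by
    refine ((integrable_heis_iff _).1 h.integrable).mono hjoint.aestronglyMeasurable
      (ae_of_all _ fun q => ?_)
    rw [norm_mul, norm_exp_neg_I_mul, mul_one]
  have hpi : Integrable p := hprod.integral_prod_left
  -- Continuity is needed because inversion is used at a single point.
  have hpc : Continuous p := by
    obtain ⟨C, hC⟩ := norm_le_inv_one_add_sq h
    refine continuous_of_dominated (bound := fun t => C * (1 + t ^ 2)⁻¹) (fun y => ?_) (fun y => ?_)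
      (integrable_inv_one_add_sq.const_mul C) (ae_of_all _ fun t => ?_)
    · exact (hjoint.comp (Continuous.prodMk_right y)).aestronglyMeasurable
    · refine ae_of_all _ fun t => ?_
      rw [norm_mul, norm_exp_neg_I_mul, mul_one]
      exact hC y t
    · exact hjoint.comp (Continuous.prodMk_left t)
  have hF : ∀ ξ : Horiz n, 𝓕 p ξ = fourierSchwartz n h (heisPt ((2 * Real.pi) • ξ) s) := by
    intro ξ
    rw [fourierSchwartz_apply, integral_heis, Real.fourier_eq', Measure.volume_eq_prod,
      integral_prod]
    · congr 1
      ext y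
      rw [smul_eq_mul, ← integral_const_mul]
      congr 1
      ext t
      rw [mul_left_comm, ← Complex.exp_add, WithLp.prod_inner_apply]
      congr 2
      change _ = -Complex.I * ((inner ℝ y ((2 * Real.pi) • ξ) + inner ℝ t s : ℝ) : ℂ)
      rw [inner_smul_right]
      simp
      ring
    · refine ((integrable_heis_iff _).1 h.integrable).mono ?_ (ae_of_all _ fun q => ?_)
      · refine Continuous.aestronglyMeasurable ?_
        refine (h.continuous.comp continuous_heisPt).mul (Complex.continuous_exp.comp ?_)
        exact continuous_const.mul (Complex.continuous_ofReal.comp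
          (continuous_heisPt.inner continuous_const))
      · rw [norm_mul, Complex.norm_exp]
        simp
  have hFi : Integrable (𝓕 p) := by
    have h1 := (integrable_slice (fourierSchwartz n h) s).comp_smul Real.two_pi_pos.ne'
    exact h1.congr (ae_of_all _ fun ξ => (hF ξ).symm)
  have hinv := congrFun (hpc.fourierInv_fourier_eq hpi hFi) 0
  rw [Real.fourierInv_eq'] at hinv
  simp only [inner_zero_right, mul_zero, Complex.ofReal_zero, zero_mul, Complex.exp_zero, one_smul,
    hF] at hinv
  have hsc := Measure.integral_comp_smul_of_nonneg volume
    (fun x : Horiz n => fourierSchwartz n h (heisPt x s)) (2 * Real.pi)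
    (hR := Real.two_pi_pos.le)
  rw [finrank_horiz, hinv, Complex.real_smul] at hsc
  change ∫ x : Horiz n, fourierSchwartz n h (heisPt x s) = _ * p 0
  rw [hsc]
  push_cast
  rw [mul_inv_cancel_left₀]
  exact pow_ne_zero _ (mul_ne_zero two_ne_zero (by exact_mod_cast Real.pi_ne_zero))

/-! ### The regularized dyadic pieces -/

/-- The contribution of one dyadic piece to the regularized integrand. -/
def regPiece {n : ℕ} (η : ℕ → 𝓢(Heis n, ℂ)) (x : Horiz n) (s : ℝ) : ℂ :=
  η 0 (heisPt x s) - (-1) ^ n * η 0 (heisPt x (-s))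
    - ∑ l ∈ Finset.range n, (1 - (-1) ^ (n + l))
        * ((s : ℂ) ^ l / (l.factorial : ℂ) * η l (heisPt x 0))

/-- The term `l = n` has coefficient `1 - (-1)^{2n} = 0`. Removing the terms `l < n` therefore
removes a Taylor polynomial with `n + 1` terms, which gains the order needed for integrability. -/
theorem sum_range_succ_antisymm (n : ℕ) (s : ℂ) (v : ℕ → ℂ) :
    ∑ l ∈ Finset.range (n + 1), s ^ l * v l
        - (-1) ^ n * ∑ l ∈ Finset.range (n + 1), (-s) ^ l * v l
      = ∑ l ∈ Finset.range n, (1 - (-1) ^ (n + l)) * (s ^ l * v l) := by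
  rw [Finset.mul_sum, ← Finset.sum_sub_distrib, Finset.sum_range_succ]
  have hn : (-1 : ℂ) ^ n * (-1) ^ n = 1 := by rw [← mul_pow]; simp
  have : s ^ n * v n - (-1) ^ n * ((-s) ^ n * v n) = 0 := by
    rw [neg_pow]
    linear_combination (-(s ^ n * v n)) * hn
  rw [this, add_zero]
  refine Finset.sum_congr rfl fun l _ => ?_
  rw [neg_pow, pow_add]
  ring

theorem regPiece_eq_taylorRem {n : ℕ} (η : ℕ → 𝓢(Heis n, ℂ)) (x : Horiz n) (s : ℝ) :
    regPiece η x s = taylorRem η (n + 1) 0 x s - (-1) ^ n * taylorRem η (n + 1) 0 x (-s) := by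
  have := sum_range_succ_antisymm n s fun l => (l.factorial : ℂ)⁻¹ * η l (heisPt x 0)
  simp only [regPiece, taylorRem, zero_add, div_eq_mul_inv, mul_assoc, Complex.ofReal_neg]
  rw [← this]
  ring

/-- For `s ≤ 1` the piece is a Taylor remainder of order `n + 1`. For `s ≥ 1` the Schwartz terms
decay like `1/s` and the polynomial has degree at most `n - 1`, so both are at most a multiple of
`s^n / s`. -/
theorem norm_regPiece_le {n : ℕ} {η : ℕ → 𝓢(Heis n, ℂ)} (hη : IsCentralDerivSeq η) :
    ∃ C, 0 ≤ C ∧ ∀ (x : Horiz n) (s : ℝ), 0 < s →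
      ‖regPiece η x s‖ ≤ C * (s ^ n * min s s⁻¹) * horizWeight x := by
  obtain ⟨C₁, hC₁, h₁⟩ := norm_taylorRem_le hη (2 * n + 1) (n + 1) 0
  obtain ⟨C₂, hC₂, h₂⟩ := norm_slice_le (η 0) 1
  choose D hD h₃ using fun l => norm_slice_le (η l) 0
  have hDs : 0 ≤ ∑ l ∈ Finset.range n, 2 * D l :=
    Finset.sum_nonneg fun l _ => mul_nonneg zero_le_two (hD l)
  refine ⟨2 * C₁ + (2 * C₂ + ∑ l ∈ Finset.range n, 2 * D l), by positivity, fun x s hs => ?_⟩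
  have hw := horizWeight_nonneg x
  rcases le_total s 1 with hs1 | hs1
  · rw [min_eq_left (hs1.trans ((one_le_inv₀ hs).2 hs1)), ← pow_succ, regPiece_eq_taylorRem]
    have hT : ∀ u : ℝ, |u| = s → ‖taylorRem η (n + 1) 0 x u‖ ≤ C₁ * s ^ (n + 1) * horizWeight x := by
      intro u hu
      have := h₁ x u
      rw [hu] at this
      rw [horizWeight, ← div_eq_mul_inv, le_div_iff₀ (by positivity), mul_comm]
      exact this
    have e1 := hT s (abs_of_pos hs)
    have e2 := hT (-s) (by rw [abs_neg, abs_of_pos hs])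
    calc _ ≤ ‖taylorRem η (n + 1) 0 x s‖ + ‖taylorRem η (n + 1) 0 x (-s)‖ := by
          refine (norm_sub_le _ _).trans_eq ?_
          simp
      _ ≤ (2 * C₁) * s ^ (n + 1) * horizWeight x := by linarith
      _ ≤ _ := by gcongr; linarith
  · rw [min_eq_right ((inv_le_one_of_one_le₀ hs1).trans hs1)]
    have hS : ∀ u : ℝ, |u| = s → ‖η 0 (heisPt x u)‖ ≤ C₂ * (s ^ n * s⁻¹) * horizWeight x := by
      intro u hu
      have := h₂ x u
      rw [hu, pow_one, ← le_div_iff₀' hs] at this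
      calc _ ≤ C₂ * horizWeight x / s := this
        _ = C₂ * (1 * s⁻¹) * horizWeight x := by ring
        _ ≤ _ := by gcongr; exact one_le_pow₀ hs1
    have e1 := hS s (abs_of_pos hs)
    have e2 := hS (-s) (by rw [abs_neg, abs_of_pos hs])
    have e3 : ∀ l ∈ Finset.range n, ‖(1 - (-1) ^ (n + l))
        * ((s : ℂ) ^ l / (l.factorial : ℂ) * η l (heisPt x 0))‖
        ≤ 2 * D l * (s ^ n * s⁻¹) * horizWeight x := by
      intro l hl
      have hln := Finset.mem_range.1 hl
      have a1 : ‖(1 - (-1) ^ (n + l) : ℂ)‖ ≤ 2 := by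
        refine (norm_sub_le _ _).trans_eq ?_
        simp; norm_num
      have a2 : ‖(s : ℂ) ^ l / (l.factorial : ℂ)‖ ≤ s ^ n * s⁻¹ := by
        rw [norm_div, norm_pow, Complex.norm_real, Real.norm_eq_abs, abs_of_pos hs,
          Complex.norm_natCast, ← div_eq_mul_inv, le_div_iff₀ hs]
        calc _ ≤ s ^ l / 1 * s := by
              gcongr
              exact_mod_cast l.factorial_pos
          _ = s ^ (l + 1) := by rw [div_one, pow_succ]
          _ ≤ s ^ n := pow_le_pow_right₀ hs1 hln
      have a3 := h₃ l x 0
      rw [pow_zero, one_mul] at a3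
      rw [norm_mul, norm_mul]
      calc _ ≤ 2 * ((s ^ n * s⁻¹) * (D l * horizWeight x)) := by gcongr
        _ = _ := by ring
    calc _ ≤ ‖η 0 (heisPt x s)‖ + ‖η 0 (heisPt x (-s))‖ + ∑ l ∈ Finset.range n,
          ‖(1 - (-1) ^ (n + l)) * ((s : ℂ) ^ l / (l.factorial : ℂ) * η l (heisPt x 0))‖ := by
          refine (norm_sub_le _ _).trans (add_le_add ?_ (norm_sum_le _ _))
          refine (norm_sub_le _ _).trans_eq ?_
          simp
      _ ≤ ‖η 0 (heisPt x s)‖ + ‖η 0 (heisPt x (-s))‖ + ∑ l ∈ Finset.range n,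
          2 * D l * (s ^ n * s⁻¹) * horizWeight x := by
          gcongr with l hl
          exact e3 l hl
      _ ≤ (2 * C₂ + ∑ l ∈ Finset.range n, 2 * D l) * (s ^ n * s⁻¹) * horizWeight x := by
          rw [← Finset.sum_mul, ← Finset.sum_mul]
          linarith
      _ ≤ _ := mul_le_mul_of_nonneg_right
          (mul_le_mul_of_nonneg_right (by linarith) (by positivity)) hw

theorem continuous_regPiece {n : ℕ} (η : ℕ → 𝓢(Heis n, ℂ)) (s : ℝ) :
    Continuous fun x => regPiece η x s := by
  have h : ∀ l u, Continuous fun x => η l (heisPt x u) := fun l u =>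
    (η l).continuous.comp (continuous_heisPt_left u)
  exact ((h 0 s).sub (continuous_const.mul (h 0 (-s)))).sub
    (continuous_finsetSum _ fun l _ => continuous_const.mul (continuous_const.mul (h l 0)))

theorem integrable_regPiece {n : ℕ} {η : ℕ → 𝓢(Heis n, ℂ)} (hη : IsCentralDerivSeq η) {s : ℝ}
    (hs : 0 < s) : Integrable fun x => regPiece η x s := by
  obtain ⟨C, hC, hb⟩ := norm_regPiece_le hη
  exact ((integrable_horizWeight n).const_mul _).mono' (continuous_regPiece η s).aestronglyMeasurable
    (ae_of_all _ fun x => hb x s hs)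

/-- Partial inversion at height `0` turns the integrals of the central derivatives of `ĥ` into the
moments of `h(0, ·)`, the Taylor coefficients of its line transform. -/
theorem integral_regPiece {n : ℕ} (h : 𝓢(Heis n, ℂ)) (s : ℝ) :
    ∫ x, regPiece (fun l => fourierSchwartz n ((centralMul n)^[l] h)) x s
      = (2 * (Real.pi : ℂ)) ^ (2 * n) * regFourier n (fun t => h (heisPt 0 t)) s := by
  have hi := fun l u => integrable_slice (fourierSchwartz n ((centralMul n)^[l] h)) u
  have h12 : Integrable fun x : Horiz n => fourierSchwartz n ((centralMul n)^[0] h) (heisPt x s)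
      - (-1) ^ n * fourierSchwartz n ((centralMul n)^[0] h) (heisPt x (-s)) := (hi 0 s).sub ((hi 0 (-s)).const_mul _)
  have hm : ∀ l, lineFourier (fun t => (centralMul n)^[l] h (heisPt 0 t)) 0
      = ∫ t : ℝ, (-Complex.I * t) ^ l * h (heisPt 0 t) := by
    intro l
    simp only [lineFourier, centralMul_iterate_apply]
    simp [heisPt]
  simp only [regPiece]
  rw [integral_sub h12 (integrable_finsetSum _ fun l _ => ((hi l 0).const_mul _).const_mul _),
    integral_sub (hi 0 s) ((hi 0 (-s)).const_mul _),
    integral_finsetSum _ fun l _ => ((hi l 0).const_mul _).const_mul _]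
  simp only [integral_const_mul, integral_slice_fourierSchwartz, hm]
  rw [regFourier, mul_sub, mul_sub, Finset.mul_sum]
  congr 1
  · simp only [Function.iterate_zero, id]
    ring
  · exact Finset.sum_congr rfl fun l _ => by ring

/-! ### The regularized integral -/

/-- The regularized integrand at central frequency `±μ`. -/
def regSymbol {n : ℕ} (c : ℂ) (η : ℕ → 𝓢(Heis n, ℂ)) (x : Horiz n) (μ : ℝ) : ℂ :=
  dyadicSymbol c η (heisPt x μ) - (-1) ^ n * dyadicSymbol c η (heisPt x (-μ))
    - ∑ l ∈ Finset.range n, (1 - (-1) ^ (n + l)) * ((μ : ℂ) ^ l * dyadicTerm c η l x)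

theorem hasSum_regPiece {n : ℕ} (c : ℂ) {η : ℕ → 𝓢(Heis n, ℂ)} (h0 : η 0 0 = 0) {x : Horiz n}
    {μ : ℝ} (hμ : μ ≠ 0) (hx : x ≠ 0 ∨ n = 0) :
    HasSum (fun j : ℤ => regPiece η ((2 : ℝ) ^ j • x) ((4 : ℝ) ^ j * μ)) (regSymbol c η x μ) := by
  by_cases hx0 : x = 0
  -- For `n = 0` the horizontal layer is a single point, of full measure. No Taylor term is
  -- subtracted then, and the series converges because the central coordinate is nonzero.
  · obtain rfl : n = 0 := hx.resolve_left (not_not.2 hx0)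
    have h1 : ∀ u : ℝ, u ≠ 0 → HasSum (fun j : ℤ => dyadic j (η 0) (heisPt x u))
        (dyadicSum 0 (η 0) (heisPt x u)) := by
      intro u hu
      have := (summable_dyadic (η 0) (l := 0) (Or.inr h0) (heisPt_ne_zero_of_right x hu)).hasSum
      simpa only [pow_zero, one_mul, dyadicSum] using this
    have h2 := (h1 μ hμ).sub (h1 (-μ) (neg_ne_zero.2 hμ))
    simp only [dyadic_apply] at h2
    simpa [regPiece, regSymbol, dyadicSymbol] using h2
  · have h1 := hasSum_taylorRem c h0 n (s := μ) hx0
    have h2 := (hasSum_taylorRem c h0 n (s := -μ) hx0).mul_left ((-1 : ℂ) ^ n)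
    have h3 := h1.sub h2
    simp only [mul_neg, ← regPiece_eq_taylorRem] at h3
    have e : regSymbol c η x μ = dyadicSymbol c η (heisPt x μ)
          - ∑ l ∈ Finset.range (n + 1), (μ : ℂ) ^ l * dyadicTerm c η l x
        - (-1) ^ n * (dyadicSymbol c η (heisPt x (-μ))
          - ∑ l ∈ Finset.range (n + 1), ((-μ : ℝ) : ℂ) ^ l * dyadicTerm c η l x) := by
      have := sum_range_succ_antisymm n μ fun l => dyadicTerm c η l x
      rw [regSymbol, Complex.ofReal_neg, ← this]
      ring
    rw [e]
    exact h3

theorem ae_ne_zero_or (n : ℕ) : ∀ᵐ x : Horiz n, x ≠ 0 ∨ n = 0 := by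
  rcases Nat.eq_zero_or_pos n with rfl | hn
  · exact ae_of_all _ fun x => Or.inr rfl
  · have : Nonempty (Fin n ⊕ Fin n) := ⟨Sum.inl ⟨0, hn⟩⟩
    have h : ∀ᵐ x : Horiz n, x ≠ 0 := by
      rw [ae_iff]
      simp
    exact h.mono fun x hx => Or.inl hx

theorem min_mul_le {a μ : ℝ} (ha : 0 < a) (hμ : 0 < μ) :
    min (a * μ) (a * μ)⁻¹ ≤ (μ + μ⁻¹) * min a a⁻¹ := by
  have h : 0 < μ⁻¹ := inv_pos.2 hμ
  rcases le_total a a⁻¹ with h1 | h1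
  · rw [min_eq_left h1]
    refine (min_le_left _ _).trans ?_
    nlinarith
  · rw [min_eq_right h1]
    refine (min_le_right _ _).trans ?_
    rw [mul_inv]
    have : 0 < a⁻¹ := inv_pos.2 ha
    nlinarith

theorem summable_min_four_zpow (μ : ℝ) (hμ : 0 < μ) :
    Summable fun j : ℤ => min ((4 : ℝ) ^ j * μ) ((4 : ℝ) ^ j * μ)⁻¹ := by
  refine (summable_min_two_zpow.mul_left (μ + μ⁻¹)).of_nonneg_of_le
    (fun j => by positivity) fun j => ?_
  refine (min_mul_le (by positivity) hμ).trans ?_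
  have hp : 0 < μ⁻¹ := inv_pos.2 hμ
  gcongr ?_ * ?_
  have h2 := two_zpow_pos j
  have h4 : (4 : ℝ) ^ j = (2 : ℝ) ^ j * (2 : ℝ) ^ j := by rw [← mul_zpow]; norm_num
  rw [h4]
  set r := (2 : ℝ) ^ j
  rcases le_total r 1 with h1 | h1
  · rw [min_eq_left (h1.trans ((one_le_inv₀ h2).2 h1))]
    exact (min_le_left _ _).trans (mul_le_of_le_one_right h2.le h1)
  · rw [min_eq_right ((inv_le_one_of_one_le₀ h1).trans h1)]
    refine (min_le_right _ _).trans (inv_anti₀ h2 ?_)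
    exact le_mul_of_one_le_right h2.le h1

theorem integral_comp_two_zpow_smul {n : ℕ} {E : Type*} [NormedAddCommGroup E] [NormedSpace ℝ E]
    (F : Horiz n → E) (j : ℤ) :
    ∫ x, F ((2 : ℝ) ^ j • x) = (((4 : ℝ) ^ j) ^ n)⁻¹ • ∫ x, F x := by
  rw [Measure.integral_comp_smul_of_nonneg volume F _ (hR := (two_zpow_pos j).le), finrank_horiz]
  congr 2
  rw [pow_mul, ← zpow_natCast _ 2, ← zpow_mul, mul_comm j, zpow_mul]
  norm_num

/-- The Jacobian `4^{-jn}` of the horizontal dilation cancels the factor `s^n` in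
`norm_regPiece_le`, leaving the summable `min s s⁻¹` at `s = 4^j μ`. -/
theorem hasSum_integral_regPiece {n : ℕ} (c : ℂ) {η : ℕ → 𝓢(Heis n, ℂ)} (hη : IsCentralDerivSeq η)
    (h0 : η 0 0 = 0) {μ : ℝ} (hμ : 0 < μ) :
    Integrable (fun x => regSymbol c η x μ) ∧
    HasSum (fun j : ℤ => (((4 : ℝ) ^ j) ^ n)⁻¹ • ∫ x, regPiece η x ((4 : ℝ) ^ j * μ))
      (∫ x, regSymbol c η x μ) := by
  obtain ⟨C, hC, hb⟩ := norm_regPiece_le hη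
  have hpos : ∀ j : ℤ, 0 < (4 : ℝ) ^ j * μ := fun j => by positivity
  have hint : ∀ j : ℤ, Integrable fun x : Horiz n =>
      regPiece η ((2 : ℝ) ^ j • x) ((4 : ℝ) ^ j * μ) := fun j =>
    (integrable_regPiece hη (hpos j)).comp_smul (two_zpow_pos j).ne'
  have hsum : Summable fun j : ℤ =>
      ∫ x : Horiz n, ‖regPiece η ((2 : ℝ) ^ j • x) ((4 : ℝ) ^ j * μ)‖ := by
    refine ((summable_min_four_zpow μ hμ).mul_left
      (C * μ ^ n * ∫ x : Horiz n, horizWeight x)).of_nonneg_of_le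
      (fun j => integral_nonneg fun x => norm_nonneg _) fun j => ?_
    rw [integral_comp_two_zpow_smul (fun x => ‖regPiece η x ((4 : ℝ) ^ j * μ)‖), smul_eq_mul]
    have h1 : ∫ x : Horiz n, ‖regPiece η x ((4 : ℝ) ^ j * μ)‖
        ≤ ∫ x : Horiz n, C * (((4 : ℝ) ^ j * μ) ^ n
          * min ((4 : ℝ) ^ j * μ) ((4 : ℝ) ^ j * μ)⁻¹) * horizWeight x :=
      integral_mono (integrable_regPiece hη (hpos j)).norm
        ((integrable_horizWeight n).const_mul _) fun x => hb x _ (hpos j)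
    rw [integral_const_mul] at h1
    calc _ ≤ (((4 : ℝ) ^ j) ^ n)⁻¹ * (C * (((4 : ℝ) ^ j * μ) ^ n
          * min ((4 : ℝ) ^ j * μ) ((4 : ℝ) ^ j * μ)⁻¹) * ∫ x : Horiz n, horizWeight x) := by gcongr
      _ = _ := by
        rw [mul_pow]
        have : ((4 : ℝ) ^ j) ^ n ≠ 0 := by positivity
        field_simp
  have := integrable_of_hasSum_integral_norm hint hsum
    ((ae_ne_zero_or n).mono fun x hx => hasSum_regPiece c h0 hμ.ne' hx)
  refine ⟨this.1, ?_⟩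
  have h2 := this.2
  simp only [fun j : ℤ => integral_comp_two_zpow_smul (n := n)
    (fun x => regPiece η x ((4 : ℝ) ^ j * μ)) j] at h2
  exact h2

/-- Substitute `√μ • x`: the dilation by `√μ` takes central frequency `±1` to `±μ`, and the Jacobian
in dimension `2n` is `μ^n`. -/
theorem integral_regSymbol {n : ℕ} {c : ℂ} {η : ℕ → 𝓢(Heis n, ℂ)} (hη : IsCentralDerivSeq η)
    (h0 : η 0 0 = 0) (hhom : ∀ (r : ℝ) (hr : 0 < r) (z : Heis n), z ≠ 0 →
      dyadicSymbol c η (dilation n r hr.ne' z) = dyadicSymbol c η z) {μ : ℝ} (hμ : 0 < μ) :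
    ∫ x, regSymbol c η x μ = (μ : ℂ) ^ n * ∫ x, regSymbol c η x 1 := by
  have hr : 0 < √μ := Real.sqrt_pos.2 hμ
  have hs := Measure.integral_comp_smul_of_nonneg volume
    (fun x : Horiz n => regSymbol c η x μ) (√μ) (hR := hr.le)
  have hae : ∀ᵐ x : Horiz n, regSymbol c η (√μ • x) μ = regSymbol c η x 1 := by
    filter_upwards [ae_ne_zero_or n] with x hx
    have hσ : ∀ ε : ℝ, ε ≠ 0 → dyadicSymbol c η (heisPt (√μ • x) (μ * ε))
        = dyadicSymbol c η (heisPt x ε) := by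
      intro ε hε
      rw [← hhom _ hr _ (heisPt_ne_zero_of_right x hε), dilation_apply, Real.sq_sqrt hμ.le]
    have h1 := hσ 1 one_ne_zero
    have h2 := hσ (-1) (by norm_num)
    rw [mul_one] at h1
    rw [mul_neg_one] at h2
    simp only [regSymbol]
    rw [h1, h2]
    congr 1
    refine Finset.sum_congr rfl fun l hl => ?_
    have hn : n ≠ 0 := fun h => by simp [h] at hl
    rw [dyadicTerm_smul hη h0 hhom l hr (hx.resolve_right hn), zpow_neg, zpow_mul]
    have : ((√μ : ℝ) : ℂ) ^ (2 : ℤ) = μ := by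
      norm_cast
      rw [Real.sq_sqrt hμ.le]
    rw [this, zpow_natCast]
    have : (μ : ℂ) ≠ 0 := by exact_mod_cast hμ.ne'
    simp only [Complex.ofReal_one, one_pow, one_mul]
    field_simp
  rw [integral_congr_ae hae, finrank_horiz, pow_mul, Real.sq_sqrt hμ.le, Complex.real_smul] at hs
  rw [hs]
  have : (μ : ℂ) ≠ 0 := by exact_mod_cast hμ.ne'
  push_cast
  field_simp

theorem continuous_lineFourier {H : ℝ → ℂ} (hc : Continuous H) (hi : Integrable H) :
    Continuous (lineFourier H) := by
  refine continuous_of_dominated (bound := fun t => ‖H t‖) (fun s => ?_) (fun s => ?_) hi.norm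
    (ae_of_all _ fun t => ?_)
  · exact Continuous.aestronglyMeasurable (by fun_prop)
  · refine ae_of_all _ fun t => ?_
    rw [norm_mul, norm_exp_neg_I_mul, mul_one]
  · fun_prop

theorem continuous_regFourier (n : ℕ) {H : ℝ → ℂ} (hc : Continuous H) (hi : Integrable H) :
    Continuous (regFourier n H) := by
  have := continuous_lineFourier hc hi
  unfold regFourier
  fun_prop

/-- Integrating `norm_regPiece_le` over `x` bounds `regFourier` by a multiple of `s^n min s s⁻¹`;
after division by `s^{n+1}` this is at most a multiple of `1 / (1 + s²)`. -/
theorem integrableOn_regFourier_div {n : ℕ} (h : 𝓢(Heis n, ℂ))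
    (hc : Continuous (regFourier n fun t => h (heisPt 0 t))) :
    IntegrableOn (fun s : ℝ => regFourier n (fun t => h (heisPt 0 t)) s / (s : ℂ) ^ (n + 1))
      (Ioi 0) := by
  obtain ⟨C, hC, hb⟩ := norm_regPiece_le (isCentralDerivSeq_fourierSchwartz h)
  set B := ∫ x : Horiz n, horizWeight x
  have hB : 0 ≤ B := integral_nonneg fun x => horizWeight_nonneg x
  have hpi : (1 : ℝ) ≤ (2 * Real.pi) ^ (2 * n) :=
    one_le_pow₀ (by linarith [Real.two_le_pi])
  have hG : ∀ s : ℝ, 0 < s → ‖regFourier n (fun t => h (heisPt 0 t)) s‖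
      ≤ C * (s ^ n * min s s⁻¹) * B := by
    intro s hs
    have h1 : ‖(2 * (Real.pi : ℂ)) ^ (2 * n) * regFourier n (fun t => h (heisPt 0 t)) s‖
        ≤ C * (s ^ n * min s s⁻¹) * B := by
      rw [← integral_regPiece]
      refine (norm_integral_le_integral_norm _).trans ?_
      rw [← integral_const_mul]
      exact integral_mono (integrable_regPiece (isCentralDerivSeq_fourierSchwartz h) hs).norm
        ((integrable_horizWeight n).const_mul _) fun x => hb x s hs
    refine le_trans ?_ h1
    rw [norm_mul]
    have : ‖(2 * (Real.pi : ℂ)) ^ (2 * n)‖ = (2 * Real.pi) ^ (2 * n) := by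
      rw [norm_pow, norm_mul, Complex.norm_real, Real.norm_eq_abs, abs_of_pos Real.pi_pos]
      simp
    rw [this]
    exact le_mul_of_one_le_left (norm_nonneg _) hpi
  refine ((integrable_inv_one_add_sq.integrableOn (s := Ioi 0)).const_mul (C * B * 2)).mono' ?_ ?_
  · refine (hc.aestronglyMeasurable).mul ?_
    exact Measurable.aestronglyMeasurable (by fun_prop)
  · filter_upwards [ae_restrict_mem measurableSet_Ioi] with s hs
    have hs : 0 < s := hs
    rw [norm_div, norm_pow, Complex.norm_real, Real.norm_eq_abs, abs_of_pos hs,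
      div_le_iff₀ (by positivity)]
    refine (hG s hs).trans ?_
    have hmin : min s s⁻¹ ≤ 2 * (1 + s ^ 2)⁻¹ * s := by
      rw [← div_eq_mul_inv, div_mul_eq_mul_div, le_div_iff₀ (by positivity)]
      rcases le_total s 1 with h1 | h1
      · calc _ ≤ s * (1 + s ^ 2) := by gcongr; exact min_le_left _ _
          _ ≤ 2 * s := by nlinarith
      · calc _ ≤ s⁻¹ * (1 + s ^ 2) := by gcongr; exact min_le_right _ _
          _ ≤ s⁻¹ * (2 * s ^ 2) := by gcongr; nlinarith
          _ = 2 * s := by field_simp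
    calc _ ≤ C * (s ^ n * (2 * (1 + s ^ 2)⁻¹ * s)) * B := by gcongr
      _ = _ := by ring

theorem integral_regSymbol_eq {n : ℕ} {c : ℂ} {h : 𝓢(Heis n, ℂ)} {a b : ℂ}
    (hs : HasCompactSupport fun t => h (heisPt 0 t))
    (h0 : fourierSchwartz n h 0 = 0)
    (hhom : ∀ (r : ℝ) (hr : 0 < r) (z : Heis n), z ≠ 0 →
      dyadicSymbol c (fun l => fourierSchwartz n ((centralMul n)^[l] h)) (dilation n r hr.ne' z)
        = dyadicSymbol c (fun l => fourierSchwartz n ((centralMul n)^[l] h)) z)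
    (ha : ∀ μ : ℝ, 0 < μ → HasSum (fun j : ℤ => ((((4 : ℝ) ^ j * μ : ℝ) : ℂ)) ^ (n + 1)
      * h (heisPt 0 ((4 : ℝ) ^ j * μ))) a)
    (hb : ∀ μ : ℝ, 0 < μ → HasSum (fun j : ℤ => ((((4 : ℝ) ^ j * μ : ℝ) : ℂ)) ^ (n + 1)
      * h (heisPt 0 (-((4 : ℝ) ^ j * μ)))) b) :
    ∫ x, regSymbol c (fun l => fourierSchwartz n ((centralMul n)^[l] h)) x 1
      = (2 * (Real.pi : ℂ)) ^ (2 * n) * (Real.pi * (-Complex.I) ^ (n + 1) / (n.factorial : ℂ))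
        * (a - (-1) ^ n * b) := by
  set η : ℕ → 𝓢(Heis n, ℂ) := fun l => fourierSchwartz n ((centralMul n)^[l] h) with hηdef
  have hη : IsCentralDerivSeq η := isCentralDerivSeq_fourierSchwartz h
  set K := ∫ x, regSymbol c η x 1 with hK
  set H : ℝ → ℂ := fun t => h (heisPt 0 t) with hH
  have hpi : (2 * (Real.pi : ℂ)) ^ (2 * n) ≠ 0 :=
    pow_ne_zero _ (mul_ne_zero two_ne_zero (by exact_mod_cast Real.pi_ne_zero))
  have hc : Continuous H := h.continuous.comp (continuous_heisPt_right 0)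
  have hHi : Integrable H := hc.integrable_of_hasCompactSupport hs
  have hG := continuous_regFourier n hc hHi
  have hGi := integrableOn_regFourier_div h hG
  have hlog : (Real.log 4 : ℂ) ≠ 0 := by
    exact_mod_cast (Real.log_pos (by norm_num : (1 : ℝ) < 4)).ne'
  -- Unfolding on the symbol side: knowing the integral at every frequency `μ` makes the dyadic sum
  -- independent of `μ`, as the unfolding requires.
  have e1 : ∫ s : ℝ in Ioi 0, regFourier n H s / (s : ℂ) ^ (n + 1)
      = Real.log 4 * (K / (2 * (Real.pi : ℂ)) ^ (2 * n)) := by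
    refine integral_Ioi_eq_of_hasSum hGi fun μ hμ => ?_
    have h1 := (hasSum_integral_regPiece c hη h0 hμ).2
    rw [integral_regSymbol hη h0 hhom hμ] at h1
    have h2 := h1.mul_left (((2 * (Real.pi : ℂ)) ^ (2 * n))⁻¹ * ((μ : ℂ) ^ n)⁻¹)
    have hμ0 : (μ : ℂ) ≠ 0 := by exact_mod_cast hμ.ne'
    have e : ((2 * (Real.pi : ℂ)) ^ (2 * n))⁻¹ * ((μ : ℂ) ^ n)⁻¹ * ((μ : ℂ) ^ n * K)
        = K / (2 * (Real.pi : ℂ)) ^ (2 * n) := by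
      field_simp
    rw [← hK, e] at h2
    refine h2.congr_fun ?_
    intro j
    simp only [hηdef, integral_regPiece, Complex.real_smul]
    have h4 : (((4 : ℝ) ^ j : ℝ) : ℂ) ≠ 0 := by
      exact_mod_cast (by positivity : (0 : ℝ) < (4 : ℝ) ^ j).ne'
    push_cast at h4 ⊢
    field_simp
    ring
  have key : ∀ (H' : ℝ → ℂ), Continuous H' → HasCompactSupport H' → ∀ a : ℂ,
      (∀ μ : ℝ, 0 < μ → HasSum (fun j : ℤ => ((((4 : ℝ) ^ j * μ : ℝ) : ℂ)) ^ (n + 1)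
        * H' ((4 : ℝ) ^ j * μ)) a) → ∫ t : ℝ in Ioi 0, (t : ℂ) ^ n * H' t = Real.log 4 * a := by
    intro H' hc' hs' a ha
    refine integral_Ioi_eq_of_hasSum
      (Continuous.integrable_of_hasCompactSupport (by fun_prop) hs'.mul_left).integrableOn
      fun μ hμ => ?_
    refine (ha μ hμ).congr_fun fun j => ?_
    rw [Pi.mul_apply]
    ring
  have e2 := integral_regFourier_div n hc hs hG.aestronglyMeasurable hGi
  rw [e1, key H hc hs a ha, key (fun t => H (-t)) (hc.comp continuous_neg)
    (hs.comp_homeomorph (Homeomorph.neg ℝ)) b hb] at e2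
  have hfac : (n.factorial : ℂ) ≠ 0 := by exact_mod_cast n.factorial_ne_zero
  have e3 : K * (n.factorial : ℂ) = (2 * (Real.pi : ℂ)) ^ (2 * n)
      * (Real.pi * (-Complex.I) ^ (n + 1)) * (a - (-1) ^ n * b) := by
    -- Both sides carry the factor `log 4` left by unfolding.
    refine mul_left_cancel₀ hlog ?_
    rw [mul_div_assoc', mul_div_assoc', div_eq_iff hpi] at e2
    linear_combination e2
  rw [mul_div_assoc', div_mul_eq_mul_div, eq_div_iff hfac, e3]

/-! ### The trace -/

theorem isSmoothPart_smoothPart {n : ℕ} {u : 𝓢'(Heis n, ℂ)} (h : IsRegularDistribution u) :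
    IsSmoothPart u (smoothPart u) := by
  rw [smoothPart, dif_pos h]
  exact h.choose_spec

/-- Homogeneity with the dilation `√s` gives `f(0, sε) = s^{-(n+1)} f(0, ε)`, as `Q = 2(n + 1)`; the
weights `s^{n+1}` undo this and the partition of unity is left. -/
theorem hasSum_kernel_central {n : ℕ} {f : Heis n → ℂ} {h : 𝓢(Heis n, ℂ)}
    (hh : ∀ z, h z = f z * annulusCutoff n z)
    (hf : ∀ (r : ℝ) (hr : 0 < r) (z : Heis n), z ≠ 0 →
      f (dilation n r hr.ne' z) = (r : ℂ) ^ (-(homDim n : ℤ)) * f z) {ε : ℝ} (hε : ε ≠ 0) {μ : ℝ}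
    (hμ : 0 < μ) : HasSum (fun j : ℤ => ((((4 : ℝ) ^ j * μ : ℝ) : ℂ)) ^ (n + 1)
      * h (heisPt 0 ((4 : ℝ) ^ j * μ * ε))) (f (heisPt 0 ε)) := by
  have h1 := (hasSum_annulusCutoff (heisPt_ne_zero_of_right (n := n) 0
    (mul_ne_zero hμ.ne' hε))).mul_left (f (heisPt 0 ε))
  rw [mul_one] at h1
  refine h1.congr_fun ?_
  intro j
  have hs : 0 < (4 : ℝ) ^ j * μ := by positivity
  set s := (4 : ℝ) ^ j * μ with hsdef
  have hr : 0 < √s := Real.sqrt_pos.2 hs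
  have e1 : f (heisPt 0 (s * ε)) = ((s : ℂ) ^ (n + 1))⁻¹ * f (heisPt 0 ε) := by
    have := hf _ hr _ (heisPt_ne_zero_of_right (n := n) 0 hε)
    rw [dilation_apply, smul_zero, Real.sq_sqrt hs.le] at this
    rw [this, zpow_neg, zpow_natCast, homDim, show 2 * n + 2 = 2 * (n + 1) by ring, pow_mul]
    congr 3
    norm_cast
    exact Real.sq_sqrt hs.le
  have hs0 : (s : ℂ) ^ (n + 1) ≠ 0 := pow_ne_zero _ (by exact_mod_cast hs.ne')
  rw [hh, e1, dyadic_apply, smul_zero, ← mul_assoc ((4 : ℝ) ^ j), ← hsdef]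
  field_simp

theorem hasCompactSupport_central {n : ℕ} {f : Heis n → ℂ} {h : 𝓢(Heis n, ℂ)}
    (hh : ∀ z, h z = f z * annulusCutoff n z) : HasCompactSupport fun t => h (heisPt 0 t) := by
  refine HasCompactSupport.intro (isCompact_Icc (a := (-2 : ℝ)) (b := 2)) fun t ht => ?_
  rw [hh, annulusCutoff_eq_zero_of_le, mul_zero]
  refine le_trans ?_ (abs_le_norm_heisPt 0 t)
  rw [mem_Icc, ← abs_le, not_le] at ht
  exact ht.le

theorem symbol_properties {n : ℕ} (k : Symb n) :
    IsRegularDistribution (fourierDist (k : 𝓢'(Heis n, ℂ))) ∧ (∃ w, IsSymbolExpansion k w) ∧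
      Integrable (regIntegrand k) ∧ tau k =
        ((2 * (Real.pi : ℂ)) ^ (n + 1) / (2 * (n.factorial : ℂ) * Complex.I ^ (n + 1))) *
          (smoothPart (k : 𝓢'(Heis n, ℂ)) (heisPt 0 1)
            - (-1) ^ n * smoothPart (k : 𝓢'(Heis n, ℂ)) (heisPt 0 (-1))) := by
  obtain ⟨⟨k, hreg, hk⟩, rfl⟩ : ∃ k' : Symb n, k = k' := ⟨k, rfl⟩
  set K : Symb n := ⟨k, hreg, hk⟩
  change IsRegularDistribution (fourierDist k) ∧ _ ∧ _ ∧ tau K = _ * (smoothPart k _ - _ * smoothPart k _)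
  have hf := isSmoothPart_smoothPart hreg
  set f := smoothPart k
  obtain ⟨h, hh⟩ := exists_schwartz_eq_mul hf.1 (hasCompactSupport_annulusCutoff n)
    (zero_notMem_tsupport_annulusCutoff n)
  obtain ⟨h0, hκ⟩ := isSmoothPart_fourierDist hf hk hh
  set c := k (originCutoff n)
  set η : ℕ → 𝓢(Heis n, ℂ) := fun l => fourierSchwartz n ((centralMul n)^[l] h) with hηdef
  have hη : IsCentralDerivSeq η := isCentralDerivSeq_fourierSchwartz h
  have hκ' : IsSmoothPart (fourierDist k) (dyadicSymbol c η) := hκ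
  have hregF : IsRegularDistribution (fourierDist k) := ⟨_, hκ'⟩
  have hhom : ∀ (r : ℝ) (hr : 0 < r) (z : Heis n), z ≠ 0 →
      dyadicSymbol c η (dilation n r hr.ne' z) = dyadicSymbol c η z := fun r hr z hz => by
    rw [hκ'.dilation_eq hk.fourierDist hr hz, zpow_zero, one_mul]
  -- The smooth part and the terms `symbolTerm` are arbitrary choices; uniqueness off the origin
  -- identifies them with the explicit dyadic series.
  have hσ : ∀ z : Heis n, z ≠ 0 → smoothPart (fourierDist k) z = dyadicSymbol c η z :=
    fun z hz => (isSmoothPart_smoothPart hregF).eq hκ' hz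
  have hplus : sigmaPlus K = fun x => dyadicSymbol c η (heisPt x 1) :=
    funext fun x => hσ _ (heisPt_ne_zero_of_right x one_ne_zero)
  have hminus : sigmaMinus K = fun x => dyadicSymbol c η (heisPt x (-1)) :=
    funext fun x => hσ _ (heisPt_ne_zero_of_right x (by norm_num))
  have hexp : IsSymbolExpansion K (dyadicTerm c η) := by
    refine ⟨contDiffOn_dyadicTerm c h0,
      fun l r x hr hx => dyadicTerm_smul hη h0 hhom l hr hx, ?_, ?_⟩
    · rw [hplus]
      simpa using dyadicSymbol_expansion hη h0 hhom (ε := 1) (by simp)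
    · rw [hminus]
      simpa using dyadicSymbol_expansion hη h0 hhom (ε := -1) (by simp)
  have hterm : ∀ (l : ℕ) (x : Horiz n), x ≠ 0 → symbolTerm K l x = dyadicTerm c η l x := by
    intro l x hx
    have hex : ∃ w, IsSymbolExpansion K w := ⟨_, hexp⟩
    have : IsSymbolExpansion K (symbolTerm K) := by
      rw [symbolTerm, dif_pos hex]
      exact hex.choose_spec
    exact this.unique hexp l hx
  have hae : ∀ᵐ x, regIntegrand K x = regSymbol c η x 1 := by
    filter_upwards [ae_ne_zero_or n] with x hx
    rw [regIntegrand, regSymbol, hplus, hminus]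
    congr 1
    refine Finset.sum_congr rfl fun l hl => ?_
    have hn : n ≠ 0 := fun h => by simp [h] at hl
    rw [hterm l x (hx.resolve_right hn)]
    simp
  refine ⟨hregF, ⟨_, hexp⟩,
    ((hasSum_integral_regPiece c hη h0 one_pos).1).congr (hae.mono fun x hx => hx.symm), ?_⟩
  have hfhom := fun (r : ℝ) (hr : 0 < r) (z : Heis n) (hz : z ≠ 0) => hf.dilation_eq hk hr hz
  have hint := integral_regSymbol_eq (c := c) (hasCompactSupport_central hh) h0 hhom
    (a := f (heisPt 0 1)) (b := f (heisPt 0 (-1)))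
    (fun μ hμ => by simpa using hasSum_kernel_central hh hfhom one_ne_zero hμ)
    (fun μ hμ => by
      simpa using hasSum_kernel_central hh hfhom (ε := -1) (by norm_num) hμ)
  rw [tau, integral_congr_ae hae, hint]
  have hpi : (Real.pi : ℂ) ≠ 0 := by exact_mod_cast Real.pi_ne_zero
  have hfac : (n.factorial : ℂ) ≠ 0 := by exact_mod_cast n.factorial_ne_zero
  have hI : (-Complex.I) ^ (n + 1) = 1 / Complex.I ^ (n + 1) := by
    rw [← Complex.inv_I, inv_pow, one_div]
  have hI0 : Complex.I ^ (n + 1) ≠ 0 := pow_ne_zero _ Complex.I_ne_zero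
  rw [hI]
  field_simp
  ring

end

/-- The first three clauses say that `τ` is well defined: the Fourier transform of `k` is a smooth
function off `0`, the functions `σ_±` have the asymptotic expansions that define the terms
`w_{2l}`, and the integrand in `τ(k)` is integrable. -/
theorem theorem3p3 (n : ℕ) :
    (∀ k : Symb n, IsRegularDistribution (fourierDist (k : 𝓢'(Heis n, ℂ))) ∧
      (∃ w, IsSymbolExpansion k w) ∧ Integrable (regIntegrand k)) ∧
    (tau : Symb n → ℂ) =
      ((2 * (Real.pi : ℂ)) ^ (n + 1) / (2 * (n.factorial : ℂ) * Complex.I ^ (n + 1))) •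
        (tauAt (centralPt n 1 one_ne_zero) -
          (-1 : ℂ) ^ n • tauAt (centralPt n (-1) (neg_ne_zero.mpr one_ne_zero))) :=
  ⟨fun k => ⟨(symbol_properties k).1, (symbol_properties k).2.1, (symbol_properties k).2.2.1⟩,
    funext fun k => (symbol_properties k).2.2.2⟩
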